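/- **Setting.** For every sample size $n$ let $t_i=i/n$. Let $(\varepsilon_i)_{i\in\mathbb Z}$ be i.i.d. random elements of a measurable space $S$, $\Upsilon_i=(\dots,\varepsilon_{i-1},\varepsilon_i)$, and let $\Upsilon_{i,k}$ be $\Upsilon_i$ with $\varepsilon_k$ replaced by $\varepsilon_k'$ from an independent copy $(\varepsilon'_i)$. For a vector-valued filter $F(u,\cdot)$, measurable for each $u\in[0,1]$, write $\|V\|_q=(\mathbb E|V|^q)^{1/q}$, $\|\cdot\|=\|\cdot\|_2$, $\delta_q(F,k)=\sup_{u\in[0,1]}\|F(u,\Upsilon_i)-F(u,\Upsilon_{i,i-k})\|_q$ and $\Sigma_F(t)=\sum_{l\in\mathbb Z}\mathrm{cov}(F(t,\Upsilon_0),F(t,\Upsilon_l))$. *Kernels (C1).* $K_d,K_r$ are symmetric probability densities on $\mathbb R$ vanishing outside $[-1,1]$, twice differentiable with bounded second derivative on $(-1,1)$. *Bandwidths (C2).* $h_r,h_d>0$ and $N\in\mathbb N$ depend on $n$, and $n=O(N)$, $nh_r^3\to\infty$, $nh_r^7\to0$, $h_d=o(h_r)$, $Nh_d^3\to\infty$,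 $R_n/h_d\to0$ with $R_n=h_r^2+\log^3 n/\sqrt{nh_r}$. *Curves.* A family $(f_k)$ of functions on $[0,1]$ satisfies (A1) if every $f_k''$ exists and is Lipschitz on $[0,1]$ with a common constant, and (A2) if $\inf_{t\in[0,1]}f_k'(t)\ge M$ for all $k$ with a common $M>0$. *Rearrangement.* For $h>0$, $g:[0,1]\to\mathbb R$ put $g^{-1}_{I,h}(s)=\int_{-\infty}^s\frac1{Nh}\sum_{i=1}^NK_d\big(\frac{g(i/N)-u}{h}\big)\,du$. **(i) High-dimensional trend model.** Let $p=p_n\ge1$ and $y_{i,k}=m_k(t_i)+e_{i,k}$ for $1\le i\le n$, $1\le k\le p$ (the $m_k$ may depend on $n$), where $\mathbf e_i=\mathbf G(t_i,\Upsilon_i)\in\mathbb R^p$ has mean zero and $\mathbf G=\mathbf G_n$. Let all the curves $m_k$ satisfy (A1)–(A2), with constants uniform in $k$ and $n$. Assume that for some constants $\alpha,\chi\in(0,1)$, $q\ge2$, $C>0$, independent of $n$, and some function $\Theta$ of the dimension: * (B1) $\max\{p,\Theta(p)\}=O(n^\alpha)$ and $\sup_{u\in[0,1]}\|\mathbf G(u,\Upsilon_0)\|_q\le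 C\Theta(p)$; * (B2) $\delta_q(\mathbf G,k)\le C\Theta(p)\chi^k$ for all $k\ge0$; * (B3) $\sum_{i=2}^n\|\mathbf G(t_i,\Upsilon_0)-\mathbf G(t_{i-1},\Upsilon_0)\|\le C\Theta(p)$; * (B4) for constants $\Lambda\ge\underline\Lambda>0$, all eigenvalues of $\Sigma_{\mathbf G}(t)$, $t\in[0,1]$, lie in $[\underline\Lambda,\Lambda]$; * (B5) for a constant $\tau>0$, $\mathbb E\exp(\tau|e_{i,k}|)\le C$ for all $i,k,n$. Let $h_{r,k},h_{d,k}>0$ be bandwidths with $\min_kh_{r,k}\asymp h_r\asymp\max_kh_{r,k}$ and $\min_kh_{d,k}\asymp h_d\asymp\max_kh_{d,k}$. Let $\hat m_{k,h}(t)$ be the $\eta_0$-component of a minimiser over $(\eta_0,\eta_1)\in\mathbb R^2$ of $\sum_{i=1}^n\{y_{i,k}-\eta_0-\eta_1(t_i-t)\}^2K_r((t_i-t)/h)$, and put $\hat m_k=\hat m_{k,h_{r,k}}$, $\tilde m_k=2\hat m_{k,h_{r,k}/\sqrt2}-\hat m_k$, $\hat m_{I,k}^{-1}=(\tilde m_k)^{-1}_{I,h_{d,k}}$.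 Let $$\hat{\mathcal T}_k=\{\hat m_{I,k}^{-1}(s):s\in\hat{\mathcal T}_k^{-1}\}\cap[h_d\log h_d^{-1},1-h_d\log h_d^{-1}],\quad \hat{\mathcal T}^{-1}_k=\Big\{s:\min_{1\le i\le N}g_k(i/N)\le s\le\max_{1\le i\le N}g_k(i/N)\Big\}.$$ Then, both for $g_k=\hat m_k$ and for $g_k=\tilde m_k$, the Lebesgue measure of $\hat{\mathcal T}=\bigcap_{k=1}^p\hat{\mathcal T}_k$ converges to $1$ in probability as $n\to\infty$. **(ii) Regression model.** Let $p,s\ge1$ be fixed and $y_i=\mathbf x_i^\top\mathbf m(t_i)+e_i$ with $\mathbf x_i=\mathbf H(t_i,\Upsilon_i)\in\mathbb R^p$, $e_i=G(t_i,\Upsilon_i)$, where the first coordinate of $\mathbf H$ is $1$ and $\mathbb E(\mathbf x_ie_i)=0$. Let $\mathbf m$ be bounded on $[0,1]$, let $\mathbf C\in\mathbb R^{s\times p}$, and let the coordinates of $\mathbf m_{\mathbf C}=\mathbf C\mathbf m$ satisfy (A1)–(A2). With $\mathbf U=\mathbf HG$, assume: * (B1') $\mathbf M(t)=\mathbb E\{\mathbf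 H(t,\Upsilon_0)\mathbf H(t,\Upsilon_0)^\top\}$ is Lipschitz on $[0,1]$ and its smallest eigenvalue is bounded away from $0$; * (B2') $\sup_{u\in[0,1]}\|\mathbf H(u,\Upsilon_0)\|_4<\infty$ and $\|\mathbf H(u,\Upsilon_0)-\mathbf H(v,\Upsilon_0)\|\le L|u-v|$ for all $u,v\in[0,1]$ and some $L>0$; * (B3') $\sup_n\sum_{i=2}^n\|\mathbf U(t_i,\Upsilon_0)-\mathbf U(t_{i-1},\Upsilon_0)\|<\infty$; * (B4') $\delta_4(\mathbf U,k)=O(\chi^k)$ for some $\chi\in(0,1)$ and $\sup_{t\in[0,1]}\|\mathbf U(t,\Upsilon_0)\|_4<\infty$; * (B5') the smallest eigenvalue of $\Sigma_{\mathbf U}(t)$ is bounded away from $0$ on $[0,1]$. Let $\hat{\mathbf m}_h(t)$ be the $\eta_0$-component of a minimiser over $\eta_0,\eta_1\in\mathbb R^p$ of $\sum_{i=1}^n\{y_i-\mathbf x_i^\top\eta_0-\mathbf x_i^\top\eta_1(t_i-t)\}^2K_r((t_i-t)/h)$. Put $\hat{\mathbf m}=\hat{\mathbf m}_{h_r}$,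 $\tilde{\mathbf m}=2\hat{\mathbf m}_{h_r/\sqrt2}-\hat{\mathbf m}_{h_r}$, let $\hat m_{\mathbf C,k},\tilde m_{\mathbf C,k}$ be the coordinates of $\mathbf C\hat{\mathbf m},\mathbf C\tilde{\mathbf m}$, and $\hat m_{\mathbf C,I,k}^{-1}=(\tilde m_{\mathbf C,k})^{-1}_{I,h_d}$. Define $\hat{\mathcal T}_k$, $1\le k\le s$, as in (i) with $\hat m^{-1}_{\mathbf C,I,k}$ in place of $\hat m^{-1}_{I,k}$. Then, both for $g_k=\hat m_{\mathbf C,k}$ and for $g_k=\tilde m_{\mathbf C,k}$, the Lebesgue measure of $\hat{\mathcal T}=\bigcap_{k=1}^s\hat{\mathcal T}_k$ converges to $1$ in probability as $n\to\infty$. (If a minimiser is not unique, an arbitrary one is taken; for possibly non-measurable events, convergence in probability refers to outer probability.) -/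

import Mathlib

open MeasureTheory ProbabilityTheory Filter Topology Asymptotics Set
open scoped ENNReal NNReal

noncomputable section

namespace MonoSCB

/-! ### Kernels, bandwidths and smoothness of the curves -/

/-- Symmetric probability densities supported in `[-1, 1]` with bounded second derivative.
Differentiability is required in the open interval only, so that the Epanechnikov kernel
`x ↦ (3 / 4) * max (1 - x ^ 2) 0` is included. -/
structure IsKernel (K : ℝ → ℝ) : Prop where
  nonneg : ∀ x, 0 ≤ K x
  integral_eq_one : ∫ x, K x = 1
  symm : ∀ x, K (-x) = K x
  support : ∀ x, 1 < |x| → K x = 0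
  diff : ∀ x ∈ Ioo (-1 : ℝ) 1, DifferentiableAt ℝ K x ∧ DifferentiableAt ℝ (deriv K) x
  bdd : ∃ B : ℝ, ∀ x ∈ Ioo (-1 : ℝ) 1, |deriv (deriv K) x| ≤ B

/-- The rate `R_n = h_r ^ 2 + log ^ 3 n / √(n h_r)`. -/
def rateR (hr : ℕ → ℝ) (n : ℕ) : ℝ :=
  hr n ^ 2 + Real.log n ^ 3 / Real.sqrt (n * hr n)

/-- The conditions on the bandwidths `h_r`, `h_d` and on the grid size `N`. -/
structure BandwidthCond (hr hd : ℕ → ℝ) (N : ℕ → ℕ) : Prop where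
  hr_pos : ∀ n, 0 < hr n
  hd_pos : ∀ n, 0 < hd n
  n_bigO : (fun n : ℕ => (n : ℝ)) =O[atTop] (fun n => (N n : ℝ))
  nhr3 : Tendsto (fun n : ℕ => (n : ℝ) * hr n ^ 3) atTop atTop
  nhr7 : Tendsto (fun n : ℕ => (n : ℝ) * hr n ^ 7) atTop (𝓝 0)
  hd_littleO : hd =o[atTop] hr
  Nhd3 : Tendsto (fun n : ℕ => (N n : ℝ) * hd n ^ 3) atTop atTop
  rate : Tendsto (fun n => rateR hr n / hd n) atTop (𝓝 0)

/-- `min_k h_{n,k} ≍ h_n ≍ max_k h_{n,k}` for positive bandwidths `h_{n,k}`, `k < p n`. -/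
def UniformlyComparable {p : ℕ → ℕ} (hk : ∀ n, Fin (p n) → ℝ) (h : ℕ → ℝ) : Prop :=
  (∀ n k, 0 < hk n k) ∧
    ∃ c > (0 : ℝ), ∃ C : ℝ, ∀ᶠ n in atTop, ∀ k, c * h n ≤ hk n k ∧ hk n k ≤ C * h n

/-- On `[0, 1]` every function of the family is twice differentiable, and the second derivatives
are Lipschitz with a common constant. -/
def SmoothFamily {ι : Type*} (f : ι → ℝ → ℝ) : Prop :=
  ∃ L : ℝ≥0, ∀ i,
    DifferentiableOn ℝ (f i) (Icc 0 1) ∧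
    DifferentiableOn ℝ (derivWithin (f i) (Icc 0 1)) (Icc 0 1) ∧
    LipschitzOnWith L (derivWithin (derivWithin (f i) (Icc 0 1)) (Icc 0 1)) (Icc 0 1)

/-- The derivatives on `[0, 1]` are bounded below by a common positive constant. -/
def UniformlyIncreasing {ι : Type*} (f : ι → ℝ → ℝ) : Prop :=
  ∃ M > (0 : ℝ), ∀ i, ∀ t ∈ Icc (0 : ℝ) 1, M ≤ derivWithin (f i) (Icc 0 1) t

/-! ### Causal nonstationary processes -/

section Causal

variable {Ω S : Type*} [MeasurableSpace Ω] [MeasurableSpace S]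

/-- The innovations are i.i.d. random elements of `S`. -/
structure IsInnovation (P : Measure Ω) (ε : ℤ → Ω → S) : Prop where
  meas : ∀ i, Measurable (ε i)
  indep : iIndepFun ε P
  ident : ∀ i, IdentDistrib (ε i) (ε 0) P P

/-- `Υ_i = (…, ε_{i-1}, ε_i)`; the coordinate `j` is `ε_{i-j}`. -/
def past (ε : ℤ → Ω → S) (i : ℤ) (ω : Ω) : ℕ → S := fun j => ε (i - j) ω

/-- `Υ_{i,k}`, that is `Υ_i` with `ε_k` replaced by an independent copy; the copy of the
innovations lives on the second factor of `Ω × Ω`. -/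
def coupledPast (ε : ℤ → Ω → S) (i k : ℤ) (z : Ω × Ω) : ℕ → S :=
  fun j => if i - (j : ℤ) = k then ε k z.2 else ε (i - j) z.1

/-- The physical dependence measure
`δ_q(F, k) = sup_{u ∈ [0,1]} ‖F(u, Υ_i) - F(u, Υ_{i,i-k})‖_q`, at `i = 0`
(it does not depend on `i`, since the innovations are i.i.d.). -/
def physDep (P : Measure Ω) (ε : ℤ → Ω → S) {d : ℕ} (q : ℝ≥0∞)
    (F : ℝ → (ℕ → S) → EuclideanSpace ℝ (Fin d)) (k : ℕ) : ℝ≥0∞ :=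
  ⨆ u ∈ Icc (0 : ℝ) 1,
    eLpNorm (fun z : Ω × Ω => F u (past ε 0 z.1) - F u (coupledPast ε 0 (-(k : ℤ)) z)) q
      (P.prod P)

/-- The long-run covariance matrix `∑_{l ∈ ℤ} cov(F(t, Υ_0), F(t, Υ_l))`. -/
def longRunCov (P : Measure Ω) (ε : ℤ → Ω → S) {d : ℕ}
    (F : ℝ → (ℕ → S) → EuclideanSpace ℝ (Fin d)) (t : ℝ) : Matrix (Fin d) (Fin d) ℝ :=
  Matrix.of fun a b =>
    ∑' l : ℤ, covariance (fun ω => F t (past ε 0 ω) a) (fun ω => F t (past ε l ω) b) P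

/-- `∑_{i=2}^n ‖F(t_i, Υ_0) - F(t_{i-1}, Υ_0)‖_2` with `t_i = i / n`. -/
def totalVariation (P : Measure Ω) (ε : ℤ → Ω → S) {d : ℕ}
    (F : ℝ → (ℕ → S) → EuclideanSpace ℝ (Fin d)) (n : ℕ) : ℝ≥0∞ :=
  ∑ i ∈ Finset.Icc 2 n,
    eLpNorm (fun ω => F ((i : ℝ) / n) (past ε 0 ω) - F (((i : ℝ) - 1) / n) (past ε 0 ω)) 2 P

/-- The assumptions on the error process `e_{i,n} = G_n(i / n, Υ_i)` of dimension `p n`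
in the high-dimensional trend model. -/
structure TrendErrorCond (P : Measure Ω) (ε : ℤ → Ω → S) (p : ℕ → ℕ) (Θ : ℕ → ℝ)
    (G : ∀ n, ℝ → (ℕ → S) → EuclideanSpace ℝ (Fin (p n))) (α χ q C : ℝ) : Prop where
  meas : ∀ n, ∀ u ∈ Icc (0 : ℝ) 1, Measurable (G n u)
  mean_zero : ∀ n, ∀ i ∈ Finset.Icc 1 n, ∀ k,
    ∫ ω, G n ((i : ℝ) / n) (past ε i ω) k ∂P = 0
  dim : (fun n => max (p n : ℝ) (Θ (p n))) =O[atTop] (fun n : ℕ => (n : ℝ) ^ α)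
  moment : ∀ n, ∀ u ∈ Icc (0 : ℝ) 1,
    eLpNorm (fun ω => G n u (past ε 0 ω)) (ENNReal.ofReal q) P ≤ ENNReal.ofReal (C * Θ (p n))
  dep : ∀ n k, physDep P ε (ENNReal.ofReal q) (G n) k ≤ ENNReal.ofReal (C * Θ (p n) * χ ^ k)
  variation : ∀ n, totalVariation P ε (G n) n ≤ ENNReal.ofReal (C * Θ (p n))
  eigen : ∃ lo > (0 : ℝ), ∃ hi : ℝ, ∀ n, ∀ t ∈ Icc (0 : ℝ) 1,
    ∀ μ ∈ spectrum ℝ (longRunCov P ε (G n) t), lo ≤ μ ∧ μ ≤ hi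
  exp_moment : ∃ τ > (0 : ℝ), ∀ n, ∀ i ∈ Finset.Icc 1 n, ∀ k,
    ∫⁻ ω, ENNReal.ofReal (Real.exp (τ * |G n ((i : ℝ) / n) (past ε i ω) k|)) ∂P
      ≤ ENNReal.ofReal C

/-- The filter `U = H G` that generates `x_i e_i`. -/
def productFilter {d : ℕ} (H : ℝ → (ℕ → S) → EuclideanSpace ℝ (Fin d)) (G : ℝ → (ℕ → S) → ℝ) :
    ℝ → (ℕ → S) → EuclideanSpace ℝ (Fin d) :=
  fun t υ => G t υ • H t υ

/-- `M(t) = E {H(t, Υ_0) H(t, Υ_0)ᵀ}`. -/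
def secondMoment (P : Measure Ω) (ε : ℤ → Ω → S) {d : ℕ}
    (H : ℝ → (ℕ → S) → EuclideanSpace ℝ (Fin d)) (t : ℝ) : Matrix (Fin d) (Fin d) ℝ :=
  Matrix.of fun a b => ∫ ω, H t (past ε 0 ω) a * H t (past ε 0 ω) b ∂P

/-- The assumptions on the covariates `x_i = H(i / n, Υ_i)` and on the errors
`e_i = G(i / n, Υ_i)` in the regression model. -/
structure RegressionCond (P : Measure Ω) (ε : ℤ → Ω → S) {d : ℕ} (hd : 0 < d)
    (H : ℝ → (ℕ → S) → EuclideanSpace ℝ (Fin d)) (G : ℝ → (ℕ → S) → ℝ) : Prop where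
  meas_H : ∀ u ∈ Icc (0 : ℝ) 1, Measurable (H u)
  meas_G : ∀ u ∈ Icc (0 : ℝ) 1, Measurable (G u)
  intercept : ∀ u ∈ Icc (0 : ℝ) 1, ∀ υ, H u υ ⟨0, hd⟩ = 1
  mean_zero : ∀ n : ℕ, ∀ i ∈ Finset.Icc 1 n, ∀ a,
    ∫ ω, productFilter H G ((i : ℝ) / n) (past ε i ω) a ∂P = 0
  design_lipschitz : ∃ L : ℝ≥0, ∀ a b,
    LipschitzOnWith L (fun t => secondMoment P ε H t a b) (Icc 0 1)
  design_eigen : ∃ c > (0 : ℝ), ∀ t ∈ Icc (0 : ℝ) 1,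
    ∀ μ ∈ spectrum ℝ (secondMoment P ε H t), c ≤ μ
  moment_H : ∃ C : ℝ, ∀ u ∈ Icc (0 : ℝ) 1,
    eLpNorm (fun ω => H u (past ε 0 ω)) 4 P ≤ ENNReal.ofReal C
  lipschitz_H : ∃ L > (0 : ℝ), ∀ u ∈ Icc (0 : ℝ) 1, ∀ v ∈ Icc (0 : ℝ) 1,
    eLpNorm (fun ω => H u (past ε 0 ω) - H v (past ε 0 ω)) 2 P ≤ ENNReal.ofReal (L * |u - v|)
  variation : ∃ C : ℝ, ∀ n, totalVariation P ε (productFilter H G) n ≤ ENNReal.ofReal C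
  dep : ∃ χ ∈ Ioo (0 : ℝ) 1, ∃ C : ℝ, ∀ k,
    physDep P ε 4 (productFilter H G) k ≤ ENNReal.ofReal (C * χ ^ k)
  moment_U : ∃ C : ℝ, ∀ u ∈ Icc (0 : ℝ) 1,
    eLpNorm (fun ω => productFilter H G u (past ε 0 ω)) 4 P ≤ ENNReal.ofReal C
  eigen : ∃ c > (0 : ℝ), ∀ t ∈ Icc (0 : ℝ) 1,
    ∀ μ ∈ spectrum ℝ (longRunCov P ε (productFilter H G) t), c ≤ μ

end Causal

/-! ### Local linear estimators -/

/-- The local linear criterion at `t` for scalar observations `y_1, …, y_n` at `t_i = i / n`. -/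
def llObjective (n : ℕ) (K : ℝ → ℝ) (h : ℝ) (y : ℕ → ℝ) (t : ℝ) (η : ℝ × ℝ) : ℝ :=
  ∑ i ∈ Finset.Icc 1 n,
    (y i - η.1 - η.2 * ((i : ℝ) / n - t)) ^ 2 * K (((i : ℝ) / n - t) / h)

/-- The local linear estimator of the curve: the first component of a minimiser of the criterion
(an arbitrary minimiser is chosen in case there are several). -/
def localLinear (n : ℕ) (K : ℝ → ℝ) (h : ℝ) (y : ℕ → ℝ) (t : ℝ) : ℝ :=
  (Classical.epsilon fun η : ℝ × ℝ =>
    ∀ η', llObjective n K h y t η ≤ llObjective n K h y t η').1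

/-- The jackknife bias-corrected estimator. -/
def jackknife (n : ℕ) (K : ℝ → ℝ) (h : ℝ) (y : ℕ → ℝ) (t : ℝ) : ℝ :=
  2 * localLinear n K (h / Real.sqrt 2) y t - localLinear n K h y t

/-- The local linear criterion at `t` for the time-varying coefficient regression of `y` on `x`. -/
def regObjective {d : ℕ} (n : ℕ) (K : ℝ → ℝ) (h : ℝ) (x : ℕ → EuclideanSpace ℝ (Fin d))
    (y : ℕ → ℝ) (t : ℝ) (η : EuclideanSpace ℝ (Fin d) × EuclideanSpace ℝ (Fin d)) : ℝ :=
  ∑ i ∈ Finset.Icc 1 n,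
    (y i - inner ℝ (x i) η.1 - inner ℝ (x i) η.2 * ((i : ℝ) / n - t)) ^ 2
      * K (((i : ℝ) / n - t) / h)

/-- The local linear estimator of the coefficient vector (an arbitrary minimiser is chosen in case
there are several). -/
def regLocalLinear {d : ℕ} (n : ℕ) (K : ℝ → ℝ) (h : ℝ) (x : ℕ → EuclideanSpace ℝ (Fin d))
    (y : ℕ → ℝ) (t : ℝ) : EuclideanSpace ℝ (Fin d) :=
  (Classical.epsilon fun η : EuclideanSpace ℝ (Fin d) × EuclideanSpace ℝ (Fin d) =>
    ∀ η', regObjective n K h x y t η ≤ regObjective n K h x y t η').1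

/-- The jackknife bias-corrected estimator of the coefficient vector. -/
def regJackknife {d : ℕ} (n : ℕ) (K : ℝ → ℝ) (h : ℝ) (x : ℕ → EuclideanSpace ℝ (Fin d))
    (y : ℕ → ℝ) (t : ℝ) : EuclideanSpace ℝ (Fin d) :=
  (2 : ℝ) • regLocalLinear n K (h / Real.sqrt 2) x y t - regLocalLinear n K h x y t

/-- The coordinate `k` of `C v`. -/
def contrast {s d : ℕ} (C : Matrix (Fin s) (Fin d) ℝ) (v : EuclideanSpace ℝ (Fin d))
    (k : Fin s) : ℝ :=
  ∑ a, C k a * v a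

/-! ### Monotone rearrangement and the index sets -/

/-- The smoothed monotone rearrangement
`s ↦ ∫_{-∞}^s (N h)⁻¹ ∑_{i=1}^N K((g(i / N) - u) / h) du`, the estimator of the inverse curve. -/
def rearrangedInv (N : ℕ) (K : ℝ → ℝ) (h : ℝ) (g : ℝ → ℝ) (s : ℝ) : ℝ :=
  ∫ u in Iic s, 1 / ((N : ℝ) * h) * ∑ i ∈ Finset.Icc 1 N, K ((g ((i : ℝ) / N) - u) / h)

/-- `{s | min_{1 ≤ i ≤ N} g(i / N) ≤ s ≤ max_{1 ≤ i ≤ N} g(i / N)}`. -/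
def gridRange (N : ℕ) (g : ℝ → ℝ) : Set ℝ :=
  {s | (∃ i ∈ Finset.Icc 1 N, g ((i : ℝ) / N) ≤ s) ∧ ∃ i ∈ Finset.Icc 1 N, s ≤ g ((i : ℝ) / N)}

/-- The index set `{m_I⁻¹(s) | s ∈ gridRange g₀} ∩ [h_d log h_d⁻¹, 1 - h_d log h_d⁻¹]`, where
`m_I⁻¹` is the rearrangement of `g` with bandwidth `h`, and `g₀` is the curve whose grid values
delimit the range of `s`. -/
def indexSet (N : ℕ) (K : ℝ → ℝ) (hd h : ℝ) (g g₀ : ℝ → ℝ) : Set ℝ :=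
  rearrangedInv N K h g '' gridRange N g₀ ∩
    Icc (hd * Real.log hd⁻¹) (1 - hd * Real.log hd⁻¹)

end MonoSCB

end

/-!
The index sets only require *consistent* estimators, with no rate. If `g` and `g₀` approximate an
increasing curve at all but a small fraction of the grid points, then the rearranged inverse of `g`
is continuous, is close to `0` at the smallest value of `g₀` and close to `1` at the largest one, so
its image contains `[e, 1 - e]` by the intermediate value theorem
(`Icc_subset_image_rearrangedInv`). Errors are measured relative to the slope of the curve, that is,
as horizontal shifts: in the high-dimensional model the slopes need not be bounded, but slope times
a constant controls the curvature (`exists_abs_sub_linear_le`). By Markov's inequality for the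
number of bad grid points, it suffices that at every interior point the estimator is good outside an
event of probability `o(1 / p)`, uniformly in the point. This is `RelConsistent`, and
`RelConsistent.tendstoInMeasure` turns it into the convergence of the index sets. The property
passes to the jackknife, which is a linear combination of two local linear estimators.

Consistency of the local linear estimators comes from their quadratic criterion: if the local design
is non-degenerate, the minimiser is as close to a line as the kernel-weighted residuals of the line
nearly satisfy the normal equations (`abs_localLinear_sub_le`, `norm_regLocalLinear_sub_le`). The
stochastic terms are weighted sums of causal functionals of the innovations. Such a functional is
replaced by a bounded function of `m + 1` innovations, up to a small error in `L¹`
(`IsInnovation.exists_bounded_finite_approx`); within each residue class modulo `m + 1` the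
replacements are independent, and Hoeffding's inequality applies
(`IsInnovation.measure_weighted_sum_ge_le`). In the trend model the number of innovations and the
truncation level grow like `n ^ (1 / 12)`, and the exponential moments and the geometric decay of
the dependence give a stretched exponential bound, which beats the dimension `p`
(`TrendErrorCond.eventually_noise_le`). In the regression model the numbers can be fixed
(`UniformlyApproximable.eventually_sum_le`); there the coefficient curve itself is merely bounded,
so the estimator is compared with the weighted least squares line of that curve, whose contrasts are
close to the smooth contrasts of the curve (`exists_weighted_least_squares`).
-/

noncomputable section

namespace MonoSCB

/-! ### Independent innovations and their pasts -/

lemma enorm_sub_le_add (a b c : ℝ) : ‖a - c‖ₑ ≤ ‖a - b‖ₑ + ‖b - c‖ₑ := by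
  rw [← edist_eq_enorm_sub, ← edist_eq_enorm_sub, ← edist_eq_enorm_sub]
  exact edist_triangle _ _ _

/-- The past at time `0` with the coordinates `m + 1, …, l` replaced by future innovations, which
serve as independent copies. -/
def mixedPast {Ω S : Type*} (ε : ℤ → Ω → S) (m l : ℕ) (ω : Ω) : ℕ → S :=
  fun j => ε (if m < j ∧ j ≤ l then (j : ℤ) + 1 else -(j : ℤ)) ω

lemma mixedPast_self {Ω S : Type*} {ε : ℤ → Ω → S} (m : ℕ) : mixedPast ε m m = past ε 0 := by
  funext ω j
  have : ¬ (m < j ∧ j ≤ m) := by omega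
  simp [mixedPast, past, this]

section Innovations

variable {Ω S : Type*} [MeasurableSpace Ω] [MeasurableSpace S]
  {P : Measure Ω} {ε : ℤ → Ω → S}

lemma measurable_past (hε : IsInnovation P ε) (i : ℤ) : Measurable (past ε i) :=
  measurable_pi_lambda _ fun _ => hε.meas _

/-- Distinct innovations, in whatever order, are an i.i.d. family, so their joint law does not
depend on which ones are taken. -/
lemma IsInnovation.map_injective (hε : IsInnovation P ε) {κ : Type*} {τ : κ → ℤ}
    (hτ : Function.Injective τ) :
    P.map (fun ω j => ε (τ j) ω) = Measure.infinitePi fun _ : κ => P.map (ε 0) := by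
  rw [((hε.indep.precomp hτ).map_fun_eq_infinitePi_map fun j => hε.meas _)]
  congr 1
  funext j
  exact (hε.ident (τ j)).map_eq

lemma IsInnovation.map_past (hε : IsInnovation P ε) (i : ℤ) :
    P.map (past ε i) = P.map (past ε 0) := by
  have h : ∀ i : ℤ, P.map (past ε i) = Measure.infinitePi fun _ : ℕ => P.map (ε 0) := fun i =>
    hε.map_injective (τ := fun j : ℕ => i - (j : ℤ)) fun a b h => by simpa using h
  rw [h i, h 0]

lemma IsInnovation.lintegral_past (hε : IsInnovation P ε) (i : ℤ) {f : (ℕ → S) → ℝ≥0∞}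
    (hf : Measurable f) :
    ∫⁻ ω, f (past ε i ω) ∂P = ∫⁻ ω, f (past ε 0 ω) ∂P := by
  rw [← lintegral_map hf (measurable_past hε i), hε.map_past, lintegral_map hf
    (measurable_past hε 0)]

lemma IsInnovation.integral_past (hε : IsInnovation P ε) (i : ℤ) {f : (ℕ → S) → ℝ}
    (hf : Measurable f) :
    ∫ ω, f (past ε i ω) ∂P = ∫ ω, f (past ε 0 ω) ∂P := by
  rw [← integral_map (measurable_past hε i).aemeasurable hf.aestronglyMeasurable, hε.map_past,
    integral_map (measurable_past hε 0).aemeasurable hf.aestronglyMeasurable]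

/-- Blocks of innovations without common members are independent. -/
lemma IsInnovation.iIndepFun_blocks (hε : IsInnovation P ε) {α β : Type*} (τ : α → β → ℤ)
    (hτ : Function.Injective fun x : α × β => τ x.1 x.2) :
    iIndepFun (fun a ω b => ε (τ a b) ω) P := by
  have := hε.indep.isProbabilityMeasure
  have : IsProbabilityMeasure (P.map (ε 0)) :=
    Measure.isProbabilityMeasure_map (hε.meas 0).aemeasurable
  have hm : ∀ a, Measurable fun ω b => ε (τ a b) ω := fun a =>
    measurable_pi_lambda _ fun b => hε.meas _
  rw [iIndepFun_iff_map_fun_eq_infinitePi_map hm]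
  have h1 := hε.map_injective hτ
  have h2 := congrArg (Measure.map (MeasurableEquiv.curry α β S)) h1
  rw [Measure.infinitePi_map_curry (fun (_ : α) (_ : β) => P.map (ε 0)),
    Measure.map_map (MeasurableEquiv.measurable _)
      (measurable_pi_lambda _ fun x => hε.meas _)] at h2
  have h3 : ∀ a, P.map (fun ω b => ε (τ a b) ω) =
      Measure.infinitePi fun _ : β => P.map (ε 0) := fun a =>
    hε.map_injective fun b b' h => by
      have := @hτ (a, b) (a, b') h
      simpa using this
  simp_rw [h3]
  exact h2

lemma IsInnovation.indepFun_past_future (hε : IsInnovation P ε) :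
    IndepFun (past ε 0) (fun ω (j : ℕ) => ε ((j : ℤ) + 1) ω) P := by
  have h := hε.iIndepFun_blocks (fun (a : Bool) (j : ℕ) => if a then -(j : ℤ) else (j : ℤ) + 1)
    (by
      rintro ⟨a, i⟩ ⟨b, j⟩ h
      cases a <;> cases b <;> simp at h ⊢ <;> omega)
  have := h.indepFun (i := true) (j := false) (by simp)
  simpa [past, funext_iff, Function.comp_def, show past ε 0 = fun ω (b : ℕ) => ε (-(b : ℤ)) ω by
    funext ω b; simp [past]] using this

/-! ### Approximation of causal functionals by functions of finitely many innovations -/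

/-- Lévy's upward theorem: in `L¹` of a probability measure on a sequence space, functions of
finitely many coordinates are dense. -/
lemma exists_dependsOn_lintegral_le (ν : Measure (ℕ → S)) [IsProbabilityMeasure ν]
    {F : (ℕ → S) → ℝ} (hF : Measurable F) (hi : Integrable F ν) {η : ℝ≥0∞} (hη : η ≠ 0) :
    ∃ (J : ℕ) (f : (ℕ → S) → ℝ), Measurable f ∧ DependsOn f (Set.Iic J) ∧
      ∫⁻ x, ‖F x - f x‖ₑ ∂ν ≤ η := by
  have hsup : (⨆ n, (Filtration.piLE (X := fun _ : ℕ => S)) n) = MeasurableSpace.pi := by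
    refine le_antisymm (iSup_le fun n => Filtration.piLE.le n) ?_
    refine iSup_le fun j => le_trans ?_ (le_iSup _ j)
    rw [Filtration.piLE_eq_comap_frestrictLe]
    intro s hs
    obtain ⟨t, ht, rfl⟩ := hs
    exact ⟨(fun x => x ⟨j, by simp⟩) ⁻¹' t, measurable_pi_apply _ ht, rfl⟩
  have hlim := hi.tendsto_eLpNorm_condExp (ℱ := Filtration.piLE (X := fun _ : ℕ => S))
    (by rw [hsup]; exact hF.stronglyMeasurable)
  obtain ⟨J, hJ⟩ := ((tendsto_order.1 hlim).2 η (pos_iff_ne_zero.2 hη)).exists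
  have hm : StronglyMeasurable[Filtration.piLE (X := fun _ : ℕ => S) J]
      (ν[F | Filtration.piLE (X := fun _ : ℕ => S) J]) := stronglyMeasurable_condExp
  refine ⟨J, _, (hm.mono (Filtration.piLE.le J)).measurable, hm.dependsOn_of_piLE, ?_⟩
  rw [eLpNorm_one_eq_lintegral_enorm] at hJ
  refine le_trans (le_of_eq ?_) hJ.le
  refine lintegral_congr fun x => ?_
  rw [Pi.sub_apply, ← enorm_neg, neg_sub]

lemma measurable_mixedPast (hε : IsInnovation P ε) (m l : ℕ) : Measurable (mixedPast ε m l) :=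
  measurable_pi_lambda _ fun _ => hε.meas _

lemma IsInnovation.map_mixedPast (hε : IsInnovation P ε) (m l : ℕ) :
    P.map (mixedPast ε m l) = P.map (past ε 0) := by
  rw [← mixedPast_self (ε := ε) 0]
  have h : ∀ m l : ℕ, P.map (mixedPast ε m l) = Measure.infinitePi fun _ : ℕ => P.map (ε 0) :=
    fun m l => hε.map_injective
      (τ := fun j : ℕ => if m < j ∧ j ≤ l then (j : ℤ) + 1 else -(j : ℤ)) fun a b h => by
        dsimp only at h
        split_ifs at h <;> omega
  rw [h, h]

/-- A coupled pair of pasts has the same law, whether the replaced innovation comes from an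
independent copy of the probability space or from the future. -/
lemma IsInnovation.lintegral_coupledPast (hε : IsInnovation P ε) {F : (ℕ → S) → ℝ}
    (hF : Measurable F) (k : ℕ) :
    ∫⁻ z : Ω × Ω, ‖F (past ε 0 z.1) - F (coupledPast ε 0 (-(k : ℤ)) z)‖ₑ ∂(P.prod P)
      = ∫⁻ ω, ‖F (past ε 0 ω) - F (Function.update (past ε 0 ω) k (ε ((k : ℤ) + 1) ω))‖ₑ ∂P := by
  classical
  have := hε.indep.isProbabilityMeasure
  have hup : Measurable fun x : (ℕ → S) × S => Function.update x.1 k x.2 := by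
    refine measurable_pi_lambda _ fun j => ?_
    by_cases h : j = k
    · subst h; simpa using measurable_snd
    · simpa [Function.update_of_ne h, Function.comp_def] using
        (measurable_pi_apply j).comp measurable_fst
  have hΨ : Measurable fun x : (ℕ → S) × S => ‖F x.1 - F (Function.update x.1 k x.2)‖ₑ :=
    ((hF.comp measurable_fst).sub (hF.comp hup)).enorm
  have h1 : ∀ z : Ω × Ω, coupledPast ε 0 (-(k : ℤ)) z
      = Function.update (past ε 0 z.1) k (ε (-(k : ℤ)) z.2) := by
    intro z
    funext j
    by_cases h : j = k
    · subst h; simp [coupledPast]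
    · simp [coupledPast, past, h]
  have hi := hε.indepFun_past_future.comp measurable_id (measurable_pi_apply k)
  have hp := (indepFun_iff_map_prod_eq_prod_map_map (measurable_past hε 0).aemeasurable
    (hε.meas ((k : ℤ) + 1)).aemeasurable).1 hi
  have hq := Measure.map_prod_map P P (measurable_past hε 0) (hε.meas (-(k : ℤ)))
  rw [(hε.ident (-(k : ℤ))).map_eq, ← (hε.ident ((k : ℤ) + 1)).map_eq, ← hp] at hq
  have e1 : ∫⁻ z : Ω × Ω, ‖F (past ε 0 z.1) - F (coupledPast ε 0 (-(k : ℤ)) z)‖ₑ ∂(P.prod P)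
      = ∫⁻ x, ‖F x.1 - F (Function.update x.1 k x.2)‖ₑ
        ∂((P.prod P).map (Prod.map (past ε 0) (ε (-(k : ℤ))))) := by
    rw [lintegral_map hΨ ((measurable_past hε 0).prodMap (hε.meas _))]
    simp [h1, Prod.map]
  rw [e1, ← hq, lintegral_map hΨ ((measurable_past hε 0).prodMk (hε.meas _))]

/-- Replacing one more coordinate of a mixed past costs no more than replacing it in the
unmixed past. -/
lemma IsInnovation.lintegral_mixedPast_succ (hε : IsInnovation P ε) {F : (ℕ → S) → ℝ}
    (hF : Measurable F) {m l : ℕ} (hml : m ≤ l) :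
    ∫⁻ ω, ‖F (mixedPast ε m l ω) - F (mixedPast ε m (l + 1) ω)‖ₑ ∂P
      = ∫⁻ z : Ω × Ω, ‖F (past ε 0 z.1) - F (coupledPast ε 0 (-((l + 1 : ℕ) : ℤ)) z)‖ₑ
          ∂(P.prod P) := by
  classical
  rw [hε.lintegral_coupledPast hF]
  set Ψ : (Option ℕ → S) → ℝ≥0∞ := fun x =>
    ‖F (fun j => x (some j)) - F (Function.update (fun j => x (some j)) (l + 1) (x none))‖ₑ
  have hsome : Measurable fun (x : Option ℕ → S) (j : ℕ) => x (some j) :=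
    measurable_pi_lambda _ fun j => measurable_pi_apply _
  have hup : Measurable fun x : Option ℕ → S =>
      Function.update (fun j => x (some j)) (l + 1) (x none) := by
    refine measurable_pi_lambda _ fun j => ?_
    by_cases h : j = l + 1
    · subst h; simpa using measurable_pi_apply _
    · simpa [Function.update_of_ne h] using measurable_pi_apply (some j)
  have hΨ : Measurable Ψ := ((hF.comp hsome).sub (hF.comp hup)).enorm
  have key : ∀ a : ℕ, a ≤ l → P.map (fun ω (o : Option ℕ) => ε (o.elim (((l + 1 : ℕ) : ℤ) + 1)
      fun j => if a < j ∧ j ≤ l then (j : ℤ) + 1 else -(j : ℤ)) ω)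
        = Measure.infinitePi fun _ : Option ℕ => P.map (ε 0) := fun a ha =>
    hε.map_injective (τ := fun o : Option ℕ => o.elim (((l + 1 : ℕ) : ℤ) + 1)
      fun j => if a < j ∧ j ≤ l then (j : ℤ) + 1 else -(j : ℤ)) <| by
        rintro (_ | i) (_ | j) h
        · rfl
        · simp only [Option.elim] at h; exfalso; split_ifs at h <;> push_cast at h <;> omega
        · simp only [Option.elim] at h; exfalso; split_ifs at h <;> push_cast at h <;> omega
        · simp only [Option.elim] at h; congr 1; split_ifs at h <;> omega
  have hmeas : ∀ a : ℕ, Measurable (fun ω (o : Option ℕ) => ε (o.elim (((l + 1 : ℕ) : ℤ) + 1)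
      fun j => if a < j ∧ j ≤ l then (j : ℤ) + 1 else -(j : ℤ)) ω) := fun a =>
    measurable_pi_lambda _ fun o => hε.meas _
  have h := congrArg (fun μ => ∫⁻ x, Ψ x ∂μ) ((key m hml).trans (key l le_rfl).symm)
  simp only [lintegral_map hΨ (hmeas _)] at h
  have e1 : ∀ ω, mixedPast ε m (l + 1) ω = Function.update (mixedPast ε m l ω) (l + 1)
      (ε (((l + 1 : ℕ) : ℤ) + 1) ω) := by
    intro ω
    funext j
    by_cases hj : j = l + 1
    · subst hj
      have : m < l + 1 := by omega
      simp [mixedPast, this]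
    · have : (m < j ∧ j ≤ l + 1) ↔ (m < j ∧ j ≤ l) := by omega
      simp only [mixedPast, Function.update_of_ne hj, this]
  have e2 : past ε 0 = mixedPast ε l l := (mixedPast_self l).symm
  simp only [e1, e2]
  exact h

/-- A causal functional is approximated in `L¹` by a function of the last `m + 1` innovations, up
to the tail of its dependence coefficients: first the far innovations are cut off by Lévy's
theorem, then those at lags `m + 1, …, J` are replaced by future ones, one at a time, and finally
the future innovations are frozen at a favourable value. -/
theorem IsInnovation.exists_finite_approx (hε : IsInnovation P ε) {F : (ℕ → S) → ℝ}
    (hF : Measurable F) (hi : Integrable (fun ω => F (past ε 0 ω)) P) {δ : ℕ → ℝ≥0∞}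
    (hδ : ∀ k : ℕ, ∫⁻ z : Ω × Ω, ‖F (past ε 0 z.1) - F (coupledPast ε 0 (-(k : ℤ)) z)‖ₑ
      ∂(P.prod P) ≤ δ k) (m : ℕ) {η : ℝ≥0∞} (hη : η ≠ 0) :
    ∃ φ : (Fin (m + 1) → S) → ℝ, Measurable φ ∧
      ∫⁻ ω, ‖F (past ε 0 ω) - φ (fun j => past ε 0 ω j)‖ₑ ∂P ≤ ∑' k, δ (k + (m + 1)) + η := by
  classical
  have := hε.indep.isProbabilityMeasure
  have hp := measurable_past hε 0
  have : IsProbabilityMeasure (P.map (past ε 0)) := Measure.isProbabilityMeasure_map hp.aemeasurable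
  obtain ⟨J, f, hf, hfJ, hFf⟩ := exists_dependsOn_lintegral_le (P.map (past ε 0)) hF
    ((integrable_map_measure hF.aestronglyMeasurable hp.aemeasurable).2 hi) hη
  -- replacing the coordinates one at a time
  have tele : ∀ l, ∫⁻ ω, ‖F (past ε 0 ω) - F (mixedPast ε m (m + l) ω)‖ₑ ∂P
      ≤ ∑ k ∈ Finset.range l, δ (k + (m + 1)) := by
    intro l
    induction l with
    | zero => simp [mixedPast_self]
    | succ l ih =>
      rw [Finset.sum_range_succ]
      have hst := (hε.lintegral_mixedPast_succ hF (m := m) (l := m + l) (by omega)).le.trans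
        (hδ (m + l + 1))
      refine le_trans ?_ (add_le_add ih (hst.trans (by rw [show m + l + 1 = l + (m + 1) by omega])))
      rw [← lintegral_add_left (f := fun ω => ‖F (past ε 0 ω) - F (mixedPast ε m (m + l) ω)‖ₑ)
        ((hF.comp hp).sub (hF.comp (measurable_mixedPast hε _ _))).enorm]
      refine lintegral_mono fun ω => ?_
      exact enorm_sub_le_add _ _ _
  have hmix := measurable_mixedPast hε m (m + J)
  have hfm : ∫⁻ ω, ‖F (mixedPast ε m (m + J) ω) - f (mixedPast ε m (m + J) ω)‖ₑ ∂P ≤ η := by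
    rw [← lintegral_map (f := fun x => ‖F x - f x‖ₑ) (hF.sub hf).enorm hmix, hε.map_mixedPast]
    exact hFf
  let M : (ℕ → S) × (ℕ → S) → ℕ → S := fun x j => if j ≤ m then x.1 j else x.2 j
  have hM : Measurable M := by
    refine measurable_pi_lambda _ fun j => ?_
    by_cases h : j ≤ m
    · simpa [M, h, Function.comp_def] using (measurable_pi_apply j).comp measurable_fst
    · simpa [M, h, Function.comp_def] using (measurable_pi_apply j).comp measurable_snd
  have hfM : ∀ ω, f (mixedPast ε m (m + J) ω)
      = f (M (past ε 0 ω, fun j : ℕ => ε ((j : ℤ) + 1) ω)) := by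
    intro ω
    refine hfJ fun j hj => ?_
    have hj' : j ≤ J := hj
    by_cases h : j ≤ m
    · have : ¬ (m < j) := by omega
      simp [mixedPast, M, h, past, this]
    · have : m < j ∧ j ≤ m + J := by omega
      simp [mixedPast, M, h, this]
  have hfut : Measurable fun ω (j : ℕ) => ε ((j : ℤ) + 1) ω :=
    measurable_pi_lambda _ fun _ => hε.meas _
  have htot : ∫⁻ ω, ‖F (past ε 0 ω) - f (M (past ε 0 ω, fun j : ℕ => ε ((j : ℤ) + 1) ω))‖ₑ ∂P
      ≤ ∑' k, δ (k + (m + 1)) + η := by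
    refine le_trans ?_ (add_le_add ((tele J).trans (ENNReal.sum_le_tsum _)) hfm)
    rw [← lintegral_add_left (f := fun ω => ‖F (past ε 0 ω) - F (mixedPast ε m (m + J) ω)‖ₑ)
      ((hF.comp hp).sub (hF.comp hmix)).enorm]
    refine lintegral_mono fun ω => ?_
    rw [← hfM]
    exact enorm_sub_le_add _ _ _
  set Q := P.map fun ω (j : ℕ) => ε ((j : ℤ) + 1) ω
  have : IsProbabilityMeasure Q := Measure.isProbabilityMeasure_map hfut.aemeasurable
  have hG : Measurable fun x : (ℕ → S) × (ℕ → S) => ‖F x.1 - f (M x)‖ₑ :=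
    ((hF.comp measurable_fst).sub (hf.comp hM)).enorm
  rw [← lintegral_map (f := fun x : (ℕ → S) × (ℕ → S) => ‖F x.1 - f (M x)‖ₑ) hG
    (hp.prodMk hfut), (indepFun_iff_map_prod_eq_prod_map_map hp.aemeasurable
    hfut.aemeasurable).1 hε.indepFun_past_future, lintegral_prod_symm' _ hG] at htot
  obtain ⟨y, hy⟩ := exists_le_lintegral (μ := Q)
    (hG.lintegral_prod_left' (μ := P.map (past ε 0))).aemeasurable
  refine ⟨fun v => f fun j => if h : j ≤ m then v ⟨j, by omega⟩ else y j, hf.comp ?_, ?_⟩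
  · refine measurable_pi_lambda _ fun j => ?_
    by_cases h : j ≤ m
    · simpa [h] using measurable_pi_apply _
    · simp [h]
  · refine le_trans (le_of_eq ?_) (hy.trans htot)
    rw [lintegral_map (f := fun x => ‖F x - f (M (x, y))‖ₑ) (hG.comp measurable_prodMk_right) hp]
    simp [M]

end Innovations

/-! ### Deviations of weighted sums of causal functionals -/

section Deviation

variable {Ω S : Type*} [MeasurableSpace Ω] [MeasurableSpace S]
  {P : Measure Ω} {ε : ℤ → Ω → S}

lemma abs_sub_clamp_le (B x y : ℝ) (hB : 0 ≤ B) :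
    |x - max (-B) (min B y)| ≤ |x - y| + max (|x| - B) 0 := by
  rcases le_total B y with h1 | h1 <;> rcases le_total (-B) y with h2 | h2 <;>
    rcases le_total x y with h3 | h3 <;> rcases abs_cases x with h4 | h4 <;>
    rcases max_cases (|x| - B) 0 with h5 | h5 <;> simp only [h1, min_eq_left, min_eq_right] <;>
    first
    | (rw [max_eq_right (by linarith)]
       rcases abs_cases (x - y) with h6 | h6 <;> rcases abs_cases (x - B) with h7 | h7 <;> linarith)
    | (rw [max_eq_left (by linarith)]
       rcases abs_cases (x - y) with h6 | h6 <;> rcases abs_cases (x - -B) with h7 | h7 <;> linarith)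

/-- Clamping a finite approximation to `[-B, B]` costs no more than truncating the functional. -/
lemma exists_bounded_approx (hε : IsInnovation P ε) {F : (ℕ → S) → ℝ} (hF : Measurable F)
    {m : ℕ} {φ : (Fin (m + 1) → S) → ℝ} (hφ : Measurable φ) {B : ℝ} (hB : 0 ≤ B) {η κ : ℝ≥0∞}
    (h1 : ∫⁻ ω, ‖F (past ε 0 ω) - φ (fun j => past ε 0 ω j)‖ₑ ∂P ≤ η)
    (h2 : ∫⁻ ω, ENNReal.ofReal (|F (past ε 0 ω)| - B) ∂P ≤ κ) :
    ∃ ψ : (Fin (m + 1) → S) → ℝ, Measurable ψ ∧ (∀ v, |ψ v| ≤ B) ∧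
      ∫⁻ ω, ‖F (past ε 0 ω) - ψ (fun j => past ε 0 ω j)‖ₑ ∂P ≤ η + κ := by
  refine ⟨fun v => max (-B) (min B (φ v)), by fun_prop, fun v => ?_, ?_⟩
  · rw [abs_le]
    exact ⟨le_max_left _ _, max_le (by linarith) (min_le_left _ _)⟩
  · refine le_trans ?_ (add_le_add h1 h2)
    have hp := measurable_past hε 0
    rw [← lintegral_add_right]
    · refine lintegral_mono fun ω => ?_
      rw [Real.enorm_eq_ofReal_abs, Real.enorm_eq_ofReal_abs,
        show ENNReal.ofReal (|F (past ε 0 ω)| - B) = ENNReal.ofReal (max (|F (past ε 0 ω)| - B) 0)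
          by simp,
        ← ENNReal.ofReal_add (abs_nonneg _) (le_max_right _ _)]
      exact ENNReal.ofReal_le_ofReal (abs_sub_clamp_le _ _ _ hB)
    · exact ((hF.comp hp).abs.sub_const _).ennreal_ofReal

/-- Hoeffding's inequality for sums of functions of `m + 1` consecutive innovations: within each
residue class modulo `m + 1` the terms are independent. -/
lemma IsInnovation.measure_sum_blocks_ge_le (hε : IsInnovation P ε) {m : ℕ} {B : ℝ} (hB : 0 ≤ B)
    (φ : ℕ → (Fin (m + 1) → S) → ℝ) (I : Finset ℕ) (hφ : ∀ i ∈ I, Measurable (φ i))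
    (hφB : ∀ i ∈ I, ∀ v, |φ i v| ≤ B) {c : ℝ} (hc : (I.card : ℝ) ≤ c) {x : ℝ} (hx : 0 ≤ x) :
    P {ω | x ≤ |∑ i ∈ I, (φ i (fun j => past ε i ω j) - ∫ ω', φ i (fun j => past ε i ω' j) ∂P)|}
      ≤ ENNReal.ofReal (2 * (m + 1) *
        Real.exp (-(x / (m + 1)) ^ 2 / (2 * (c * B ^ 2)))) := by
  classical
  lift c to ℝ≥0 using (Nat.cast_nonneg _).trans hc
  have := hε.indep.isProbabilityMeasure
  lift B to ℝ≥0 using hB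
  set Z : ℕ → Ω → ℝ := fun i ω =>
    φ i (fun j => past ε i ω j) - ∫ ω', φ i (fun j => past ε i ω' j) ∂P with hZ
  have hY : ∀ i ∈ I, Measurable fun ω => φ i (fun j => past ε i ω j) := fun i hi =>
    (hφ i hi).comp (measurable_pi_lambda _ fun j => hε.meas _)
  have hsub : ∀ i ∈ I, HasSubgaussianMGF (Z i) (B ^ 2) P := by
    intro i hi
    have h := hasSubgaussianMGF_of_mem_Icc (μ := P) (hY i hi).aemeasurable (a := -(B : ℝ)) (b := B)
      (ae_of_all _ fun ω => abs_le.1 (hφB i hi _))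
    convert h using 2
    ext
    have hB : |(B : ℝ) + B| = 2 * B := by rw [abs_of_nonneg (by positivity)]; ring
    simp [hB]
  have hclass : ∀ r : ℕ, HasSubgaussianMGF (fun ω => ∑ i ∈ I with i % (m + 1) = r, Z i ω)
      (c * B ^ 2) P := by
    intro r
    have hind : iIndepFun (fun (i : {i : ℕ // i % (m + 1) = r}) ω (j : Fin (m + 1)) =>
        ε ((i : ℕ) - (j : ℕ) : ℤ) ω) P := by
      refine hε.iIndepFun_blocks (fun (i : {i : ℕ // i % (m + 1) = r}) (j : Fin (m + 1)) =>
        ((i : ℕ) - (j : ℕ) : ℤ)) ?_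
      rintro ⟨⟨i, hi⟩, ⟨j, hj⟩⟩ ⟨⟨i', hi'⟩, ⟨j', hj'⟩⟩ h
      simp only at h
      have e1 := Nat.div_add_mod i (m + 1)
      have e2 := Nat.div_add_mod i' (m + 1)
      have h4 : i / (m + 1) = i' / (m + 1) := by
        rcases lt_trichotomy (i / (m + 1)) (i' / (m + 1)) with hl | hl | hl
        · have := Nat.mul_le_mul_left (m + 1) (Nat.succ_le_of_lt hl)
          rw [Nat.mul_succ] at this
          omega
        · exact hl
        · have := Nat.mul_le_mul_left (m + 1) (Nat.succ_le_of_lt hl)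
          rw [Nat.mul_succ] at this
          omega
      have h3 : i = i' := by rw [← e1, ← e2, h4, hi, hi']
      subst h3
      have h5 : j = j' := by omega
      subst h5
      rfl
    have hind' : iIndepFun (fun (i : {i : ℕ // i % (m + 1) = r}) ω =>
        if (i : ℕ) ∈ I then Z i ω else 0) P := by
      refine (hind.comp (fun i v => if (i : ℕ) ∈ I then
        φ i v - ∫ ω', φ i (fun j => past ε i ω' j) ∂P else 0) fun i => ?_)
      by_cases hi : (i : ℕ) ∈ I
      · simpa [hi] using (hφ i hi).sub_const _
      · simp [hi]
    have h := HasSubgaussianMGF.sum_of_iIndepFun (μ := P) hind' (c := fun _ => B ^ 2)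
      (s := I.subtype fun i => i % (m + 1) = r) (by
        intro i hi
        have hi' : (i : ℕ) ∈ I := by simpa using hi
        simpa [hi'] using hsub i hi')
    have h2 : (fun ω => ∑ i ∈ I.subtype fun i => i % (m + 1) = r,
        if (i : ℕ) ∈ I then Z i ω else 0) = fun ω => ∑ i ∈ I with i % (m + 1) = r, Z i ω := by
      funext ω
      rw [Finset.sum_subtype_eq_sum_filter (fun i => if i ∈ I then Z i ω else 0)]
      exact Finset.sum_congr rfl fun i hi => if_pos (Finset.mem_filter.1 hi).1
    rw [h2] at h
    refine ⟨h.integrable_exp_mul, fun t => (h.mgf_le t).trans (Real.exp_le_exp.2 ?_)⟩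
    have hle : ((∑ i ∈ I.subtype fun i => i % (m + 1) = r, (B : ℝ≥0) ^ 2 : ℝ≥0) : ℝ)
        ≤ ((c * B ^ 2 : ℝ≥0) : ℝ) := by
      rw [Finset.sum_const, nsmul_eq_mul]
      push_cast
      gcongr
      rw [Finset.card_subtype]
      exact (Nat.cast_le.2 (Finset.card_filter_le _ _)).trans hc
    gcongr
  have hm0 : (0 : ℝ) < m + 1 := by positivity
  set y := x / (m + 1)
  have hy : 0 ≤ y := by positivity
  set b := Real.exp (-y ^ 2 / (2 * (c * B ^ 2)))
  have hone : ∀ r : ℕ, P {ω | y ≤ |∑ i ∈ I with i % (m + 1) = r, Z i ω|}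
      ≤ ENNReal.ofReal (2 * b) := by
    intro r
    have h1 := (hclass r).measure_ge_le hy
    have h2 := (hclass r).neg.measure_ge_le hy
    rw [← ENNReal.ofReal_toReal (measure_ne_top P _)]
    refine ENNReal.ofReal_le_ofReal ?_
    have h3 : {ω | y ≤ |∑ i ∈ I with i % (m + 1) = r, Z i ω|} ⊆
        {ω | y ≤ ∑ i ∈ I with i % (m + 1) = r, Z i ω} ∪
        {ω | y ≤ (-fun ω => ∑ i ∈ I with i % (m + 1) = r, Z i ω) ω} := fun ω hω => by
      simpa [le_abs] using hω
    have h4 := (measureReal_mono (μ := P) h3).trans (measureReal_union_le _ _)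
    have hcast : ((c * B ^ 2 : ℝ≥0) : ℝ) = c * B ^ 2 := by simp
    rw [hcast] at h1 h2
    change P.real _ ≤ _
    linarith
  have hun : {ω | x ≤ |∑ i ∈ I, Z i ω|} ⊆
      ⋃ r ∈ Finset.range (m + 1), {ω | y ≤ |∑ i ∈ I with i % (m + 1) = r, Z i ω|} := by
    intro ω hω
    by_contra hcon
    simp only [mem_iUnion, not_exists, mem_ofPred_eq, not_le] at hcon
    have h1 : ∑ i ∈ I, Z i ω
        = ∑ r ∈ Finset.range (m + 1), ∑ i ∈ I with i % (m + 1) = r, Z i ω :=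
      (Finset.sum_fiberwise_of_maps_to (fun i _ => Finset.mem_range.2 (Nat.mod_lt _ (by omega)))
        _).symm
    have h2 : |∑ i ∈ I, Z i ω| < ∑ r ∈ Finset.range (m + 1), y := by
      rw [h1]
      exact (Finset.abs_sum_le_sum_abs _ _).trans_lt
        (Finset.sum_lt_sum_of_nonempty (by simp) fun r hr => hcon r hr)
    have h3 : ∑ r ∈ Finset.range (m + 1), y = x := by
      simp [y]
      field_simp
    rw [h3] at h2
    exact absurd hω (not_le.2 h2)
  refine (measure_mono hun).trans ((measure_biUnion_finset_le _ _).trans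
    ((Finset.sum_le_sum fun r _ => hone r).trans (le_of_eq ?_)))
  rw [Finset.sum_const, Finset.card_range, nsmul_eq_mul, ← ENNReal.ofReal_natCast,
    ← ENNReal.ofReal_mul (by positivity)]
  congr 1
  push_cast
  ring

/-- The bound for the probability that a sum of at most `c` terms with weights in `[-A, A]`
deviates by `x`, when every term is within `η` in `L¹` of a function of `m + 1` innovations with
values in `[-B, B]`. -/
def deviationBound (A B c η : ℝ) (m : ℕ) (x : ℝ) : ℝ :=
  3 * A * c * η / x + 2 * (m + 1) * Real.exp (-(x / 3 / (m + 1)) ^ 2 / (2 * (c * (A * B) ^ 2)))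

/-- Functionals that are well approximated by bounded functions of few innovations have weighted
sums close to their means. -/
theorem IsInnovation.measure_weighted_sum_ge_le (hε : IsInnovation P ε) {F : ℕ → (ℕ → S) → ℝ}
    {I : Finset ℕ} (hF : ∀ i ∈ I, Measurable (F i))
    (hi : ∀ i ∈ I, Integrable (fun ω => F i (past ε 0 ω)) P)
    {m : ℕ} {A B η : ℝ} (hA : 0 ≤ A) (hB : 0 ≤ B) (hη : 0 ≤ η)
    (happ : ∀ i ∈ I, ∃ φ : (Fin (m + 1) → S) → ℝ, Measurable φ ∧ (∀ v, |φ v| ≤ B) ∧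
      ∫⁻ ω, ‖F i (past ε 0 ω) - φ (fun j => past ε 0 ω j)‖ₑ ∂P ≤ ENNReal.ofReal η)
    {a : ℕ → ℝ} (ha : ∀ i ∈ I, |a i| ≤ A) {c : ℝ}
    (hc : (I.card : ℝ) ≤ c) {x : ℝ} (hx : 0 < x) :
    P {ω | x ≤ |∑ i ∈ I, a i * (F i (past ε i ω) - ∫ ω', F i (past ε i ω') ∂P)|}
      ≤ ENNReal.ofReal (deviationBound A B c η m x) := by
  classical
  have hc0 : 0 ≤ c := (Nat.cast_nonneg _).trans hc
  have := hε.indep.isProbabilityMeasure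
  choose! φ hφ hφB hφη using happ
  have hblk : ∀ i : ℤ, Measurable fun ω (j : Fin (m + 1)) => past ε i ω j := fun i =>
    measurable_pi_lambda _ fun j => hε.meas _
  have hpre : Measurable fun (x : ℕ → S) (j : Fin (m + 1)) => x j :=
    measurable_pi_lambda _ fun j => measurable_pi_apply _
  have hD : ∀ i ∈ I, ∫⁻ ω, ‖F i (past ε i ω) - φ i (fun j => past ε i ω j)‖ₑ ∂P
      ≤ ENNReal.ofReal η := fun i h => by
    refine le_trans (le_of_eq ?_) (hφη i h)
    exact hε.lintegral_past i (f := fun x => ‖F i x - φ i (fun j => x j)‖ₑ)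
      ((hF i h).sub ((hφ i h).comp hpre)).enorm
  have hDm : ∀ i ∈ I, Measurable fun ω => F i (past ε i ω) - φ i (fun j => past ε i ω j) :=
    fun i h => ((hF i h).comp (measurable_past hε i)).sub ((hφ i h).comp (hblk i))
  have hexp : 0 ≤ 2 * ((m : ℝ) + 1) *
      Real.exp (-(x / 3 / (m + 1)) ^ 2 / (2 * (c * (A * B) ^ 2))) := by positivity
  -- in the first case the bound exceeds one; in the second the means of the terms and of their
  -- approximations differ by less than `x / 3` in total
  by_cases hbig : x / 3 ≤ A * c * η
  · refine prob_le_one.trans ?_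
    rw [← ENNReal.ofReal_one]
    refine ENNReal.ofReal_le_ofReal ?_
    have : 1 ≤ 3 * A * c * η / x := by
      rw [le_div_iff₀ hx]
      linarith
    unfold deviationBound
    linarith
  push Not at hbig
  set Y : ℕ → Ω → ℝ := fun i ω => φ i (fun j => past ε i ω j)
  have hYi : ∀ i ∈ I, Integrable (Y i) P := fun i h =>
    Integrable.of_mem_Icc (-B) B ((hφ i h).comp (hblk i)).aemeasurable
      (ae_of_all _ fun ω => abs_le.1 (hφB i h _))
  have hXi : ∀ i ∈ I, Integrable (fun ω => F i (past ε i ω)) P := fun i h => by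
    have h1 := (integrable_map_measure (μ := P) (f := past ε 0) (hF i h).aestronglyMeasurable
      (measurable_past hε 0).aemeasurable).2 (hi i h)
    rw [← hε.map_past i] at h1
    exact (integrable_map_measure (hF i h).aestronglyMeasurable
      (measurable_past hε i).aemeasurable).1 h1
  have hmean : ∀ i ∈ I, |(∫ ω, F i (past ε i ω) ∂P) - ∫ ω, Y i ω ∂P| ≤ η := fun i h => by
    rw [← integral_sub (hXi i h) (hYi i h)]
    have h1 := enorm_integral_le_lintegral_enorm (μ := P) fun ω => F i (past ε i ω) - Y i ω
    have h2 := h1.trans (hD i h)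
    rwa [Real.enorm_eq_ofReal_abs, ENNReal.ofReal_le_ofReal_iff hη] at h2
  have hsub : {ω | x ≤ |∑ i ∈ I, a i * (F i (past ε i ω) - ∫ ω', F i (past ε i ω') ∂P)|} ⊆
      {ω | ENNReal.ofReal (x / 3) ≤ ∑ i ∈ I, ENNReal.ofReal A * ‖F i (past ε i ω) - Y i ω‖ₑ} ∪
      {ω | x / 3 ≤ |∑ i ∈ I, (a i * Y i ω - ∫ ω', a i * Y i ω' ∂P)|} := by
    intro ω hω
    by_contra hcon
    simp only [mem_union, mem_ofPred_eq, not_or, not_le] at hcon hω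
    obtain ⟨h1, h2⟩ := hcon
    have e1 : ∑ i ∈ I, ENNReal.ofReal A * ‖F i (past ε i ω) - Y i ω‖ₑ
        = ENNReal.ofReal (∑ i ∈ I, A * |F i (past ε i ω) - Y i ω|) := by
      rw [ENNReal.ofReal_sum_of_nonneg fun i _ => mul_nonneg hA (abs_nonneg _)]
      exact Finset.sum_congr rfl fun i _ => by
        rw [Real.enorm_eq_ofReal_abs, ENNReal.ofReal_mul hA]
    rw [e1, ENNReal.ofReal_lt_ofReal_iff (by positivity)] at h1
    have e2 : ∑ i ∈ I, a i * (F i (past ε i ω) - ∫ ω', F i (past ε i ω') ∂P)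
        = ∑ i ∈ I, a i * (F i (past ε i ω) - Y i ω)
          + ∑ i ∈ I, (a i * Y i ω - ∫ ω', a i * Y i ω' ∂P)
          - ∑ i ∈ I, a i * ((∫ ω', F i (past ε i ω') ∂P) - ∫ ω', Y i ω' ∂P) := by
      rw [← Finset.sum_add_distrib, ← Finset.sum_sub_distrib]
      exact Finset.sum_congr rfl fun i _ => by rw [integral_const_mul]; ring
    have h3 : |∑ i ∈ I, a i * (F i (past ε i ω) - Y i ω)| < x / 3 :=
      ((Finset.abs_sum_le_sum_abs _ _).trans (Finset.sum_le_sum fun i h => by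
        rw [abs_mul]; exact mul_le_mul_of_nonneg_right (ha i h) (abs_nonneg _))).trans_lt h1
    have h4 : |∑ i ∈ I, a i * ((∫ ω', F i (past ε i ω') ∂P) - ∫ ω', Y i ω' ∂P)| < x / 3 := by
      refine ((Finset.abs_sum_le_sum_abs _ _).trans (Finset.sum_le_sum
        (g := fun _ => A * η) fun i h => ?_)).trans_lt ?_
      · rw [abs_mul]
        exact mul_le_mul (ha i h) (hmean i h) (abs_nonneg _) hA
      · rw [Finset.sum_const, nsmul_eq_mul]
        have := mul_le_mul_of_nonneg_right hc (mul_nonneg hA hη)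
        linarith
    rw [e2] at hω
    have h5 := (abs_sub _ _).trans (add_le_add (abs_add_le _ _) le_rfl) |> hω.trans
    linarith
  refine (measure_mono hsub).trans ((measure_union_le _ _).trans ?_)
  unfold deviationBound
  rw [ENNReal.ofReal_add (by positivity) hexp]
  refine add_le_add ?_ ?_
  · refine (meas_ge_le_lintegral_div (Finset.aemeasurable_fun_sum _ fun i h =>
      ((hDm i h).enorm.const_mul _).aemeasurable) (by simpa using hx) ENNReal.ofReal_ne_top).trans ?_
    rw [lintegral_finsetSum' _ fun i h => ((hDm i h).enorm.const_mul _).aemeasurable]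
    have h6 : ∑ i ∈ I, ∫⁻ ω, ENNReal.ofReal A * ‖F i (past ε i ω) - Y i ω‖ₑ ∂P
        ≤ ENNReal.ofReal (c * (A * η)) := by
      refine (Finset.sum_le_sum (g := fun _ => ENNReal.ofReal (A * η)) fun i h => ?_).trans ?_
      · rw [lintegral_const_mul _ (hDm i h).enorm, ENNReal.ofReal_mul hA]
        exact mul_le_mul_right (hD i h) _
      · rw [Finset.sum_const, nsmul_eq_mul, ← ENNReal.ofReal_natCast,
          ← ENNReal.ofReal_mul (by positivity)]
        exact ENNReal.ofReal_le_ofReal (mul_le_mul_of_nonneg_right hc (mul_nonneg hA hη))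
    refine (ENNReal.div_le_div_right h6 _).trans ?_
    rw [← ENNReal.ofReal_div_of_pos (by positivity)]
    refine ENNReal.ofReal_le_ofReal (le_of_eq ?_)
    field_simp
  · refine hε.measure_sum_blocks_ge_le (mul_nonneg hA hB) (fun i v => a i * φ i v) I
      (fun i h => (hφ i h).const_mul _) (fun i h v => ?_) hc (by positivity)
    rw [abs_mul]
    exact mul_le_mul (ha i h) (hφB i h v) (abs_nonneg _) hA

end Deviation

/-! ### Kernels and local designs -/

section Design

lemma IsKernel.exists_le {K : ℝ → ℝ} (hK : IsKernel K) : ∃ κ > (0 : ℝ), ∀ x, K x ≤ κ := by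
  obtain ⟨B, hB⟩ := hK.bdd
  have h0 : (0 : ℝ) ∈ Ioo (-1 : ℝ) 1 := by simp
  have hB0 : 0 ≤ B := (abs_nonneg _).trans (hB 0 h0)
  have hlt : ∀ x ∈ Ioo (-1 : ℝ) 1, |x| ≤ 1 := fun x hx => abs_le.2 ⟨hx.1.le, hx.2.le⟩
  have h1 : ∀ x ∈ Ioo (-1 : ℝ) 1, |deriv K x| ≤ |deriv K 0| + B := by
    intro x hx
    have h := (convex_Ioo (-1 : ℝ) 1).norm_image_sub_le_of_norm_deriv_le
      (fun y hy => (hK.diff y hy).2) (C := B) hB h0 hx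
    rw [Real.norm_eq_abs, Real.norm_eq_abs, sub_zero] at h
    have h2 := abs_sub_abs_le_abs_sub (deriv K x) (deriv K 0)
    nlinarith [hlt x hx]
  have h2 : ∀ x ∈ Ioo (-1 : ℝ) 1, K x ≤ K 0 + (|deriv K 0| + B) := by
    intro x hx
    have h := (convex_Ioo (-1 : ℝ) 1).norm_image_sub_le_of_norm_deriv_le
      (fun y hy => (hK.diff y hy).1) (C := |deriv K 0| + B) h1 h0 hx
    rw [Real.norm_eq_abs, Real.norm_eq_abs, sub_zero] at h
    nlinarith [hlt x hx, le_abs_self (K x - K 0), abs_nonneg (deriv K 0)]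
  refine ⟨K 0 + (|deriv K 0| + B) + K 1 + 1, ?_, fun x => ?_⟩
  · linarith [hK.nonneg 0, hK.nonneg 1, abs_nonneg (deriv K 0)]
  · have e0 := hK.nonneg 0
    have e1 := hK.nonneg 1
    have e2 := abs_nonneg (deriv K 0)
    rcases lt_trichotomy |x| 1 with h | h | h
    · linarith [h2 x (abs_lt.1 h)]
    · rcases eq_or_eq_neg_of_abs_eq h with rfl | rfl
      · linarith
      · rw [hK.symm]; linarith
    · rw [hK.support x h]; linarith

lemma IsKernel.exists_ge {K : ℝ → ℝ} (hK : IsKernel K) :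
    ∃ x₀ x₁ κ₀ : ℝ, x₀ < x₁ ∧ 0 < κ₀ ∧ Icc x₀ x₁ ⊆ Ioo (-1 : ℝ) 1 ∧ ∀ x ∈ Icc x₀ x₁, κ₀ ≤ K x := by
  have hex : ∃ x ∈ Ioo (-1 : ℝ) 1, 0 < K x := by
    by_contra! hcon
    have h0 : K =ᵐ[volume] 0 := by
      have h1 : ∀ᵐ x : ℝ, x ≠ 1 := by simp [ae_iff]
      have h2 : ∀ᵐ x : ℝ, x ≠ -1 := by simp [ae_iff]
      filter_upwards [h1, h2] with x hx1 hx2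
      rcases lt_trichotomy |x| 1 with h | h | h
      · exact le_antisymm (hcon x (abs_lt.1 h)) (hK.nonneg x)
      · rcases eq_or_eq_neg_of_abs_eq h with rfl | rfl
        · exact absurd rfl hx1
        · exact absurd rfl hx2
      · exact hK.support x h
    have := hK.integral_eq_one
    rw [integral_congr_ae h0] at this
    simp at this
  obtain ⟨x, hx, hKx⟩ := hex
  have hc : ∀ᶠ y in 𝓝 x, K x / 2 < K y ∧ y ∈ Ioo (-1 : ℝ) 1 :=
    ((hK.diff x hx).1.continuousAt.eventually (lt_mem_nhds (by linarith))).and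
      (isOpen_Ioo.mem_nhds hx)
  obtain ⟨r, hr, hball⟩ := Metric.eventually_nhds_iff.1 hc
  refine ⟨x - r / 2, x + r / 2, K x / 2, by linarith, by linarith, fun y hy => (hball ?_).2,
    fun y hy => (hball ?_).1.le⟩ <;>
  · rw [Real.dist_eq, abs_lt]
    constructor <;> linarith [hy.1, hy.2]

/-- The standardized position `(i / n - t) / h` of the design point `i / n`. -/
def designPt (n : ℕ) (h t : ℝ) (i : ℕ) : ℝ := ((i : ℝ) / n - t) / h

/-- The indices of the design points within the bandwidth of `t`. -/
def activeSet (n : ℕ) (h t : ℝ) : Finset ℕ := {i ∈ Finset.Icc 1 n | |designPt n h t i| ≤ 1}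

lemma card_activeSet_le {n : ℕ} {h t : ℝ} (hh : 0 < h) (ht : h ≤ t) (hn : 1 ≤ n * h) :
    ((activeSet n h t).card : ℝ) ≤ 3 * (n * h) := by
  have hn0 : (0 : ℝ) < n := by
    by_contra hcon
    nlinarith
  have hth : 0 ≤ (n : ℝ) * (t + h) := mul_nonneg hn0.le (by linarith)
  have hsub : activeSet n h t ⊆ Finset.Icc ⌈n * (t - h)⌉₊ ⌊n * (t + h)⌋₊ := by
    intro i hi
    have h1 := (Finset.mem_filter.1 hi).2
    rw [designPt, abs_le, le_div_iff₀ hh, div_le_iff₀ hh] at h1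
    have e : (n : ℝ) * ((i : ℝ) / n) = i := by field_simp
    rw [Finset.mem_Icc]
    constructor
    · rw [Nat.ceil_le, ← e]
      exact mul_le_mul_of_nonneg_left (by linarith [h1.1]) hn0.le
    · rw [Nat.le_floor_iff hth, ← e]
      exact mul_le_mul_of_nonneg_left (by linarith [h1.2]) hn0.le
  have h2 := Finset.card_le_card hsub
  rw [Nat.card_Icc] at h2
  have h3 : (⌈n * (t - h)⌉₊ : ℝ) ≤ n * (t - h) + 1 :=
    (Nat.ceil_lt_add_one (mul_nonneg hn0.le (by linarith))).le
  have h4 : (⌊n * (t + h)⌋₊ : ℝ) ≤ n * (t + h) := Nat.floor_le hth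
  have h5 : (n : ℝ) * (t - h) ≤ ⌈n * (t - h)⌉₊ := Nat.le_ceil _
  rcases le_total (⌈n * (t - h)⌉₊) (⌊n * (t + h)⌋₊ + 1) with h6 | h6
  · have h7 : ((activeSet n h t).card : ℝ) ≤ ((⌊n * (t + h)⌋₊ + 1 - ⌈n * (t - h)⌉₊ : ℕ) : ℝ) := by
      exact_mod_cast h2
    rw [Nat.cast_sub h6] at h7
    push_cast at h7
    linarith
  · have : (activeSet n h t).card = 0 := by omega
    rw [this]
    push_cast
    linarith

lemma sum_kernel_eq_sum_activeSet {K : ℝ → ℝ} (hK : IsKernel K) (n : ℕ) (h t : ℝ) (g : ℕ → ℝ) :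
    ∑ i ∈ Finset.Icc 1 n, K (designPt n h t i) * g i
      = ∑ i ∈ activeSet n h t, K (designPt n h t i) * g i := by
  refine (Finset.sum_subset (Finset.filter_subset _ _) fun i hi hni => ?_).symm
  have : 1 < |designPt n h t i| := by
    by_contra hcon
    exact hni (Finset.mem_filter.2 ⟨hi, not_lt.1 hcon⟩)
  rw [hK.support _ this, zero_mul]

/-- An affine function that is small at two distant points of `[-1, 1]` has small coefficients. -/
lemma sq_add_sq_le_of_affine {a b x y g : ℝ} (hg : 0 < g) (hxy : g ≤ y - x) (hx : |x| ≤ 1) :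
    a ^ 2 + b ^ 2 ≤ (2 + 6 / g ^ 2) * ((a + b * x) ^ 2 + (a + b * y) ^ 2) := by
  have h1 : b ^ 2 * g ^ 2 ≤ 2 * ((a + b * x) ^ 2 + (a + b * y) ^ 2) := by
    have h2 : b ^ 2 * g ^ 2 ≤ b ^ 2 * (y - x) ^ 2 := by gcongr
    nlinarith [sq_nonneg ((a + b * x) + (a + b * y))]
  have h3 : b ^ 2 ≤ 2 / g ^ 2 * ((a + b * x) ^ 2 + (a + b * y) ^ 2) := by
    rw [div_mul_eq_mul_div, le_div_iff₀ (by positivity)]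
    exact h1
  have h4 : x ^ 2 ≤ 1 := by nlinarith [abs_le.1 hx]
  have h5 : (b * x) ^ 2 ≤ b ^ 2 := by rw [mul_pow]; nlinarith [sq_nonneg b]
  have h6 : a ^ 2 ≤ 2 * (a + b * x) ^ 2 + 2 * b ^ 2 := by
    nlinarith [sq_nonneg (a + b * x + b * x)]
  have h7 : (2 + 6 / g ^ 2) * ((a + b * x) ^ 2 + (a + b * y) ^ 2)
      = 2 * ((a + b * x) ^ 2 + (a + b * y) ^ 2)
        + 3 * (2 / g ^ 2 * ((a + b * x) ^ 2 + (a + b * y) ^ 2)) := by ring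
  rw [h7]
  nlinarith [sq_nonneg (a + b * y)]

/-- `K` has a non-degenerate local design: the weighted sum of squares of an affine function of
the standardized position controls the coefficients, with a factor of the order `n h`. -/
theorem IsKernel.exists_design_bound {K : ℝ → ℝ} (hK : IsKernel K) :
    ∃ c > (0 : ℝ), ∃ C₀ : ℝ, ∀ (n : ℕ) (h t : ℝ), 0 < h → h ≤ t → h ≤ 1 - t → C₀ ≤ n * h →
      ∀ a b : ℝ, c * (n * h) * (a ^ 2 + b ^ 2)
        ≤ ∑ i ∈ Finset.Icc 1 n, K (designPt n h t i) * (a + b * designPt n h t i) ^ 2 := by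
  obtain ⟨x₀, x₁, κ₀, hx, hκ, hsub, hge⟩ := hK.exists_ge
  set w := x₁ - x₀ with hw
  have hw0 : 0 < w := by linarith
  set g := w / 3 with hg
  have hg0 : 0 < g := by positivity
  set Γ := 2 * (2 + 6 / g ^ 2) with hΓ
  have hΓ0 : 0 < Γ := by positivity
  refine ⟨κ₀ * (g / 2) / Γ, by positivity, 2 / g, fun n h t hh ht ht1 hn a b => ?_⟩
  have hnh : 2 ≤ n * h * g := by rwa [div_le_iff₀ hg0] at hn
  have hn0 : (0 : ℝ) < n := by
    by_contra hcon
    nlinarith [mul_pos hh hg0]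
  set q := (a ^ 2 + b ^ 2) / Γ with hq
  have hq0 : 0 ≤ q := by positivity
  have hx0 := hsub ⟨le_refl x₀, hx.le⟩
  have hx1 := hsub ⟨hx.le, le_refl x₁⟩
  -- on one of two disjoint windows the affine function is nowhere small
  have key : ∀ α : ℝ, x₀ ≤ α → α + g ≤ x₁ → (∀ z ∈ Icc α (α + g), q ≤ (a + b * z) ^ 2) →
      κ₀ * (g / 2) / Γ * (n * h) * (a ^ 2 + b ^ 2)
        ≤ ∑ i ∈ Finset.Icc 1 n, K (designPt n h t i) * (a + b * designPt n h t i) ^ 2 := by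
    intro α hα hβ hz
    have hpos : 0 < t + h * α := by nlinarith [hx0.1]
    have hle1 : t + h * (α + g) ≤ 1 := by nlinarith [hx1.2]
    set J := Finset.Icc ⌈n * (t + h * α)⌉₊ ⌊n * (t + h * (α + g))⌋₊ with hJ
    have hJsub : J ⊆ Finset.Icc 1 n := by
      intro i hi
      rw [Finset.mem_Icc] at hi ⊢
      constructor
      · have h1 : 0 < ⌈n * (t + h * α)⌉₊ := Nat.ceil_pos.2 (by positivity)
        omega
      · refine hi.2.trans (Nat.floor_le_of_le ?_)
        nlinarith
    have hJz : ∀ i ∈ J, designPt n h t i ∈ Icc α (α + g) := by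
      intro i hi
      rw [Finset.mem_Icc, Nat.ceil_le, Nat.le_floor_iff (by nlinarith [mul_pos hh hg0])] at hi
      rw [mem_Icc, designPt, le_div_iff₀ hh, div_le_iff₀ hh]
      have e1 : t + h * α ≤ (i : ℝ) / n := by
        rw [le_div_iff₀ hn0]; linarith [hi.1]
      have e2 : (i : ℝ) / n ≤ t + h * (α + g) := by
        rw [div_le_iff₀ hn0]; linarith [hi.2]
      constructor <;> linarith
    have hcard : n * h * g / 2 ≤ (J.card : ℝ) := by
      rw [hJ, Nat.card_Icc]
      have h3 : (⌈n * (t + h * α)⌉₊ : ℝ) ≤ n * (t + h * α) + 1 :=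
        (Nat.ceil_lt_add_one (by positivity)).le
      have h4 : (n : ℝ) * (t + h * (α + g)) ≤ ⌊n * (t + h * (α + g))⌋₊ + 1 :=
        (Nat.lt_floor_add_one _).le
      have h5 : ((⌊n * (t + h * (α + g))⌋₊ + 1 : ℕ) : ℝ) ≤
          ((⌊n * (t + h * (α + g))⌋₊ + 1 - ⌈n * (t + h * α)⌉₊ : ℕ) : ℝ)
            + (⌈n * (t + h * α)⌉₊ : ℝ) := by
        rw [← Nat.cast_add]
        exact_mod_cast (by omega : ∀ a b : ℕ, a ≤ a - b + b) _ _
      push_cast at h5 ⊢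
      nlinarith
    calc κ₀ * (g / 2) / Γ * (n * h) * (a ^ 2 + b ^ 2) = n * h * g / 2 * (κ₀ * q) := by
          rw [hq]; ring
      _ ≤ J.card * (κ₀ * q) := by gcongr
      _ = ∑ i ∈ J, κ₀ * q := by rw [Finset.sum_const, nsmul_eq_mul]
      _ ≤ ∑ i ∈ J, K (designPt n h t i) * (a + b * designPt n h t i) ^ 2 := by
          refine Finset.sum_le_sum fun i hi => ?_
          have h1 := hJz i hi
          exact mul_le_mul (hge _ ⟨hα.trans h1.1, h1.2.trans hβ⟩) (hz _ h1) hq0 (hK.nonneg _)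
      _ ≤ _ := Finset.sum_le_sum_of_subset_of_nonneg hJsub fun i _ _ =>
          mul_nonneg (hK.nonneg _) (sq_nonneg _)
  by_cases hleft : ∀ z ∈ Icc x₀ (x₀ + g), q ≤ (a + b * z) ^ 2
  · exact key x₀ le_rfl (by linarith) hleft
  · refine key (x₁ - g) (by linarith) (by linarith) fun y hy => ?_
    push Not at hleft
    obtain ⟨z, hz, hzq⟩ := hleft
    have hz1 : |z| ≤ 1 := abs_le.2 ⟨by linarith [hz.1, hx0.1], by linarith [hz.2, hx1.2]⟩
    have h1 := sq_add_sq_le_of_affine (a := a) (b := b) hg0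
      (show g ≤ y - z by linarith [hz.2, hy.1]) hz1
    have h2 : a ^ 2 + b ^ 2 = q * Γ := by rw [hq]; field_simp
    rw [h2, hΓ] at h1
    have h3 : 0 < 2 + 6 / g ^ 2 := by positivity
    have h4 : q * 2 ≤ (a + b * z) ^ 2 + (a + b * y) ^ 2 := by
      refine le_of_mul_le_mul_left ?_ h3
      linarith
    linarith

end Design

/-! ### Minimisers of the local linear criteria -/

section Minimiser

/-- A continuous criterion that grows quadratically away from `θ` has a minimiser, and the
minimisers are as close to `θ` as the linear part is small. -/
lemma epsilon_minimiser_le {V : Type*} [NormedAddCommGroup V] [ProperSpace V] [Nonempty V]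
    {Q : V → ℝ} (hQ : Continuous Q) (θ : V) {D : V → ℝ} {A c E : ℝ} (hA : 0 ≤ A) (hc : 0 < c)
    (hE : 0 ≤ E) (hD0 : ∀ η, 0 ≤ D η) (hD : ∀ η, ‖η - θ‖ ≤ A * D η)
    (h : ∀ η, Q θ - 2 * E * D η + c * D η ^ 2 ≤ Q η) :
    D (Classical.epsilon fun η => ∀ η', Q η ≤ Q η') ≤ 2 * E / c := by
  have hle : ∀ η, Q η ≤ Q θ → D η ≤ 2 * E / c := by
    intro η hη
    rw [le_div_iff₀ hc]
    rcases (hD0 η).eq_or_lt with h0 | h0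
    · rw [← h0]
      linarith
    · have h1 := h η
      have h2 : D η * (D η * c) ≤ D η * (2 * E) := by nlinarith
      exact le_of_mul_le_mul_left h2 h0
  have hex : ∃ η, ∀ η', Q η ≤ Q η' := by
    refine hQ.exists_forall_le' θ ?_
    have hcomp : IsCompact (Metric.closedBall θ (A * (2 * E / c))) := isCompact_closedBall _ _
    filter_upwards [hcomp.compl_mem_cocompact] with η hη
    by_contra! hcon
    refine hη ?_
    rw [Metric.mem_closedBall, dist_eq_norm]
    exact (hD η).trans (mul_le_mul_of_nonneg_left (hle η hcon.le) hA)
  exact hle _ (Classical.epsilon_spec hex θ)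

/-- If the local design is non-degenerate, the local linear estimator is close to the intercept of
any line whose kernel-weighted residuals nearly satisfy the normal equations. -/
theorem abs_localLinear_sub_le {n : ℕ} {K : ℝ → ℝ} {h t : ℝ} (hh : 0 < h) {c : ℝ} (hc : 0 < c)
    (hdes : ∀ a b : ℝ, c * (a ^ 2 + b ^ 2)
      ≤ ∑ i ∈ Finset.Icc 1 n, K (designPt n h t i) * (a + b * designPt n h t i) ^ 2)
    (y : ℕ → ℝ) (θ₀ θ₁ : ℝ) :
    |localLinear n K h y t - θ₀| ≤ 2 *
      (|∑ i ∈ Finset.Icc 1 n, K (designPt n h t i) * (y i - θ₀ - θ₁ * ((i : ℝ) / n - t))| +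
       |∑ i ∈ Finset.Icc 1 n, K (designPt n h t i) *
          (designPt n h t i * (y i - θ₀ - θ₁ * ((i : ℝ) / n - t)))|) / c := by
  set E₀ := ∑ i ∈ Finset.Icc 1 n, K (designPt n h t i) * (y i - θ₀ - θ₁ * ((i : ℝ) / n - t))
  set E₁ := ∑ i ∈ Finset.Icc 1 n, K (designPt n h t i) *
    (designPt n h t i * (y i - θ₀ - θ₁ * ((i : ℝ) / n - t)))
  set D : ℝ × ℝ → ℝ := fun η => max |η.1 - θ₀| (h * |η.2 - θ₁|) with hDdef
  have hQ : Continuous (llObjective n K h y t) := by unfold llObjective; fun_prop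
  have hD : ∀ η : ℝ × ℝ, ‖η - (θ₀, θ₁)‖ ≤ max 1 h⁻¹ * D η := by
    intro η
    rw [Prod.norm_def]
    refine max_le ?_ ?_
    · calc |η.1 - θ₀| = 1 * |η.1 - θ₀| := (one_mul _).symm
        _ ≤ _ := mul_le_mul (le_max_left _ _) (le_max_left _ _) (abs_nonneg _) (by positivity)
    · calc |η.2 - θ₁| = h⁻¹ * (h * |η.2 - θ₁|) := by field_simp
        _ ≤ _ := mul_le_mul (le_max_right _ _) (le_max_right _ _) (by positivity) (by positivity)
  have hmain : ∀ η, llObjective n K h y t (θ₀, θ₁) - 2 * (|E₀| + |E₁|) * D η + c * D η ^ 2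
      ≤ llObjective n K h y t η := by
    intro η
    set d₀ := η.1 - θ₀ with hd₀
    set d₁ := h * (η.2 - θ₁) with hd₁
    have hexp : llObjective n K h y t η = llObjective n K h y t (θ₀, θ₁)
        - 2 * (d₀ * E₀ + d₁ * E₁)
        + ∑ i ∈ Finset.Icc 1 n, K (designPt n h t i) * (d₀ + d₁ * designPt n h t i) ^ 2 := by
      simp only [llObjective, E₀, E₁, Finset.mul_sum, ← Finset.sum_add_distrib,
        ← Finset.sum_sub_distrib]
      refine Finset.sum_congr rfl fun i _ => ?_
      have e : (i : ℝ) / n - t = h * designPt n h t i := by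
        rw [designPt]; field_simp
      change _ * K (designPt n h t i) = _ * K (designPt n h t i) - _ + _
      rw [e, hd₀, hd₁]
      ring
    have hD0 : |d₀| ≤ D η := le_max_left _ _
    have hD1 : |d₁| ≤ D η := by
      rw [hd₁, abs_mul, abs_of_pos hh]; exact le_max_right _ _
    have h1 : d₀ * E₀ + d₁ * E₁ ≤ (|E₀| + |E₁|) * D η := by
      have e1 := le_abs_self (d₀ * E₀)
      have e2 := le_abs_self (d₁ * E₁)
      rw [abs_mul] at e1 e2
      nlinarith [mul_le_mul_of_nonneg_right hD0 (abs_nonneg E₀),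
        mul_le_mul_of_nonneg_right hD1 (abs_nonneg E₁)]
    have h2 : D η ^ 2 ≤ d₀ ^ 2 + d₁ ^ 2 := by
      have e : h * |η.2 - θ₁| = |d₁| := by rw [hd₁, abs_mul, abs_of_pos hh]
      rcases max_cases |η.1 - θ₀| (h * |η.2 - θ₁|) with h3 | h3
      · rw [hDdef]; dsimp only; rw [h3.1, sq_abs]; nlinarith [sq_nonneg d₁]
      · rw [hDdef]; dsimp only; rw [h3.1, e, sq_abs]; nlinarith [sq_nonneg d₀]
    have h3 := hdes d₀ d₁
    have h4 := mul_le_mul_of_nonneg_left h2 hc.le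
    rw [hexp]
    linarith
  have := epsilon_minimiser_le hQ (θ₀, θ₁) (by positivity) hc (by positivity)
    (fun η => le_max_of_le_left (abs_nonneg _)) hD hmain
  exact (le_max_left _ _).trans this

/-- The analogue of `abs_localLinear_sub_le` for the regression criterion, the normal equations
and the design being expressed through linear and quadratic forms. -/
theorem norm_regLocalLinear_sub_le {d n : ℕ} {K : ℝ → ℝ} {h t : ℝ} (hh : 0 < h) {c E : ℝ}
    (hc : 0 < c) (hE : 0 ≤ E) (x : ℕ → EuclideanSpace ℝ (Fin d)) (y : ℕ → ℝ)
    (θ₀ θ₁ : EuclideanSpace ℝ (Fin d))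
    (hdes : ∀ v₀ v₁ : EuclideanSpace ℝ (Fin d), c * (max ‖v₀‖ ‖v₁‖) ^ 2
      ≤ ∑ i ∈ Finset.Icc 1 n, K (designPt n h t i) *
        (inner ℝ (x i) (v₀ + designPt n h t i • v₁)) ^ 2)
    (hlin : ∀ v₀ v₁ : EuclideanSpace ℝ (Fin d),
      ∑ i ∈ Finset.Icc 1 n, K (designPt n h t i) *
        ((y i - inner ℝ (x i) (θ₀ + designPt n h t i • θ₁)) *
          inner ℝ (x i) (v₀ + designPt n h t i • v₁)) ≤ E * max ‖v₀‖ ‖v₁‖) :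
    ‖regLocalLinear n K h x y t - θ₀‖ ≤ 2 * E / c := by
  set D : EuclideanSpace ℝ (Fin d) × EuclideanSpace ℝ (Fin d) → ℝ :=
    fun η => max ‖η.1 - θ₀‖ ‖h • η.2 - θ₁‖ with hDdef
  have hQ : Continuous (regObjective n K h x y t) := by unfold regObjective; fun_prop
  have hD : ∀ η, ‖η - (θ₀, h⁻¹ • θ₁)‖ ≤ max 1 h⁻¹ * D η := by
    intro η
    rw [Prod.norm_def]
    refine max_le ?_ ?_
    · calc ‖η.1 - θ₀‖ = 1 * ‖η.1 - θ₀‖ := (one_mul _).symm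
        _ ≤ _ := mul_le_mul (le_max_left _ _) (le_max_left _ _) (norm_nonneg _) (by positivity)
    · have e : η.2 - h⁻¹ • θ₁ = h⁻¹ • (h • η.2 - θ₁) := by
        rw [smul_sub, smul_smul, inv_mul_cancel₀ hh.ne', one_smul]
      calc ‖η.2 - h⁻¹ • θ₁‖ = h⁻¹ * ‖h • η.2 - θ₁‖ := by
            rw [e, norm_smul, Real.norm_of_nonneg (by positivity)]
        _ ≤ _ := mul_le_mul (le_max_right _ _) (le_max_right _ _) (norm_nonneg _) (by positivity)
  have hmain : ∀ η, regObjective n K h x y t (θ₀, h⁻¹ • θ₁) - 2 * E * D η + c * D η ^ 2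
      ≤ regObjective n K h x y t η := by
    intro η
    set d₀ := η.1 - θ₀ with hd₀
    set d₁ := h • η.2 - θ₁ with hd₁
    have hexp : regObjective n K h x y t η = regObjective n K h x y t (θ₀, h⁻¹ • θ₁)
        - 2 * ∑ i ∈ Finset.Icc 1 n, K (designPt n h t i) *
          ((y i - inner ℝ (x i) (θ₀ + designPt n h t i • θ₁)) *
            inner ℝ (x i) (d₀ + designPt n h t i • d₁))
        + ∑ i ∈ Finset.Icc 1 n, K (designPt n h t i) *
          (inner ℝ (x i) (d₀ + designPt n h t i • d₁)) ^ 2 := by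
      simp only [regObjective, Finset.mul_sum, ← Finset.sum_add_distrib,
        ← Finset.sum_sub_distrib]
      refine Finset.sum_congr rfl fun i _ => ?_
      have e : (i : ℝ) / n - t = h * designPt n h t i := by
        rw [designPt]; field_simp
      change _ * K (designPt n h t i) = _ * K (designPt n h t i) - _ + _
      rw [e, hd₀, hd₁]
      simp only [inner_add_right, inner_smul_right, inner_sub_right]
      field_simp
      ring
    have h2 := hdes d₀ d₁
    have h3 := hlin d₀ d₁
    rw [hexp]
    change _ - 2 * E * max ‖d₀‖ ‖d₁‖ + c * (max ‖d₀‖ ‖d₁‖) ^ 2 ≤ _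
    linarith
  have := epsilon_minimiser_le hQ (θ₀, h⁻¹ • θ₁) (by positivity) hc hE
    (fun η => le_max_of_le_left (norm_nonneg _)) hD hmain
  exact (le_max_left _ _).trans this

end Minimiser

/-! ### Increasing curves with a Lipschitz second derivative -/

section Curve

lemma mul_sub_le_of_le_derivWithin {f : ℝ → ℝ} {M : ℝ} (hf : DifferentiableOn ℝ f (Icc 0 1))
    (hM : ∀ t ∈ Icc (0 : ℝ) 1, M ≤ derivWithin f (Icc 0 1) t) {u v : ℝ} (hu : u ∈ Icc (0 : ℝ) 1)
    (hv : v ∈ Icc (0 : ℝ) 1) (huv : u ≤ v) : M * (v - u) ≤ f v - f u := by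
  refine (convex_Icc (0 : ℝ) 1).mul_sub_le_image_sub_of_le_deriv hf.continuousOn
    (hf.mono interior_subset) (fun x hx => ?_) u hu v hv huv
  rw [← derivWithin_of_mem_nhds (mem_interior_iff_mem_nhds.1 hx)]
  exact hM x (interior_subset hx)

/-- Away from the boundary, the error of the linear approximation is controlled by the slope. The
slope cannot drop below `M` on either side, so a large second derivative forces a large slope;
neither is bounded in the high-dimensional model. -/
theorem exists_abs_sub_linear_le {L M τ : ℝ} (hL : 0 ≤ L) (hM : 0 < M) (hτ : 0 < τ) :
    ∃ C > (0 : ℝ), ∀ f : ℝ → ℝ, DifferentiableOn ℝ f (Icc 0 1) →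
      DifferentiableOn ℝ (derivWithin f (Icc 0 1)) (Icc 0 1) →
      (∀ x ∈ Icc (0 : ℝ) 1, ∀ y ∈ Icc (0 : ℝ) 1,
        |derivWithin (derivWithin f (Icc 0 1)) (Icc 0 1) x
          - derivWithin (derivWithin f (Icc 0 1)) (Icc 0 1) y| ≤ L * |x - y|) →
      (∀ t ∈ Icc (0 : ℝ) 1, M ≤ derivWithin f (Icc 0 1) t) →
      ∀ t ∈ Icc τ (1 - τ), ∀ u ∈ Icc (0 : ℝ) 1,
        |f u - f t - derivWithin f (Icc 0 1) t * (u - t)|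
          ≤ C * derivWithin f (Icc 0 1) t * (u - t) ^ 2 := by
  refine ⟨((1 + L / M) / τ + L / M), by positivity, fun f hf hf' hL' hM' t ht u hu => ?_⟩
  set I := Icc (0 : ℝ) 1 with hI
  set f₁ := derivWithin f I
  set f₂ := derivWithin f₁ I
  have htI : t ∈ I := ⟨by linarith [ht.1], by linarith [ht.2]⟩
  have hd1 : ∀ x ∈ I, HasDerivWithinAt f (f₁ x) I x := fun x hx => (hf x hx).hasDerivWithinAt
  have hd2 : ∀ x ∈ I, HasDerivWithinAt f₁ (f₂ x) I x := fun x hx => (hf' x hx).hasDerivWithinAt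
  have hdist : ∀ x ∈ I, |x - t| ≤ 1 := fun x hx => abs_le.2
    ⟨by linarith [hx.1, htI.2], by linarith [hx.2, htI.1]⟩
  have hbd : ∀ x ∈ I, |f₂ x - f₂ t| ≤ L := fun x hx =>
    (hL' x hx t htI).trans (mul_le_of_le_one_right hL (hdist x hx))
  have hq : ∀ x ∈ I, f₁ x ≤ f₁ t + f₂ t * (x - t) + L := by
    intro x hx
    have h := (convex_Icc (0 : ℝ) 1).norm_image_sub_le_of_norm_hasDerivWithin_le
      (f := fun y => f₁ y - f₂ t * y) (f' := fun y => f₂ y - f₂ t * 1) (C := L)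
      (fun y hy => (hd2 y hy).sub ((hasDerivWithinAt_id y I).const_mul _))
      (fun y hy => by simpa using hbd y hy) htI hx
    rw [Real.norm_eq_abs, Real.norm_eq_abs] at h
    have h2 := (le_abs_self _).trans h
    have h3 := mul_le_of_le_one_right hL (hdist x hx)
    nlinarith
  have hMt : M ≤ f₁ t := hM' t htI
  have hD : |f₂ t| * τ ≤ f₁ t + L := by
    rcases abs_cases (f₂ t) with h | h
    · have hx : t - τ ∈ I := ⟨by linarith [ht.1], by linarith [ht.2]⟩
      have h1 := hq _ hx
      have h2 := hM' _ hx
      rw [h.1]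
      nlinarith
    · have hx : t + τ ∈ I := ⟨by linarith [ht.1], by linarith [ht.2]⟩
      have h1 := hq _ hx
      have h2 := hM' _ hx
      rw [h.1]
      nlinarith
  set C := (1 + L / M) / τ + L / M with hC
  have hLM : L ≤ L / M * f₁ t := by
    rw [div_mul_eq_mul_div, le_div_iff₀ hM]
    exact mul_le_mul_of_nonneg_left hMt hL
  have hf2 : ∀ x ∈ I, |f₂ x| ≤ C * f₁ t := by
    intro x hx
    have h1 : |f₂ t| ≤ (1 + L / M) / τ * f₁ t := by
      rw [div_mul_eq_mul_div, le_div_iff₀ hτ]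
      linarith
    have h2 := abs_sub_abs_le_abs_sub (f₂ x) (f₂ t)
    have h3 := hbd x hx
    rw [hC, add_mul]
    linarith
  have hf1 : ∀ x ∈ I, |f₁ x - f₁ t| ≤ C * f₁ t * |x - t| := fun x hx =>
    (convex_Icc (0 : ℝ) 1).norm_image_sub_le_of_norm_hasDerivWithin_le hd2 hf2 htI hx
  have hseg : uIcc t u ⊆ I := uIcc_subset_Icc htI hu
  have hC0 : 0 ≤ C * f₁ t := (abs_nonneg _).trans (hf2 t htI)
  have h := (convex_uIcc t u).norm_image_sub_le_of_norm_hasDerivWithin_le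
    (f := fun y => f y - f₁ t * y) (f' := fun y => f₁ y - f₁ t * 1) (C := C * f₁ t * |u - t|)
    (fun y hy => ((hd1 y (hseg hy)).mono hseg).sub ((hasDerivWithinAt_id y _).const_mul _))
    (fun y hy => by
      simp only [mul_one, Real.norm_eq_abs]
      exact (hf1 y (hseg hy)).trans (mul_le_mul_of_nonneg_left
        (abs_sub_left_of_mem_uIcc hy) hC0)) left_mem_uIcc right_mem_uIcc
  rw [Real.norm_eq_abs, Real.norm_eq_abs, mul_assoc, abs_mul_abs_self, ← sq] at h
  refine le_trans (le_of_eq ?_) h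
  congr 1
  ring

end Curve

/-! ### The smoothed monotone rearrangement -/

section Rearrangement

lemma IsKernel.integrable {K : ℝ → ℝ} (hK : IsKernel K) : Integrable K := by
  by_contra h
  have := hK.integral_eq_one
  rw [integral_undef h] at this
  exact zero_ne_one this

lemma IsKernel.integrable_comp {K : ℝ → ℝ} (hK : IsKernel K) {h : ℝ} (hh : 0 < h) (a : ℝ) :
    Integrable fun u => 1 / h * K ((a - u) / h) :=
  ((hK.integrable.comp_div hh.ne').comp_sub_left a).const_mul _

lemma IsKernel.integral_comp {K : ℝ → ℝ} (hK : IsKernel K) {h : ℝ} (hh : 0 < h) (a : ℝ) :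
    ∫ u, 1 / h * K ((a - u) / h) = 1 := by
  rw [integral_const_mul, integral_sub_left_eq_self (fun u => K (u / h)) volume a,
    Measure.integral_comp_div, hK.integral_eq_one, abs_of_pos hh]
  simp [hh.ne']

/-- The smoothed indicator of `a ≤ s`, the summand of the rearrangement. -/
def smoothStep (K : ℝ → ℝ) (h a s : ℝ) : ℝ := ∫ u in Iic s, 1 / h * K ((a - u) / h)

lemma rearrangedInv_eq {K : ℝ → ℝ} (hK : IsKernel K) (N : ℕ) {h : ℝ} (hh : 0 < h) (g : ℝ → ℝ)
    (s : ℝ) : rearrangedInv N K h g s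
      = 1 / (N : ℝ) * ∑ i ∈ Finset.Icc 1 N, smoothStep K h (g ((i : ℝ) / N)) s := by
  unfold rearrangedInv smoothStep
  rw [← integral_finsetSum _ fun i _ => (hK.integrable_comp hh _).integrableOn, ← integral_const_mul]
  refine integral_congr_ae (ae_of_all _ fun u => ?_)
  simp only [← Finset.mul_sum]
  rw [← mul_assoc, one_div_mul_one_div]

lemma smoothStep_mono {K : ℝ → ℝ} (hK : IsKernel K) {h : ℝ} (hh : 0 < h) (a : ℝ) :
    Monotone (smoothStep K h a) := fun _ _ hst =>
  setIntegral_mono_set (hK.integrable_comp hh a).integrableOn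
    (ae_of_all _ fun _ => mul_nonneg (by positivity) (hK.nonneg _))
    (Iic_subset_Iic.2 hst).eventuallyLE

lemma smoothStep_nonneg {K : ℝ → ℝ} (hK : IsKernel K) {h : ℝ} (hh : 0 < h) (a s : ℝ) :
    0 ≤ smoothStep K h a s :=
  setIntegral_nonneg measurableSet_Iic fun _ _ => mul_nonneg (by positivity) (hK.nonneg _)

lemma smoothStep_le_one {K : ℝ → ℝ} (hK : IsKernel K) {h : ℝ} (hh : 0 < h) (a s : ℝ) :
    smoothStep K h a s ≤ 1 := by
  rw [← hK.integral_comp hh a]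
  exact setIntegral_le_integral (hK.integrable_comp hh a)
    (ae_of_all _ fun _ => mul_nonneg (by positivity) (hK.nonneg _))

lemma smoothStep_eq_zero {K : ℝ → ℝ} (hK : IsKernel K) {h : ℝ} (hh : 0 < h) {a s : ℝ}
    (hs : s + h < a) : smoothStep K h a s = 0 := by
  refine setIntegral_eq_zero_of_forall_eq_zero fun u hu => ?_
  rw [hK.support, mul_zero]
  refine lt_abs.2 (Or.inl ?_)
  rw [lt_div_iff₀ hh]
  linarith [mem_Iic.1 hu]

lemma smoothStep_eq_one {K : ℝ → ℝ} (hK : IsKernel K) {h : ℝ} (hh : 0 < h) {a s : ℝ}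
    (hs : a + h ≤ s) : smoothStep K h a s = 1 := by
  rw [← hK.integral_comp hh a]
  refine setIntegral_eq_integral_of_forall_compl_eq_zero fun u hu => ?_
  rw [hK.support, mul_zero]
  refine lt_abs.2 (Or.inr ?_)
  rw [← neg_div, lt_div_iff₀ hh]
  linarith [not_le.1 (fun h => hu (mem_Iic.2 h))]

lemma continuous_smoothStep {K : ℝ → ℝ} (hK : IsKernel K) {h : ℝ} (hh : 0 < h) (a : ℝ) :
    Continuous (smoothStep K h a) := by
  have hi := hK.integrable_comp hh a
  have h1 : smoothStep K h a = fun s => (∫ u in Iic (0 : ℝ), 1 / h * K ((a - u) / h))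
      + ∫ u in (0 : ℝ)..s, 1 / h * K ((a - u) / h) := by
    funext s
    rw [← intervalIntegral.integral_Iic_sub_Iic hi.integrableOn hi.integrableOn]
    simp [smoothStep]
  rw [h1]
  exact continuous_const.add (intervalIntegral.continuous_primitive
    (fun _ _ => hi.intervalIntegrable) 0)

lemma continuous_rearrangedInv {K : ℝ → ℝ} (hK : IsKernel K) (N : ℕ) {h : ℝ} (hh : 0 < h)
    (g : ℝ → ℝ) : Continuous (rearrangedInv N K h g) := by
  rw [funext (rearrangedInv_eq hK N hh g)]
  exact continuous_const.mul (continuous_finsetSum _ fun i _ => continuous_smoothStep hK hh _)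

lemma rearrangedInv_mono {K : ℝ → ℝ} (hK : IsKernel K) (N : ℕ) {h : ℝ} (hh : 0 < h)
    (g : ℝ → ℝ) : Monotone (rearrangedInv N K h g) := by
  intro s t hst
  rw [rearrangedInv_eq hK N hh, rearrangedInv_eq hK N hh]
  exact mul_le_mul_of_nonneg_left
    (Finset.sum_le_sum fun i _ => smoothStep_mono hK hh _ hst) (by positivity)

lemma rearrangedInv_le_card {K : ℝ → ℝ} (hK : IsKernel K) (N : ℕ) {h : ℝ} (hh : 0 < h)
    (g : ℝ → ℝ) (s : ℝ) : rearrangedInv N K h g s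
      ≤ 1 / (N : ℝ) * ({i ∈ Finset.Icc 1 N | g ((i : ℝ) / N) ≤ s + h} : Finset ℕ).card := by
  rw [rearrangedInv_eq hK N hh, Finset.card_filter]
  push_cast
  refine mul_le_mul_of_nonneg_left (Finset.sum_le_sum fun i _ => ?_) (by positivity)
  split_ifs with hi
  · exact smoothStep_le_one hK hh _ _
  · exact (smoothStep_eq_zero hK hh (not_le.1 hi)).le

lemma card_le_rearrangedInv {K : ℝ → ℝ} (hK : IsKernel K) (N : ℕ) {h : ℝ} (hh : 0 < h)
    (g : ℝ → ℝ) (s : ℝ) :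
    1 / (N : ℝ) * ({i ∈ Finset.Icc 1 N | g ((i : ℝ) / N) + h ≤ s} : Finset ℕ).card
      ≤ rearrangedInv N K h g s := by
  rw [rearrangedInv_eq hK N hh, Finset.card_filter]
  push_cast
  refine mul_le_mul_of_nonneg_left (Finset.sum_le_sum fun i _ => ?_) (by positivity)
  split_ifs with hi
  · exact (smoothStep_eq_one hK hh hi).ge
  · exact smoothStep_nonneg hK hh _ _

/-- If outside a small set of grid points `g` and `g₀` lie between two horizontal shifts of a
strictly increasing curve, then the rearrangement maps the range of `g₀` onto almost all of the
unit interval. Nothing is required at the exceptional points: they change the counts that sandwich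
the rearrangement by their number only. -/
theorem Icc_subset_image_rearrangedInv {K : ℝ → ℝ} (hK : IsKernel K) {N : ℕ} (hN : 0 < N)
    {h M κ β e : ℝ} (hh : 0 < h) (hM : 0 < M) (hκ : 0 ≤ κ) {f g g₀ : ℝ → ℝ}
    (hf : ∀ u ∈ Icc (0 : ℝ) 1, ∀ v ∈ Icc (0 : ℝ) 1, u ≤ v → M * (v - u) ≤ f v - f u)
    {Bad : Finset ℕ} (hBad : (Bad.card : ℝ) ≤ β * N)
    (hgood : ∀ i ∈ Finset.Icc 1 N, i ∉ Bad → (i : ℝ) / N ∈ Icc κ (1 - κ) ∧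
      (f ((i : ℝ) / N - κ) ≤ g ((i : ℝ) / N) ∧ g ((i : ℝ) / N) ≤ f ((i : ℝ) / N + κ)) ∧
      (f ((i : ℝ) / N - κ) ≤ g₀ ((i : ℝ) / N) ∧ g₀ ((i : ℝ) / N) ≤ f ((i : ℝ) / N + κ)))
    (he : 2 * β + 1 / N + 2 * κ + h / M ≤ e) (he2 : e < 1 / 2) :
    Icc e (1 - e) ⊆ rearrangedInv N K h g '' gridRange N g₀ := by
  have hN0 : (0 : ℝ) < N := by exact_mod_cast hN
  have hhM : 0 < h / M := by positivity
  have hN1 : 0 < 1 / (N : ℝ) := by positivity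
  have hβ : 0 ≤ β := by
    by_contra hcon
    have : β * N < 0 := mul_neg_of_neg_of_pos (by linarith) hN0
    have h2 : (0 : ℝ) ≤ Bad.card := by positivity
    linarith
  have hcardN : Bad.card + 1 ≤ N := by
    have h1 : (β + 1 / N) * N < 1 * N := by
      refine mul_lt_mul_of_pos_right ?_ hN0
      linarith
    rw [add_mul, one_div_mul_cancel hN0.ne', one_mul] at h1
    have : ((Bad.card + 1 : ℕ) : ℝ) ≤ N := by push_cast; linarith
    exact_mod_cast this
  have hmemI : ∀ x, x ∈ Icc κ (1 - κ) → x ∈ Icc (0 : ℝ) 1 ∧ x - κ ∈ Icc (0 : ℝ) 1 ∧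
      x + κ ∈ Icc (0 : ℝ) 1 := fun x hx =>
    ⟨⟨by linarith [hx.1], by linarith [hx.2]⟩, ⟨by linarith [hx.1], by linarith [hx.2]⟩,
      ⟨by linarith [hx.1], by linarith [hx.2]⟩⟩
  have hexists : ∀ J : Finset ℕ, J ⊆ Finset.Icc 1 N → Bad.card < J.card →
      ∃ i ∈ J, i ∈ Finset.Icc 1 N ∧ i ∉ Bad := by
    intro J hJ hc
    obtain ⟨i, hi, hib⟩ := Finset.exists_mem_notMem_of_card_lt_card hc
    exact ⟨i, hi, hJ hi, hib⟩
  obtain ⟨i, hi, hiN, hib⟩ := hexists (Finset.Icc 1 (Bad.card + 1))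
    (Finset.Icc_subset_Icc le_rfl hcardN) (by simp)
  obtain ⟨j, hj, hjN, hjb⟩ := hexists (Finset.Icc (N - Bad.card) N)
    (Finset.Icc_subset_Icc (by omega) le_rfl) (by rw [Nat.card_Icc]; omega)
  have hiv : (i : ℝ) / N ≤ β + 1 / N := by
    rw [div_le_iff₀ hN0, add_mul, one_div_mul_cancel hN0.ne']
    have : (i : ℝ) ≤ Bad.card + 1 := by exact_mod_cast (Finset.mem_Icc.1 hi).2
    linarith
  have hjv : 1 - β ≤ (j : ℝ) / N := by
    rw [le_div_iff₀ hN0]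
    have h1 : N ≤ j + Bad.card := by have := (Finset.mem_Icc.1 hj).1; omega
    have h2 : (N : ℝ) ≤ j + Bad.card := by exact_mod_cast h1
    linarith
  obtain ⟨hig, -, hi0⟩ := hgood i hiN hib
  obtain ⟨hjg, -, hj0⟩ := hgood j hjN hjb
  have hlo : rearrangedInv N K h g (g₀ ((i : ℝ) / N)) ≤ e := by
    refine (rearrangedInv_le_card hK N hh g _).trans ?_
    have hsub : ({l ∈ Finset.Icc 1 N | g ((l : ℝ) / N) ≤ g₀ ((i : ℝ) / N) + h} : Finset ℕ) ⊆
        Bad ∪ Finset.Icc 1 ⌊N * ((i : ℝ) / N + 2 * κ + h / M)⌋₊ := by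
      intro l hl
      obtain ⟨hlN, hlg⟩ := Finset.mem_filter.1 hl
      by_cases hlb : l ∈ Bad
      · exact Finset.mem_union_left _ hlb
      refine Finset.mem_union_right _ (Finset.mem_Icc.2 ⟨(Finset.mem_Icc.1 hlN).1, ?_⟩)
      obtain ⟨hl1, hl2, -⟩ := hgood l hlN hlb
      rw [Nat.le_floor_iff (by positivity)]
      have hle : (l : ℝ) / N ≤ (i : ℝ) / N + 2 * κ + h / M := by
        rcases le_total ((l : ℝ) / N - κ) ((i : ℝ) / N + κ) with h1 | h1
        · linarith
        · have h2 := hf _ (hmemI _ hig).2.2 _ (hmemI _ hl1).2.1 h1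
          have h3 : (l : ℝ) / N - κ - ((i : ℝ) / N + κ) ≤ h / M := by
            rw [le_div_iff₀ hM]
            linarith
          linarith
      rw [div_le_iff₀ hN0] at hle
      linarith
    have h1 := (Finset.card_le_card hsub).trans (Finset.card_union_le _ _)
    rw [Nat.card_Icc, Nat.add_sub_cancel] at h1
    have h2 : (({l ∈ Finset.Icc 1 N | g ((l : ℝ) / N) ≤ g₀ ((i : ℝ) / N) + h} : Finset ℕ).card : ℝ)
        ≤ β * N + N * ((i : ℝ) / N + 2 * κ + h / M) := by
      refine (Nat.cast_le.2 h1).trans ?_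
      push_cast
      exact add_le_add hBad (Nat.floor_le (by positivity))
    rw [one_div_mul_eq_div, div_le_iff₀ hN0]
    nlinarith
  have hhi : 1 - e ≤ rearrangedInv N K h g (g₀ ((j : ℝ) / N)) := by
    refine le_trans ?_ (card_le_rearrangedInv hK N hh g _)
    have hsub : Finset.Icc 1 ⌊N * ((j : ℝ) / N - 2 * κ - h / M)⌋₊ ⊆
        Bad ∪ ({l ∈ Finset.Icc 1 N | g ((l : ℝ) / N) + h ≤ g₀ ((j : ℝ) / N)} : Finset ℕ) := by
      intro l hl
      rw [Finset.mem_Icc, Nat.le_floor_iff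
        (mul_nonneg hN0.le (by linarith))] at hl
      have hlN : l ∈ Finset.Icc 1 N := by
        refine Finset.mem_Icc.2 ⟨hl.1, ?_⟩
        have : (l : ℝ) ≤ N := by nlinarith [hjg.2]
        exact_mod_cast this
      by_cases hlb : l ∈ Bad
      · exact Finset.mem_union_left _ hlb
      refine Finset.mem_union_right _ (Finset.mem_filter.2 ⟨hlN, ?_⟩)
      obtain ⟨hl1, hl2, -⟩ := hgood l hlN hlb
      have hle : (l : ℝ) / N ≤ (j : ℝ) / N - 2 * κ - h / M := by
        rw [div_le_iff₀ hN0]; linarith [hl.2]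
      have h2 := hf _ (hmemI _ hl1).2.2 _ (hmemI _ hjg).2.1 (by linarith)
      have h3 : h ≤ M * ((j : ℝ) / N - κ - ((l : ℝ) / N + κ)) := by
        rw [← div_le_iff₀' hM]
        linarith
      linarith [hl2.2, hj0.1]
    have h1 := (Finset.card_le_card hsub).trans (Finset.card_union_le _ _)
    rw [Nat.card_Icc, Nat.add_sub_cancel] at h1
    have h2 := (Nat.lt_floor_add_one ((N : ℝ) * ((j : ℝ) / N - 2 * κ - h / M))).le
    have h3 : ((⌊N * ((j : ℝ) / N - 2 * κ - h / M)⌋₊ : ℕ) : ℝ) ≤ Bad.card +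
        ({l ∈ Finset.Icc 1 N | g ((l : ℝ) / N) + h ≤ g₀ ((j : ℝ) / N)} : Finset ℕ).card := by
      exact_mod_cast h1
    rw [one_div_mul_eq_div, le_div_iff₀ hN0]
    have h4 : (N : ℝ) * (1 / N) = 1 := mul_one_div_cancel hN0.ne'
    nlinarith
  have hij : g₀ ((i : ℝ) / N) ≤ g₀ ((j : ℝ) / N) := by
    by_contra! hcon
    have := rearrangedInv_mono hK N hh g hcon.le
    linarith
  have hivt := intermediate_value_Icc hij (continuous_rearrangedInv hK N hh g).continuousOn
  intro s hs
  obtain ⟨r, hr, hrs⟩ := hivt ⟨hlo.trans hs.1, hs.2.trans hhi⟩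
  exact ⟨r, ⟨⟨i, hiN, hr.1⟩, ⟨j, hjN, hr.2⟩⟩, hrs⟩

end Rearrangement

/-! ### From consistency of the estimators to the index sets -/

section Bandwidths

variable {hr hd : ℕ → ℝ} {N : ℕ → ℕ}

lemma BandwidthCond.tendsto_hr (h : BandwidthCond hr hd N) : Tendsto hr atTop (𝓝 0) := by
  rw [tendsto_order]
  refine ⟨fun a ha => Eventually.of_forall fun n => ha.trans (h.hr_pos n), fun a ha => ?_⟩
  filter_upwards [(tendsto_order.1 h.nhr7).2 (a ^ 7) (by positivity), eventually_ge_atTop 1]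
    with n hn hn1
  have h1 : (1 : ℝ) ≤ n := by exact_mod_cast hn1
  have h2 : hr n ^ 7 < a ^ 7 := by nlinarith [pow_pos (h.hr_pos n) 7]
  exact lt_of_pow_lt_pow_left₀ 7 ha.le h2

lemma BandwidthCond.tendsto_hd (h : BandwidthCond hr hd N) : Tendsto hd atTop (𝓝 0) :=
  h.hd_littleO.isBigO.trans_tendsto h.tendsto_hr

lemma BandwidthCond.tendsto_N (h : BandwidthCond hr hd N) :
    Tendsto (fun n => (N n : ℝ)) atTop atTop := by
  obtain ⟨C, hC, hb⟩ := h.n_bigO.exists_pos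
  have h1 : Tendsto (fun n : ℕ => (n : ℝ) / C) atTop atTop :=
    tendsto_natCast_atTop_atTop.atTop_div_const hC
  refine tendsto_atTop_mono' _ ?_ h1
  filter_upwards [hb.bound] with n hn
  rw [Real.norm_of_nonneg (by positivity), Real.norm_of_nonneg (by positivity)] at hn
  rw [div_le_iff₀ hC]
  linarith

lemma BandwidthCond.tendsto_hd_log (h : BandwidthCond hr hd N) :
    Tendsto (fun n => hd n * Real.log (hd n)⁻¹) atTop (𝓝 0) := by
  have h1 := (Real.continuous_mul_log.tendsto 0).comp h.tendsto_hd
  simp only [zero_mul] at h1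
  have h2 := h1.neg
  simp only [neg_zero] at h2
  refine h2.congr fun n => ?_
  simp [Real.log_inv]

/-- The effective sample size `n h_r` is at least `n ^ (2 / 3)`. -/
lemma BandwidthCond.rpow_le_mul (h : BandwidthCond hr hd N) :
    ∀ᶠ n : ℕ in atTop, (n : ℝ) ^ (2 / 3 : ℝ) ≤ n * hr n := by
  filter_upwards [h.nhr3.eventually_ge_atTop 1] with n hn
  have h0 := h.hr_pos n
  have h1 : ((n : ℝ) ^ (2 / 3 : ℝ)) ^ (3 : ℕ) ≤ (n * hr n) ^ 3 := by
    rw [← Real.rpow_natCast, ← Real.rpow_mul (by positivity)]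
    norm_num
    have : (n : ℝ) ^ 2 * 1 ≤ n ^ 2 * (n * hr n ^ 3) := by gcongr
    nlinarith
  exact le_of_pow_le_pow_left₀ (by norm_num) (by positivity) h1

lemma BandwidthCond.tendsto_mul (h : BandwidthCond hr hd N) :
    Tendsto (fun n : ℕ => (n : ℝ) * hr n) atTop atTop :=
  tendsto_atTop_mono' _ h.rpow_le_mul
    ((tendsto_rpow_atTop (by norm_num)).comp tendsto_natCast_atTop_atTop)

end Bandwidths

section Consistency

variable {Ω : Type*} [MeasurableSpace Ω] {P : Measure Ω}

/-- Consistency of the estimators `g n k` of the increasing curves `m n k` at the interior points,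
in probability and uniformly over the points. The error is measured relative to the slope, so that
it amounts to a small horizontal shift of the curve, and the probability is so small that the
union over the `p n` curves is negligible. -/
def RelConsistent (P : Measure Ω) (p : ℕ → ℕ) (m : ∀ n, Fin (p n) → ℝ → ℝ)
    (g : ∀ n, Fin (p n) → Ω → ℝ → ℝ) : Prop :=
  ∀ κ > (0 : ℝ), ∀ τ ∈ Ioo (0 : ℝ) (1 / 2), ∀ e > (0 : ℝ), ∀ᶠ n in atTop, ∀ k,
    ∀ t ∈ Icc τ (1 - τ),
      (p n : ℝ≥0∞) * P {ω | κ * derivWithin (m n k) (Icc 0 1) t ≤ |g n k ω t - m n k t|}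
        ≤ ENNReal.ofReal e

lemma RelConsistent.jackknife {p : ℕ → ℕ} {m : ∀ n, Fin (p n) → ℝ → ℝ}
    {g g' : ∀ n, Fin (p n) → Ω → ℝ → ℝ} (hg : RelConsistent P p m g)
    (hg' : RelConsistent P p m g') :
    RelConsistent P p m fun n k ω t => 2 * g' n k ω t - g n k ω t := by
  intro κ hκ τ hτ e he
  filter_upwards [hg (κ / 3) (by positivity) τ hτ (e / 2) (by positivity),
    hg' (κ / 3) (by positivity) τ hτ (e / 2) (by positivity)] with n h1 h2 k t ht
  have hsub : {ω | κ * derivWithin (m n k) (Icc 0 1) t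
        ≤ |2 * g' n k ω t - g n k ω t - m n k t|} ⊆
      {ω | κ / 3 * derivWithin (m n k) (Icc 0 1) t ≤ |g n k ω t - m n k t|} ∪
      {ω | κ / 3 * derivWithin (m n k) (Icc 0 1) t ≤ |g' n k ω t - m n k t|} := by
    intro ω hω
    by_contra hcon
    simp only [mem_union, mem_ofPred_eq, not_or, not_le] at hcon hω
    have e1 : 2 * g' n k ω t - g n k ω t - m n k t
        = 2 * (g' n k ω t - m n k t) - (g n k ω t - m n k t) := by ring
    rw [e1] at hω
    have e2 := abs_sub (2 * (g' n k ω t - m n k t)) (g n k ω t - m n k t)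
    rw [abs_mul, abs_two] at e2
    linarith
  calc _ ≤ (p n : ℝ≥0∞) * (_ + _) := by
        gcongr
        exact (measure_mono hsub).trans (measure_union_le _ _)
    _ ≤ ENNReal.ofReal (e / 2) + ENNReal.ofReal (e / 2) := by
        rw [mul_add]
        exact add_le_add (h1 k t ht) (h2 k t ht)
    _ = ENNReal.ofReal e := by
        rw [← ENNReal.ofReal_add (by positivity) (by positivity), add_halves]

/-- Markov's inequality for the number of events that occur; no measurability is needed. -/
lemma measure_le_card_le {ι : Type*} (I : Finset ι) (E : ι → Set Ω) {x : ℝ} (hx : 0 < x) :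
    P {ω | ∃ J ⊆ I, (∀ i ∈ J, ω ∈ E i) ∧ x ≤ J.card} ≤ (∑ i ∈ I, P (E i)) / ENNReal.ofReal x := by
  classical
  have hm : ∀ i ∈ I, AEMeasurable ((toMeasurable P (E i)).indicator fun _ => (1 : ℝ≥0∞)) P :=
    fun i _ => (measurable_const.indicator (measurableSet_toMeasurable _ _)).aemeasurable
  have h := meas_ge_le_lintegral_div (μ := P) (f := fun ω => ∑ i ∈ I,
    (toMeasurable P (E i)).indicator (fun _ => (1 : ℝ≥0∞)) ω)
    (Finset.aemeasurable_fun_sum _ hm) (ε := ENNReal.ofReal x) (by simpa using hx)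
    ENNReal.ofReal_ne_top
  rw [lintegral_finsetSum' _ hm] at h
  simp only [lintegral_indicator_const (measurableSet_toMeasurable _ _), measure_toMeasurable,
    one_mul] at h
  refine le_trans (measure_mono ?_) h
  rintro ω ⟨J, hJ, hJE, hx⟩
  rw [mem_ofPred_eq]
  calc ENNReal.ofReal x ≤ ENNReal.ofReal J.card := ENNReal.ofReal_le_ofReal hx
    _ = ∑ i ∈ J, (1 : ℝ≥0∞) := by simp
    _ ≤ ∑ i ∈ J, (toMeasurable P (E i)).indicator (fun _ => (1 : ℝ≥0∞)) ω := by
        refine Finset.sum_le_sum fun i hi => ?_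
        rw [indicator_of_mem (subset_toMeasurable _ _ (hJE i hi))]
    _ ≤ _ := Finset.sum_le_sum_of_subset hJ

/-- Few grid points are close to the boundary. -/
lemma card_boundary_le {N : ℕ} (hN : 0 < N) {τ : ℝ} (hτ : 0 < τ) (hτ1 : τ < 1) :
    (({i ∈ Finset.Icc 1 N | (i : ℝ) / N ∉ Icc τ (1 - τ)} : Finset ℕ).card : ℝ)
      ≤ 2 * τ * N + 1 := by
  have hN0 : (0 : ℝ) < N := by exact_mod_cast hN
  have hsub : ({i ∈ Finset.Icc 1 N | (i : ℝ) / N ∉ Icc τ (1 - τ)} : Finset ℕ) ⊆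
      Finset.Icc 1 ⌊τ * N⌋₊ ∪ Finset.Icc ⌈(1 - τ) * N⌉₊ N := by
    intro i hi
    obtain ⟨hiN, hi⟩ := Finset.mem_filter.1 hi
    rw [Finset.mem_Icc] at hiN
    rw [mem_Icc, not_and_or, not_le, not_le, div_lt_iff₀ hN0, lt_div_iff₀ hN0] at hi
    rcases hi with hi | hi
    · exact Finset.mem_union_left _ (Finset.mem_Icc.2 ⟨hiN.1, Nat.le_floor hi.le⟩)
    · exact Finset.mem_union_right _ (Finset.mem_Icc.2 ⟨Nat.ceil_le.2 hi.le, hiN.2⟩)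
  have h1 := (Finset.card_le_card hsub).trans (Finset.card_union_le _ _)
  rw [Nat.card_Icc, Nat.card_Icc, Nat.add_sub_cancel] at h1
  have h2 : ⌈(1 - τ) * N⌉₊ ≤ N + 1 := by
    rw [Nat.ceil_le]
    push_cast
    nlinarith
  have h3 : (1 - τ) * N ≤ ⌈(1 - τ) * N⌉₊ := Nat.le_ceil _
  have h4 : (⌊τ * N⌋₊ : ℝ) ≤ τ * N := Nat.floor_le (by positivity)
  have h5 : (({i ∈ Finset.Icc 1 N | (i : ℝ) / N ∉ Icc τ (1 - τ)} : Finset ℕ).card : ℝ)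
      ≤ (⌊τ * N⌋₊ : ℝ) + ((N + 1 - ⌈(1 - τ) * N⌉₊ : ℕ) : ℝ) := by exact_mod_cast h1
  rw [Nat.cast_sub h2] at h5
  push_cast at h5
  linarith

/-- Consistent estimators of uniformly increasing curves have index sets that fill the unit
interval. With high probability, for all curves at once, the estimates are good outside a small
fraction of the grid; then `Icc_subset_image_rearrangedInv` applies to every curve. -/
theorem RelConsistent.tendstoInMeasure {K : ℝ → ℝ} (hK : IsKernel K) {hr hd : ℕ → ℝ} {N : ℕ → ℕ}
    (hband : BandwidthCond hr hd N) {p : ℕ → ℕ} (hp : ∀ n, 0 < p n) {hdk : ∀ n, Fin (p n) → ℝ}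
    (hdk_cmp : UniformlyComparable hdk hd) {m : ∀ n, Fin (p n) → ℝ → ℝ}
    (hsm : SmoothFamily fun i : Σ n, Fin (p n) => m i.1 i.2)
    (hinc : UniformlyIncreasing fun i : Σ n, Fin (p n) => m i.1 i.2)
    {g g₀ : ∀ n, Fin (p n) → Ω → ℝ → ℝ} (hg : RelConsistent P p m g)
    (hg₀ : RelConsistent P p m g₀) :
    TendstoInMeasure P (fun n ω => volume.real (⋂ k : Fin (p n),
      indexSet (N n) K (hd n) (hdk n k) (g n k ω) (g₀ n k ω))) atTop (fun _ => 1) := by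
  classical
  rw [tendstoInMeasure_iff_dist]
  intro ρ hρ
  rw [ENNReal.tendsto_nhds_zero]
  intro δ hδ
  obtain ⟨L, hL⟩ := hsm
  obtain ⟨M, hM, hM'⟩ := hinc
  set e := min ρ 1 / 8 with he
  have he0 : 0 < e := by positivity
  have heρ : 2 * e < ρ := by
    have := min_le_left ρ 1
    rw [he]; linarith
  have he8 : e ≤ 1 / 8 := by
    have := min_le_right ρ 1
    rw [he]; linarith
  set τ := e / 32 with hτ
  obtain ⟨C, hC, hcurve⟩ := exists_abs_sub_linear_le L.coe_nonneg hM (show 0 < τ by positivity)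
  set κ := min τ (1 / (4 * C)) with hκ
  have hκ0 : 0 < κ := by positivity
  have hκτ : κ ≤ τ := min_le_left _ _
  have hκC : κ * C ≤ 1 / 4 := by
    have h1 := mul_le_mul_of_nonneg_right (min_le_right τ (1 / (4 * C))) hC.le
    refine h1.trans (le_of_eq ?_)
    field_simp
  obtain ⟨δ', hδ'0, hδ'⟩ : ∃ δ' : ℝ, 0 < δ' ∧ ENNReal.ofReal δ' ≤ δ := by
    obtain ⟨r, hr0, hr1⟩ := ENNReal.lt_iff_exists_nnreal_btwn.1 hδ
    exact ⟨r, by exact_mod_cast hr0, by simpa using hr1.le⟩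
  set β := e / 16 with hβ
  set e' := δ' * β / 2 with he'
  have hτ2 : τ ∈ Ioo (0 : ℝ) (1 / 2) := ⟨by positivity, by rw [hτ]; linarith⟩
  obtain ⟨hdkpos, c, hc, C', hdkC⟩ := hdk_cmp
  have hdk0 : ∀ᶠ n in atTop, ∀ k, hdk n k / M ≤ e / 8 := by
    have h1 : Tendsto (fun n => C' * hd n / M) atTop (𝓝 0) := by
      simpa using (hband.tendsto_hd.const_mul C').div_const M
    filter_upwards [hdkC, (tendsto_order.1 h1).2 (e / 8) (by positivity)] with n h2 h3 k
    exact (div_le_div_of_nonneg_right (h2 k).2 hM.le).trans h3.le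
  filter_upwards [hg (κ / 2) (by positivity) τ hτ2 e' (by positivity),
    hg₀ (κ / 2) (by positivity) τ hτ2 e' (by positivity), hdk0,
    (tendsto_order.1 hband.tendsto_hd_log).2 e he0,
    (tendsto_order.1 hband.tendsto_hd).2 1 one_pos,
    hband.tendsto_N.eventually_ge_atTop (max 1 (24 / e))] with n hgn hg₀n hdkn hlog hd1 hNn
  have hN1 : (1 : ℝ) ≤ N n := (le_max_left _ _).trans hNn
  have hNpos : 0 < N n := by
    have : (0 : ℝ) < N n := by linarith
    exact_mod_cast this
  have hN0 : (0 : ℝ) < N n := by linarith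
  have hNe : 3 / (N n : ℝ) ≤ e / 8 := by
    have h1 := (le_max_right _ _).trans hNn
    rw [div_le_iff₀ he0] at h1
    rw [div_le_iff₀ hN0]
    linarith
  have hlog0 : 0 ≤ hd n * Real.log (hd n)⁻¹ :=
    mul_nonneg (hband.hd_pos n).le (Real.log_nonneg ((one_le_inv₀ (hband.hd_pos n)).2 hd1.le))
  -- the events that the estimates of the curve `k` are bad at the grid point `i / N`
  set E : Fin (p n) → ℕ → Set Ω := fun k i =>
    {ω | κ / 2 * derivWithin (m n k) (Icc 0 1) ((i : ℝ) / N n)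
        ≤ |g n k ω ((i : ℝ) / N n) - m n k ((i : ℝ) / N n)|} ∪
    {ω | κ / 2 * derivWithin (m n k) (Icc 0 1) ((i : ℝ) / N n)
        ≤ |g₀ n k ω ((i : ℝ) / N n) - m n k ((i : ℝ) / N n)|} with hE
  set I : Finset ℕ := {i ∈ Finset.Icc 1 (N n) | (i : ℝ) / N n ∈ Icc τ (1 - τ)} with hI
  have hp0 : (p n : ℝ≥0∞) ≠ 0 := by exact_mod_cast (hp n).ne'
  have hPE : ∀ k, ∀ i ∈ I, P (E k i) ≤ ENNReal.ofReal (2 * e') / p n := by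
    intro k i hi
    have hit := (Finset.mem_filter.1 hi).2
    rw [ENNReal.le_div_iff_mul_le (Or.inl hp0) (Or.inl (ENNReal.natCast_ne_top _)), mul_comm]
    calc _ ≤ (p n : ℝ≥0∞) * (_ + _) := by
          gcongr
          exact measure_union_le _ _
      _ ≤ ENNReal.ofReal e' + ENNReal.ofReal e' := by
          rw [mul_add]
          exact add_le_add (hgn k _ hit) (hg₀n k _ hit)
      _ = ENNReal.ofReal (2 * e') := by
          rw [← ENNReal.ofReal_add (by positivity) (by positivity)]
          ring_nf
  have hsub : {ω | ρ ≤ dist (volume.real (⋂ k : Fin (p n),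
      indexSet (N n) K (hd n) (hdk n k) (g n k ω) (g₀ n k ω))) 1} ⊆
      ⋃ k, {ω | ∃ J ⊆ I, (∀ i ∈ J, ω ∈ E k i) ∧ β * N n ≤ J.card} := by
    intro ω hω
    by_contra hcon
    simp only [mem_iUnion, mem_ofPred_eq, not_exists, not_and, not_le] at hcon
    have himg : ∀ k, Icc e (1 - e) ⊆
        rearrangedInv (N n) K (hdk n k) (g n k ω) '' gridRange (N n) (g₀ n k ω) := by
      intro k
      set Bad : Finset ℕ := ({i ∈ Finset.Icc 1 (N n) | (i : ℝ) / N n ∉ Icc τ (1 - τ)} : Finset ℕ) ∪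
        {i ∈ I | ω ∈ E k i} with hBad
      have hcard : (Bad.card : ℝ) ≤ (2 * τ + 1 / N n + β) * N n := by
        have h1 := card_boundary_le hNpos hτ2.1 (by linarith [hτ2.2] : τ < 1)
        have h2 := (hcon k {i ∈ I | ω ∈ E k i} (Finset.filter_subset _ _)
          fun i hi => (Finset.mem_filter.1 hi).2).le
        have h3 : (Bad.card : ℝ)
            ≤ (({i ∈ Finset.Icc 1 (N n) | (i : ℝ) / N n ∉ Icc τ (1 - τ)} : Finset ℕ).card : ℝ)
              + (({i ∈ I | ω ∈ E k i} : Finset ℕ).card : ℝ) := by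
          exact_mod_cast Finset.card_union_le _ _
        have h4 : (1 / (N n : ℝ)) * N n = 1 := one_div_mul_cancel hN0.ne'
        rw [add_mul, add_mul, h4]
        linarith
      obtain ⟨hdf, hdf', hlip⟩ := hL ⟨n, k⟩
      have hMk := hM' ⟨n, k⟩
      dsimp only at hdf hdf' hlip hMk
      refine Icc_subset_image_rearrangedInv hK hNpos (hdkpos n k) hM hκ0.le
        (f := m n k) (fun u hu v hv huv => mul_sub_le_of_le_derivWithin hdf hMk hu hv huv)
        hcard (fun i hi hib => ?_) (e := e) ?_ (by linarith)
      · rw [hBad, Finset.mem_union, not_or] at hib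
        have hit : (i : ℝ) / N n ∈ Icc τ (1 - τ) := by
          by_contra hit
          exact hib.1 (Finset.mem_filter.2 ⟨hi, hit⟩)
        have hiE : ω ∉ E k i := fun h =>
          hib.2 (Finset.mem_filter.2 ⟨Finset.mem_filter.2 ⟨hi, hit⟩, h⟩)
        simp only [hE, mem_union, mem_ofPred_eq, not_or, not_le] at hiE
        set t := (i : ℝ) / N n
        have htI : t ∈ Icc (0 : ℝ) 1 := ⟨by linarith [hit.1, hτ2.1], by linarith [hit.2, hτ2.1]⟩
        have hquad := hcurve (m n k) hdf hdf'
          (fun x hx y hy => by simpa [Real.dist_eq] using hlip.dist_le_mul x hx y hy) hMk t hit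
        set s := derivWithin (m n k) (Icc 0 1) t
        have hs : 0 < s := hM.trans_le (hMk t htI)
        have h1 := hquad (t + κ) ⟨by linarith [htI.1], by linarith [hit.2]⟩
        have h2 := hquad (t - κ) ⟨by linarith [hit.1], by linarith [htI.2]⟩
        rw [show t + κ - t = κ by ring, abs_le] at h1
        rw [show t - κ - t = -κ by ring, abs_le] at h2
        have h3 : C * s * κ ^ 2 ≤ κ / 4 * s := by
          have := mul_le_mul_of_nonneg_right hκC (mul_pos hκ0 hs).le
          linarith [this, (by ring : C * s * κ ^ 2 = κ * C * (κ * s))]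
        have h4 := abs_lt.1 hiE.1
        have h5 := abs_lt.1 hiE.2
        have h6 : 0 < κ * s := mul_pos hκ0 hs
        have h7 : C * s * (-κ) ^ 2 = C * s * κ ^ 2 := by ring
        rw [h7] at h2
        refine ⟨⟨by linarith [hit.1], by linarith [hit.2]⟩, ⟨?_, ?_⟩, ⟨?_, ?_⟩⟩ <;> linarith
      · have h1 := hdkn k
        have h2 : 3 / (N n : ℝ) = 3 * (1 / N n) := by ring
        rw [h2] at hNe
        linarith
    have hlow : Icc e (1 - e) ⊆ ⋂ k : Fin (p n),
        indexSet (N n) K (hd n) (hdk n k) (g n k ω) (g₀ n k ω) := by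
      refine subset_iInter fun k => subset_inter (himg k) ?_
      exact Icc_subset_Icc hlog.le (by linarith)
    have hupp : (⋂ k : Fin (p n), indexSet (N n) K (hd n) (hdk n k) (g n k ω) (g₀ n k ω)) ⊆
        Icc 0 1 := by
      refine (iInter_subset _ ⟨0, hp n⟩).trans (inter_subset_right.trans ?_)
      exact Icc_subset_Icc hlog0 (by linarith)
    have h1 := measureReal_mono (μ := (volume : Measure ℝ)) hupp (by simp)
    have h2 := measureReal_mono (μ := (volume : Measure ℝ)) hlow
      (((measure_mono hupp).trans_lt (by simp)).ne)
    rw [Real.volume_real_Icc_of_le (by norm_num)] at h1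
    rw [Real.volume_real_Icc_of_le (by linarith)] at h2
    have h3 : dist (volume.real (⋂ k : Fin (p n),
        indexSet (N n) K (hd n) (hdk n k) (g n k ω) (g₀ n k ω))) 1 < ρ := by
      rw [Real.dist_eq, abs_lt]
      constructor <;> linarith
    exact absurd hω (not_le.2 h3)
  refine ((measure_mono hsub).trans (measure_iUnion_fintype_le _ _)).trans (le_trans ?_ hδ')
  have hbound : ∀ k, P {ω | ∃ J ⊆ I, (∀ i ∈ J, ω ∈ E k i) ∧ β * N n ≤ J.card}
      ≤ ENNReal.ofReal δ' / p n := by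
    intro k
    refine (measure_le_card_le I (E k) (by positivity)).trans ?_
    have h1 : ∑ i ∈ I, P (E k i) ≤ ENNReal.ofReal (N n * (2 * e')) / p n := by
      refine (Finset.sum_le_sum (hPE k)).trans ?_
      rw [Finset.sum_const, nsmul_eq_mul, ENNReal.ofReal_mul hN0.le, mul_div_assoc,
        ENNReal.ofReal_natCast]
      gcongr
      exact (Finset.card_filter_le _ _).trans (by simp)
    refine (ENNReal.div_le_div_right h1 _).trans (le_of_eq ?_)
    rw [ENNReal.div_right_comm, ← ENNReal.ofReal_div_of_pos (by positivity)]
    congr 2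
    have hβ0 : β ≠ 0 := by positivity
    rw [he']
    field_simp
  refine (Finset.sum_le_sum fun k _ => hbound k).trans (le_of_eq ?_)
  rw [Finset.sum_const, Finset.card_univ, Fintype.card_fin, nsmul_eq_mul,
    ENNReal.mul_div_cancel hp0 (ENNReal.natCast_ne_top _)]

end Consistency

/-! ### Kernel-weighted sums of weakly dependent processes -/

section WeakDependence

variable {Ω S : Type*} [MeasurableSpace Ω] [MeasurableSpace S]
  {P : Measure Ω} {ε : ℤ → Ω → S}

lemma measurable_coupledPast (hε : IsInnovation P ε) (i k : ℤ) :
    Measurable (coupledPast ε i k) := by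
  refine measurable_pi_lambda _ fun j => ?_
  by_cases h : i - (j : ℤ) = k
  · simpa [coupledPast, h, Function.comp_def] using (hε.meas k).comp measurable_snd
  · simpa [coupledPast, h, Function.comp_def] using (hε.meas (i - j)).comp measurable_fst

/-- The physical dependence measure dominates the `L¹` distance of coupled coordinates. -/
lemma lintegral_coord_le_physDep (hε : IsInnovation P ε) {d : ℕ} {q : ℝ≥0∞} (hq : 1 ≤ q)
    {F : ℝ → (ℕ → S) → EuclideanSpace ℝ (Fin d)} {u : ℝ} (hu : u ∈ Icc (0 : ℝ) 1)
    (hF : Measurable (F u)) (k : ℕ) (a : Fin d) :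
    ∫⁻ z : Ω × Ω, ‖F u (past ε 0 z.1) a - F u (coupledPast ε 0 (-(k : ℤ)) z) a‖ₑ ∂(P.prod P)
      ≤ physDep P ε q F k := by
  have := hε.indep.isProbabilityMeasure
  have hm : Measurable fun z : Ω × Ω =>
      F u (past ε 0 z.1) - F u (coupledPast ε 0 (-(k : ℤ)) z) :=
    (hF.comp ((measurable_past hε 0).comp measurable_fst)).sub
      (hF.comp (measurable_coupledPast hε _ _))
  calc _ ≤ ∫⁻ z : Ω × Ω, ‖F u (past ε 0 z.1) - F u (coupledPast ε 0 (-(k : ℤ)) z)‖ₑ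
        ∂(P.prod P) := by
        refine lintegral_mono fun z => ?_
        rw [enorm_le_iff_norm_le]
        exact PiLp.norm_apply_le (F u (past ε 0 z.1) - F u (coupledPast ε 0 (-(k : ℤ)) z)) a
    _ = eLpNorm (fun z : Ω × Ω => F u (past ε 0 z.1) - F u (coupledPast ε 0 (-(k : ℤ)) z)) 1
        (P.prod P) := eLpNorm_one_eq_lintegral_enorm.symm
    _ ≤ eLpNorm (fun z : Ω × Ω => F u (past ε 0 z.1) - F u (coupledPast ε 0 (-(k : ℤ)) z)) q
        (P.prod P) := eLpNorm_le_eLpNorm_of_exponent_le hq hm.aestronglyMeasurable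
    _ ≤ physDep P ε q F k := le_iSup₂_of_le u hu le_rfl

/-- Geometrically decaying dependence gives bounded finite approximations with a geometric error,
apart from the truncation error `κ`. -/
lemma IsInnovation.exists_bounded_finite_approx (hε : IsInnovation P ε) {F : (ℕ → S) → ℝ}
    (hF : Measurable F) (hi : Integrable (fun ω => F (past ε 0 ω)) P) {D χ κ B : ℝ} (hD : 0 ≤ D)
    (hχ : χ ∈ Ioo (0 : ℝ) 1) (hκ : 0 ≤ κ) (hB : 0 ≤ B)
    (hdep : ∀ k : ℕ, ∫⁻ z : Ω × Ω, ‖F (past ε 0 z.1) - F (coupledPast ε 0 (-(k : ℤ)) z)‖ₑ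
      ∂(P.prod P) ≤ ENNReal.ofReal (D * χ ^ k))
    (htrunc : ∫⁻ ω, ENNReal.ofReal (|F (past ε 0 ω)| - B) ∂P ≤ ENNReal.ofReal κ) (m : ℕ) :
    ∃ φ : (Fin (m + 1) → S) → ℝ, Measurable φ ∧ (∀ v, |φ v| ≤ B) ∧
      ∫⁻ ω, ‖F (past ε 0 ω) - φ (fun j => past ε 0 ω j)‖ₑ ∂P
        ≤ ENNReal.ofReal ((D / (1 - χ) + 1) * χ ^ (m + 1) + κ) := by
  have h1χ : 0 < 1 - χ := by linarith [hχ.2]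
  have hχ0 := hχ.1
  obtain ⟨φ, hφ, h1⟩ := hε.exists_finite_approx hF hi hdep m
    (η := ENNReal.ofReal (χ ^ (m + 1))) (by simpa using pow_pos hχ0 _)
  obtain ⟨ψ, hψ, hψB, h2⟩ := exists_bounded_approx hε hF hφ hB h1 htrunc
  refine ⟨ψ, hψ, hψB, h2.trans (le_of_eq ?_)⟩
  have hs : ∀ k : ℕ, D * χ ^ (k + (m + 1)) = D * χ ^ (m + 1) * χ ^ k := fun k => by ring
  have hsum : Summable fun k : ℕ => D * χ ^ (m + 1) * χ ^ k :=
    (summable_geometric_of_lt_one hχ0.le hχ.2).mul_left _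
  have hts : ∑' k : ℕ, D * χ ^ (m + 1) * χ ^ k = D * χ ^ (m + 1) / (1 - χ) := by
    rw [tsum_mul_left, tsum_geometric_of_lt_one hχ0.le hχ.2, div_eq_mul_inv]
  simp_rw [hs]
  rw [← ENNReal.ofReal_tsum_of_nonneg (fun k => by positivity) hsum, hts,
    ← ENNReal.ofReal_add (by positivity) (by positivity),
    ← ENNReal.ofReal_add (by positivity) hκ]
  congr 1
  ring

/-- The deviation bound for the sum over the active set of a window with `n h ≥ 1`. -/
lemma IsInnovation.measure_activeSet_sum_ge_le (hε : IsInnovation P ε)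
    {F : ℕ → (ℕ → S) → ℝ} {n : ℕ} {h t : ℝ} (hh : 0 < h) (ht : h ≤ t) (hn : 1 ≤ n * h)
    (hF : ∀ i ∈ activeSet n h t, Measurable (F i))
    (hi : ∀ i ∈ activeSet n h t, Integrable (fun ω => F i (past ε 0 ω)) P)
    {m : ℕ} {A B η : ℝ} (hA : 0 < A) (hB : 0 < B) (hη : 0 ≤ η)
    (happ : ∀ i ∈ activeSet n h t, ∃ φ : (Fin (m + 1) → S) → ℝ, Measurable φ ∧
      (∀ v, |φ v| ≤ B) ∧
      ∫⁻ ω, ‖F i (past ε 0 ω) - φ (fun j => past ε 0 ω j)‖ₑ ∂P ≤ ENNReal.ofReal η)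
    {a : ℕ → ℝ} (ha : ∀ i ∈ activeSet n h t, |a i| ≤ A) {δ : ℝ} (hδ : 0 < δ) :
    P {ω | δ * (n * h) ≤
      |∑ i ∈ activeSet n h t, a i * (F i (past ε i ω) - ∫ ω', F i (past ε i ω') ∂P)|}
      ≤ ENNReal.ofReal (9 * A * η / δ + 2 * (m + 1) *
        Real.exp (-(δ ^ 2 * (n * h) / (54 * (A ^ 2 * ((m + 1) ^ 2 * B ^ 2)))))) := by
  have hnh : 0 < n * h := by linarith
  refine (hε.measure_weighted_sum_ge_le hF hi hA.le hB.le hη happ ha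
    (card_activeSet_le hh ht hn) (x := δ * (n * h)) (by positivity)).trans (le_of_eq ?_)
  congr 1
  unfold deviationBound
  have hn0 : (n : ℝ) ≠ 0 := by
    rintro h0
    rw [h0] at hnh
    simp at hnh
  have e1 : 3 * A * (3 * (n * h)) * η / (δ * (n * h)) = 9 * A * η / δ := by
    field_simp
    ring
  have e2 : -(δ * (n * h) / 3 / (m + 1)) ^ 2 / (2 * (3 * (n * h) * (A * B) ^ 2))
      = -(δ ^ 2 * (n * h) / (54 * (A ^ 2 * ((m + 1) ^ 2 * B ^ 2)))) := by
    have : (m : ℝ) + 1 ≠ 0 := by positivity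
    field_simp
    ring
  rw [e1, e2]

/-- The weights of the local linear normal equations are bounded. -/
lemma abs_kernel_mul_pow_le {K : ℝ → ℝ} (hK : IsKernel K) {κ : ℝ} (hκ : ∀ x, K x ≤ κ) {n : ℕ}
    {h t : ℝ} {i : ℕ} (hi : i ∈ activeSet n h t) (l : ℕ) :
    |K (designPt n h t i) * designPt n h t i ^ l| ≤ κ := by
  have h1 : |designPt n h t i ^ l| ≤ 1 := by
    rw [abs_pow]
    exact pow_le_one₀ (abs_nonneg _) (Finset.mem_filter.1 hi).2
  rw [abs_mul, abs_of_nonneg (hK.nonneg _)]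
  have h2 := hK.nonneg (designPt n h t i)
  calc _ ≤ K (designPt n h t i) * 1 := mul_le_mul_of_nonneg_left h1 h2
    _ ≤ κ := by rw [mul_one]; exact hκ _

lemma abs_sum_kernel_le {K : ℝ → ℝ} (hK : IsKernel K) {κ : ℝ} (hκ : ∀ x, K x ≤ κ) {n : ℕ}
    {h t : ℝ} (hh : 0 < h) (ht : h ≤ t) (hn : 1 ≤ n * h) (l : ℕ) {g : ℕ → ℝ} {V : ℝ}
    (hV : 0 ≤ V) (hg : ∀ i ∈ activeSet n h t, |g i| ≤ V) :
    |∑ i ∈ activeSet n h t, K (designPt n h t i) * designPt n h t i ^ l * g i|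
      ≤ 3 * (n * h) * (κ * V) := by
  have hκ0 : 0 ≤ κ := (hK.nonneg 0).trans (hκ 0)
  calc _ ≤ ∑ i ∈ activeSet n h t, κ * V := by
        refine (Finset.abs_sum_le_sum_abs _ _).trans (Finset.sum_le_sum fun i hi => ?_)
        rw [abs_mul]
        exact mul_le_mul (abs_kernel_mul_pow_le hK hκ hi l) (hg i hi) (abs_nonneg _) hκ0
    _ ≤ _ := by
        rw [Finset.sum_const, nsmul_eq_mul]
        exact mul_le_mul_of_nonneg_right (card_activeSet_le hh ht hn) (by positivity)

lemma div_mem_Icc_of_mem_activeSet {n : ℕ} {h t : ℝ} {i : ℕ} (hi : i ∈ activeSet n h t) :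
    (i : ℝ) / n ∈ Icc (0 : ℝ) 1 := by
  have h1 := Finset.mem_Icc.1 (Finset.mem_filter.1 hi).1
  have hn : (0 : ℝ) < n := by exact_mod_cast (by omega : 0 < n)
  exact ⟨by positivity, by rw [div_le_one hn]; exact_mod_cast h1.2⟩

lemma abs_sub_le_of_mem_activeSet {n : ℕ} {h t : ℝ} (hh : 0 < h) {i : ℕ}
    (hi : i ∈ activeSet n h t) : |(i : ℝ) / n - t| ≤ h := by
  have h1 := (Finset.mem_filter.1 hi).2
  rwa [designPt, abs_div, abs_of_pos hh, div_le_one hh] at h1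

end WeakDependence

/-! ### Local linear fits of smooth curves -/

section LocalFit

/-- If the kernel-weighted residuals of a line satisfy the normal equations, its coefficients are
of the order of the data. -/
lemma abs_le_of_normal_equations {K : ℝ → ℝ} (hK : IsKernel K) {κ : ℝ} (hκ : ∀ x, K x ≤ κ)
    {n : ℕ} {h t c V : ℝ} (hh : 0 < h) (ht : h ≤ t) (hn : 1 ≤ n * h) (hc : 0 < c) (hV : 0 ≤ V)
    (hdes : ∀ a b : ℝ, c * (n * h) * (a ^ 2 + b ^ 2)
      ≤ ∑ i ∈ Finset.Icc 1 n, K (designPt n h t i) * (a + b * designPt n h t i) ^ 2)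
    {g : ℕ → ℝ} (hg : ∀ i ∈ activeSet n h t, |g i| ≤ V) {a₀ a₁ : ℝ}
    (h₀ : ∑ i ∈ Finset.Icc 1 n, K (designPt n h t i) * (g i - (a₀ + a₁ * designPt n h t i)) = 0)
    (h₁ : ∑ i ∈ Finset.Icc 1 n, K (designPt n h t i) *
      (designPt n h t i * (g i - (a₀ + a₁ * designPt n h t i))) = 0) :
    |a₀| ≤ 6 * κ * V / c ∧ |a₁| ≤ 6 * κ * V / c := by
  have hnh : 0 < n * h := by linarith
  set W : ℕ → ℝ := fun l =>
    ∑ i ∈ activeSet n h t, K (designPt n h t i) * designPt n h t i ^ l * g i with hW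
  have hWV : ∀ l, |W l| ≤ 3 * (n * h) * (κ * V) := fun l =>
    abs_sum_kernel_le hK hκ hh ht hn l hV hg
  have hexp : ∑ i ∈ Finset.Icc 1 n, K (designPt n h t i) * (a₀ + a₁ * designPt n h t i) ^ 2
      = a₀ * W 0 + a₁ * W 1 := by
    have e : ∀ l, W l
        = ∑ i ∈ Finset.Icc 1 n, K (designPt n h t i) * (designPt n h t i ^ l * g i) := by
      intro l
      rw [sum_kernel_eq_sum_activeSet hK]
      exact Finset.sum_congr rfl fun i _ => by ring
    rw [← sub_eq_zero]
    have h2 : a₀ * ∑ i ∈ Finset.Icc 1 n,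
          K (designPt n h t i) * (g i - (a₀ + a₁ * designPt n h t i))
        + a₁ * ∑ i ∈ Finset.Icc 1 n, K (designPt n h t i) *
          (designPt n h t i * (g i - (a₀ + a₁ * designPt n h t i))) = 0 := by
      rw [h₀, h₁]; ring
    rw [← neg_eq_zero, ← h2, e, e]
    simp only [Finset.mul_sum, ← Finset.sum_add_distrib, ← Finset.sum_sub_distrib,
      ← Finset.sum_neg_distrib]
    exact Finset.sum_congr rfl fun i _ => by ring
  have hmain := hdes a₀ a₁
  rw [hexp] at hmain
  have h3 : a₀ * W 0 + a₁ * W 1 ≤ (|a₀| + |a₁|) * (3 * (n * h) * (κ * V)) := by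
    have e0 := le_abs_self (a₀ * W 0)
    have e1 := le_abs_self (a₁ * W 1)
    rw [abs_mul] at e0 e1
    nlinarith [mul_le_mul_of_nonneg_left (hWV 0) (abs_nonneg a₀),
      mul_le_mul_of_nonneg_left (hWV 1) (abs_nonneg a₁)]
  have h4 : c * (a₀ ^ 2 + a₁ ^ 2) ≤ (|a₀| + |a₁|) * (3 * (κ * V)) := by
    refine le_of_mul_le_mul_left ?_ hnh
    linarith
  have hm : c * max |a₀| |a₁| ≤ 6 * κ * V := by
    set D := max |a₀| |a₁| with hD
    have hD0 : 0 ≤ D := le_max_of_le_left (abs_nonneg _)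
    have hκV : 0 ≤ κ * V := mul_nonneg ((hK.nonneg 0).trans (hκ 0)) hV
    have e1 : D ^ 2 ≤ a₀ ^ 2 + a₁ ^ 2 := by
      rcases max_cases |a₀| |a₁| with h5 | h5
      · rw [hD, h5.1, sq_abs]; nlinarith [sq_nonneg a₁]
      · rw [hD, h5.1, sq_abs]; nlinarith [sq_nonneg a₀]
    have e2 : |a₀| + |a₁| ≤ 2 * D := by
      have := le_max_left |a₀| |a₁|
      have := le_max_right |a₀| |a₁|
      linarith
    have e3 : c * D ^ 2 ≤ 2 * D * (3 * (κ * V)) :=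
      (mul_le_mul_of_nonneg_left e1 hc.le).trans
        (h4.trans (mul_le_mul_of_nonneg_right e2 (by positivity)))
    rcases hD0.eq_or_lt with h6 | h6
    · rw [← h6]; linarith
    · refine le_of_mul_le_mul_left ?_ h6
      linarith
  constructor
  · rw [le_div_iff₀ hc, mul_comm]
    exact (mul_le_mul_of_nonneg_left (le_max_left _ _) hc.le).trans hm
  · rw [le_div_iff₀ hc, mul_comm]
    exact (mul_le_mul_of_nonneg_left (le_max_right _ _) hc.le).trans hm

/-- The error of the local linear estimator of a curve with a quadratic linearization error: a
bias of the order `h ^ 2` and the two kernel-weighted sums of the noise. -/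
lemma abs_localLinear_sub_le_of_curve {K : ℝ → ℝ} (hK : IsKernel K) {κ : ℝ} (hκ : ∀ x, K x ≤ κ)
    {n : ℕ} {h t c V : ℝ} (hh : 0 < h) (ht : h ≤ t) (hn : 1 ≤ n * h) (hc : 0 < c) (hV : 0 ≤ V)
    (hdes : ∀ a b : ℝ, c * (n * h) * (a ^ 2 + b ^ 2)
      ≤ ∑ i ∈ Finset.Icc 1 n, K (designPt n h t i) * (a + b * designPt n h t i) ^ 2)
    {f : ℝ → ℝ} {s : ℝ}
    (hf : ∀ u ∈ Icc (0 : ℝ) 1, |f u - f t - s * (u - t)| ≤ V * (u - t) ^ 2)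
    {y X : ℕ → ℝ} (hy : ∀ i, y i = f ((i : ℝ) / n) + X i) :
    |localLinear n K h y t - f t| ≤ 12 * κ * (V * h ^ 2) / c + 2 / (c * (n * h)) *
      (|∑ i ∈ activeSet n h t, K (designPt n h t i) * designPt n h t i ^ 0 * X i|
        + |∑ i ∈ activeSet n h t, K (designPt n h t i) * designPt n h t i ^ 1 * X i|) := by
  have hnh : 0 < n * h := by linarith
  have hρ : ∀ i ∈ activeSet n h t,
      |f ((i : ℝ) / n) - f t - s * ((i : ℝ) / n - t)| ≤ V * h ^ 2 := by
    intro i hi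
    refine (hf _ (div_mem_Icc_of_mem_activeSet hi)).trans (mul_le_mul_of_nonneg_left ?_ hV)
    exact sq_le_sq' (abs_le.1 (abs_sub_le_of_mem_activeSet hh hi)).1
      (abs_le.1 (abs_sub_le_of_mem_activeSet hh hi)).2
  have hsum : ∀ l : ℕ, |∑ i ∈ Finset.Icc 1 n, K (designPt n h t i) *
      (designPt n h t i ^ l * (y i - f t - s * ((i : ℝ) / n - t)))|
      ≤ 3 * (n * h) * (κ * (V * h ^ 2))
        + |∑ i ∈ activeSet n h t, K (designPt n h t i) * designPt n h t i ^ l * X i| := by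
    intro l
    have e : ∑ i ∈ activeSet n h t, K (designPt n h t i) *
        (designPt n h t i ^ l * (y i - f t - s * ((i : ℝ) / n - t)))
        = (∑ i ∈ activeSet n h t, K (designPt n h t i) * designPt n h t i ^ l *
          (f ((i : ℝ) / n) - f t - s * ((i : ℝ) / n - t)))
        + ∑ i ∈ activeSet n h t, K (designPt n h t i) * designPt n h t i ^ l * X i := by
      rw [← Finset.sum_add_distrib]
      exact Finset.sum_congr rfl fun i _ => by rw [hy i]; ring
    rw [sum_kernel_eq_sum_activeSet hK, e]
    exact (abs_add_le _ _).trans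
      (add_le_add (abs_sum_kernel_le hK hκ hh ht hn l (by positivity) hρ) le_rfl)
  have h1 := abs_localLinear_sub_le hh (mul_pos hc hnh) hdes y (f t) s
  have h2 := hsum 0
  have h3 := hsum 1
  simp only [pow_zero, one_mul, pow_one, mul_one] at h2 h3 ⊢
  refine h1.trans ?_
  rw [div_le_iff₀ (by positivity)]
  have e1 : ∀ x : ℝ, (12 * κ * (V * h ^ 2) / c + 2 / (c * (n * h)) * x) * (c * (n * h))
      = 12 * κ * (V * h ^ 2) * (n * h) + 2 * x := by
    intro x
    have h0 : c * (n * h) ≠ 0 := by positivity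
    rw [add_mul, mul_right_comm (2 / _), div_mul_cancel₀ _ h0, ← mul_assoc,
      div_mul_cancel₀ _ hc.ne']
  rw [e1]
  linarith

end LocalFit

/-! ### Consistency in the high-dimensional trend model -/

section Windows

variable {hr hd : ℕ → ℝ} {N : ℕ → ℕ}

lemma UniformlyComparable.eventually_window (hband : BandwidthCond hr hd N) {p : ℕ → ℕ}
    {b : ∀ n, Fin (p n) → ℝ} (hb : UniformlyComparable b hr) {ρ : ℝ} (hρ : 0 < ρ) (Γ : ℝ) :
    ∀ᶠ n in atTop, ∀ k, b n k ≤ ρ ∧ Γ ≤ n * b n k := by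
  obtain ⟨hb0, c, hc, C, hcC⟩ := hb
  have h1 : Tendsto (fun n => C * hr n) atTop (𝓝 0) := by
    simpa using hband.tendsto_hr.const_mul C
  filter_upwards [hcC, (tendsto_order.1 h1).2 ρ hρ,
    (hband.tendsto_mul.const_mul_atTop hc).eventually_ge_atTop Γ] with n h2 h3 h4 k
  refine ⟨(h2 k).2.trans h3.le, h4.trans ?_⟩
  have := mul_le_mul_of_nonneg_left (h2 k).1 (Nat.cast_nonneg (α := ℝ) n)
  linarith

lemma UniformlyComparable.exists_rpow_le (hband : BandwidthCond hr hd N) {p : ℕ → ℕ}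
    {b : ∀ n, Fin (p n) → ℝ} (hb : UniformlyComparable b hr) :
    ∃ c > (0 : ℝ), ∀ᶠ n : ℕ in atTop, ∀ k, c * (n : ℝ) ^ (2 / 3 : ℝ) ≤ n * b n k := by
  obtain ⟨hb0, c, hc, C, hcC⟩ := hb
  refine ⟨c, hc, ?_⟩
  filter_upwards [hcC, hband.rpow_le_mul] with n h2 h3 k
  have h4 := mul_le_mul_of_nonneg_left (h2 k).1 (Nat.cast_nonneg (α := ℝ) n)
  have h5 := mul_le_mul_of_nonneg_left h3 hc.le
  linarith

lemma UniformlyComparable.div_const {p : ℕ → ℕ} {b : ∀ n, Fin (p n) → ℝ}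
    (hb : UniformlyComparable b hr) {r : ℝ} (hr0 : 0 < r) :
    UniformlyComparable (fun n k => b n k / r) hr := by
  obtain ⟨hb0, c, hc, C, hcC⟩ := hb
  refine ⟨fun n k => div_pos (hb0 n k) hr0, c / r, div_pos hc hr0, C / r, ?_⟩
  filter_upwards [hcC] with n hn k
  rw [div_mul_eq_mul_div, div_mul_eq_mul_div]
  exact ⟨div_le_div_of_nonneg_right (hn k).1 hr0.le, div_le_div_of_nonneg_right (hn k).2 hr0.le⟩

end Windows

section Trend

variable {Ω S : Type*} [MeasurableSpace Ω] [MeasurableSpace S]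
  {P : Measure Ω} {ε : ℤ → Ω → S}

lemma integrable_coord [IsFiniteMeasure P] {d : ℕ} {f : Ω → EuclideanSpace ℝ (Fin d)}
    (hf : Measurable f)
    {q : ℝ≥0∞} (hq : 1 ≤ q) (hfq : eLpNorm f q P ≠ ∞) (a : Fin d) :
    Integrable (fun ω => f ω a) P := by
  have h1 : MemLp f q P := ⟨hf.aestronglyMeasurable, hfq.lt_top⟩
  refine (h1.integrable hq).norm.mono' (by fun_prop) (ae_of_all _ fun ω => ?_)
  exact PiLp.norm_apply_le (f ω) a

/-- An exponential moment bounds the truncation error. -/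
lemma lintegral_trunc_le_of_exp_moment {X : Ω → ℝ} {τ C : ℝ} (hτ : 0 < τ)
    (h : ∫⁻ ω, ENNReal.ofReal (Real.exp (τ * |X ω|)) ∂P ≤ ENNReal.ofReal C) (B : ℝ) :
    ∫⁻ ω, ENNReal.ofReal (|X ω| - B) ∂P ≤ ENNReal.ofReal (C / τ * Real.exp (-(τ * B))) := by
  have hp : ∀ x : ℝ, x - B ≤ Real.exp (-(τ * B)) / τ * Real.exp (τ * x) := by
    intro x
    have h1 := Real.add_one_le_exp (τ * (x - B))
    have e : Real.exp (-(τ * B)) / τ * Real.exp (τ * x) = Real.exp (τ * (x - B)) / τ := by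
      rw [div_mul_eq_mul_div, ← Real.exp_add]
      ring_nf
    rw [e, le_div_iff₀ hτ]
    linarith
  calc _ ≤ ∫⁻ ω, ENNReal.ofReal (Real.exp (-(τ * B)) / τ) *
        ENNReal.ofReal (Real.exp (τ * |X ω|)) ∂P := by
        refine lintegral_mono fun ω => ?_
        rw [← ENNReal.ofReal_mul (by positivity)]
        exact ENNReal.ofReal_le_ofReal (hp _)
    _ = ENNReal.ofReal (Real.exp (-(τ * B)) / τ) *
        ∫⁻ ω, ENNReal.ofReal (Real.exp (τ * |X ω|)) ∂P :=
        lintegral_const_mul' _ _ ENNReal.ofReal_ne_top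
    _ ≤ ENNReal.ofReal (Real.exp (-(τ * B)) / τ) * ENNReal.ofReal C := by gcongr
    _ = _ := by
        rw [← ENNReal.ofReal_mul (by positivity)]
        congr 1
        ring

/-- The deviation bound of the trend model at dependence lag and truncation level
`⌈n ^ (1 / 12)⌉` beats every dimension that is at most of the order `n`. -/
lemma eventually_mul_deviation_le {κ C c' c₁ χ τ δ e : ℝ} (hκ : 0 < κ) (hC : 0 < C) (hc' : 0 < c')
    (hc₁ : 0 < c₁) (hχ : χ ∈ Ioo (0 : ℝ) 1) (hτ : 0 < τ) (hδ : 0 < δ) (he : 0 < e) :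
    ∀ᶠ n : ℕ in atTop, ∀ T b : ℝ, 0 ≤ T → T ≤ c' * n → c₁ * (n : ℝ) ^ (2 / 3 : ℝ) ≤ b →
      T * (9 * κ * ((C * T / (1 - χ) + 1) * χ ^ (⌈(n : ℝ) ^ (1 / 12 : ℝ)⌉₊ + 1)
          + C / τ * Real.exp (-(τ * ⌈(n : ℝ) ^ (1 / 12 : ℝ)⌉₊))) / δ
        + 2 * ((⌈(n : ℝ) ^ (1 / 12 : ℝ)⌉₊ : ℝ) + 1) *
          Real.exp (-(δ ^ 2 * b / (54 * (κ ^ 2 * (((⌈(n : ℝ) ^ (1 / 12 : ℝ)⌉₊ : ℝ) + 1) ^ 2 *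
            (⌈(n : ℝ) ^ (1 / 12 : ℝ)⌉₊ : ℝ) ^ 2)))))) ≤ e := by
  have hχ0 := hχ.1
  have h1χ : 0 < 1 - χ := by linarith [hχ.2]
  have hlog : 0 < -Real.log χ := neg_pos.2 (Real.log_neg hχ0 hχ.2)
  set a := min (min τ (-Real.log χ)) (δ ^ 2 * c₁ / (1944 * κ ^ 2)) with ha
  have ha0 : 0 < a := by positivity
  set Γ := c' * (9 * κ * ((C * c' / (1 - χ) + 1) + C / τ) / δ + 6) with hΓ
  have hΓ0 : 0 < Γ := by positivity
  have hlim : Tendsto (fun n : ℕ => Γ * ((n : ℝ) ^ (1 / 12 : ℝ)) ^ (24 : ℝ) *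
      Real.exp (-a * (n : ℝ) ^ (1 / 12 : ℝ))) atTop (𝓝 0) := by
    have h1 := (tendsto_rpow_mul_exp_neg_mul_atTop_nhds_zero 24 a ha0).comp
      ((tendsto_rpow_atTop (show (0 : ℝ) < 1 / 12 by norm_num)).comp tendsto_natCast_atTop_atTop)
    have h2 := h1.const_mul Γ
    rw [mul_zero] at h2
    exact h2.congr fun n => by simp [mul_assoc]
  filter_upwards [(tendsto_order.1 hlim).2 e he, eventually_ge_atTop 1] with n hn hn1 T b hT0 hT hb
  have hn1' : (1 : ℝ) ≤ n := by exact_mod_cast hn1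
  -- in terms of `ξ` the dimension is at most of the order `ξ ^ 12`, the effective sample size at
  -- least of the order `ξ ^ 8`, and the denominator of the exponent at most of the order `ξ ^ 4`
  set ξ := (n : ℝ) ^ (1 / 12 : ℝ) with hξ
  have hξ1 : 1 ≤ ξ := Real.one_le_rpow hn1' (by norm_num)
  have hnξ : (n : ℝ) = ξ ^ 12 := by
    rw [hξ, ← Real.rpow_natCast, ← Real.rpow_mul (by positivity)]
    norm_num
  have hn23 : (n : ℝ) ^ (2 / 3 : ℝ) = ξ ^ 8 := by
    rw [hξ, ← Real.rpow_natCast, ← Real.rpow_mul (by positivity)]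
    norm_num
  rw [show (24 : ℝ) = ((24 : ℕ) : ℝ) by norm_num, Real.rpow_natCast] at hn
  set β := ⌈ξ⌉₊ with hβ
  have hβ1 : ξ ≤ β := Nat.le_ceil _
  have hβ2 : (β : ℝ) ≤ 2 * ξ := by
    have := (Nat.ceil_lt_add_one (by linarith : (0 : ℝ) ≤ ξ)).le
    linarith
  set E := Real.exp (-a * ξ) with hE
  have hE0 : 0 < E := Real.exp_pos _
  have e1 : χ ^ (β + 1) ≤ E := by
    calc χ ^ (β + 1) ≤ χ ^ β := pow_le_pow_of_le_one hχ0.le hχ.2.le (by omega)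
      _ = Real.exp (Real.log χ * β) := by
          rw [mul_comm, Real.exp_nat_mul, Real.exp_log hχ0]
      _ ≤ E := by
          rw [hE, Real.exp_le_exp]
          have h1 : a ≤ -Real.log χ := (min_le_left _ _).trans (min_le_right _ _)
          nlinarith
  have e2 : Real.exp (-(τ * β)) ≤ E := by
    rw [hE, Real.exp_le_exp]
    have h1 : a ≤ τ := (min_le_left _ _).trans (min_le_left _ _)
    nlinarith
  have e3 : Real.exp (-(δ ^ 2 * b / (54 * (κ ^ 2 * (((β : ℝ) + 1) ^ 2 * (β : ℝ) ^ 2))))) ≤ E := by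
    rw [hE, Real.exp_le_exp, neg_mul, neg_le_neg_iff, le_div_iff₀ (by positivity)]
    have h1 : a ≤ δ ^ 2 * c₁ / (1944 * κ ^ 2) := min_le_right _ _
    rw [le_div_iff₀ (by positivity)] at h1
    have h2 : ((β : ℝ) + 1) ^ 2 * (β : ℝ) ^ 2 ≤ 36 * ξ ^ 4 := by
      have h3 : ((β : ℝ) + 1) * β ≤ 6 * ξ ^ 2 := by nlinarith
      calc ((β : ℝ) + 1) ^ 2 * (β : ℝ) ^ 2 = (((β : ℝ) + 1) * β) ^ 2 := by ring
        _ ≤ (6 * ξ ^ 2) ^ 2 := by gcongr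
        _ = _ := by ring
    calc a * ξ * (54 * (κ ^ 2 * (((β : ℝ) + 1) ^ 2 * (β : ℝ) ^ 2)))
        ≤ a * ξ * (54 * (κ ^ 2 * (36 * ξ ^ 4))) := by gcongr
      _ = a * (1944 * κ ^ 2) * ξ ^ 5 := by ring
      _ ≤ δ ^ 2 * c₁ * ξ ^ 8 := by
          have h4 : ξ ^ 5 ≤ ξ ^ 8 := pow_le_pow_right₀ hξ1 (by norm_num)
          gcongr
      _ ≤ δ ^ 2 * b := by
          rw [hn23] at hb
          nlinarith [sq_nonneg δ]
  have hTξ : T ≤ c' * ξ ^ 12 := by rwa [hnξ] at hT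
  have hξ12 : 1 ≤ ξ ^ 12 := one_le_pow₀ hξ1
  have hξle : ξ ≤ ξ ^ 12 := le_self_pow₀ hξ1 (by norm_num)
  refine le_trans ?_ hn.le
  calc _ ≤ c' * ξ ^ 12 * (9 * κ * ((C * (c' * ξ ^ 12) / (1 - χ) + 1) * E + C / τ * E) / δ
        + 2 * (2 * ξ + ξ) * E) := by
        gcongr
    _ ≤ c' * ξ ^ 12 * (9 * κ * ((C * (c' * ξ ^ 12) / (1 - χ) + ξ ^ 12) * E + C / τ * ξ ^ 12 * E)
        / δ + 6 * ξ ^ 12 * E) := by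
        have h5 : C / τ ≤ C / τ * ξ ^ 12 := le_mul_of_one_le_right (by positivity) hξ12
        have h6 : 2 * (2 * ξ + ξ) ≤ 6 * ξ ^ 12 := by linarith
        gcongr
    _ = Γ * ξ ^ 24 * E := by
        rw [hΓ]
        field_simp

/-- The kernel-weighted sums of the errors are negligible, with exceptional probabilities of
smaller order than `1 / p`. -/
lemma TrendErrorCond.eventually_noise_le (hε : IsInnovation P ε) {K : ℝ → ℝ} (hK : IsKernel K)
    {hr hd : ℕ → ℝ} {N : ℕ → ℕ} (hband : BandwidthCond hr hd N) {p : ℕ → ℕ} {Θ : ℕ → ℝ}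
    {G : ∀ n, ℝ → (ℕ → S) → EuclideanSpace ℝ (Fin (p n))} {α χ q C : ℝ}
    (hα : α ∈ Ioo (0 : ℝ) 1) (hχ : χ ∈ Ioo (0 : ℝ) 1) (hq : 2 ≤ q) (hC : 0 < C)
    (hG : TrendErrorCond P ε p Θ G α χ q C) {b : ∀ n, Fin (p n) → ℝ}
    (hb : UniformlyComparable b hr) {τ : ℝ} (hτ : 0 < τ) {δ e : ℝ} (hδ : 0 < δ) (he : 0 < e) :
    ∀ᶠ n in atTop, ∀ k, ∀ t ∈ Icc τ (1 - τ), ∀ l : ℕ,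
      (p n : ℝ≥0∞) * P {ω | δ * (n * b n k) ≤
        |∑ i ∈ activeSet n (b n k) t, K (designPt n (b n k) t i) * designPt n (b n k) t i ^ l *
          G n ((i : ℝ) / n) (past ε i ω) k|} ≤ ENNReal.ofReal e := by
  have := hε.indep.isProbabilityMeasure
  obtain ⟨κ, hκ, hKκ⟩ := hK.exists_le
  obtain ⟨τ', hτ', hexp⟩ := hG.exp_moment
  obtain ⟨c', hc', hdim⟩ := hG.dim.exists_pos
  obtain ⟨c₁, hc₁, hb₁⟩ := hb.exists_rpow_le hband
  filter_upwards [hb.eventually_window hband hτ 1, hb₁, hdim.bound, eventually_ge_atTop 1,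
    eventually_mul_deviation_le hκ hC hc' hc₁ hχ hτ' hδ he] with n hwin hbn hTn hn1 hmain k t ht l
  have hn1' : (1 : ℝ) ≤ n := by exact_mod_cast hn1
  set T := max (p n : ℝ) (Θ (p n)) with hT
  have hT0 : 0 ≤ T := (Nat.cast_nonneg _).trans (le_max_left _ _)
  have hTle : T ≤ c' * n := by
    rw [Real.norm_of_nonneg hT0, Real.norm_of_nonneg (by positivity)] at hTn
    refine hTn.trans (mul_le_mul_of_nonneg_left ?_ hc'.le)
    calc (n : ℝ) ^ α ≤ (n : ℝ) ^ (1 : ℝ) := Real.rpow_le_rpow_of_exponent_le hn1' hα.2.le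
      _ = n := Real.rpow_one _
  set β := ⌈(n : ℝ) ^ (1 / 12 : ℝ)⌉₊ with hβ
  have hβ0 : (0 : ℝ) < β := by
    have : 0 < β := Nat.ceil_pos.2 (Real.rpow_pos_of_pos (by linarith) _)
    exact_mod_cast this
  have hq1 : 1 ≤ ENNReal.ofReal q := by
    rw [← ENNReal.ofReal_one]
    exact ENNReal.ofReal_le_ofReal (by linarith)
  have hmem : ∀ i ∈ activeSet n (b n k) t, i ∈ Finset.Icc 1 n := fun i hi =>
    (Finset.mem_filter.1 hi).1
  have hF : ∀ i ∈ activeSet n (b n k) t, Measurable fun v => G n ((i : ℝ) / n) v k := by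
    intro i hi
    have := hG.meas n _ (div_mem_Icc_of_mem_activeSet hi)
    fun_prop
  have hi : ∀ i ∈ activeSet n (b n k) t,
      Integrable (fun ω => G n ((i : ℝ) / n) (past ε 0 ω) k) P := by
    intro i hi
    have hu := div_mem_Icc_of_mem_activeSet hi
    exact integrable_coord ((hG.meas n _ hu).comp (measurable_past hε 0)) hq1
      ((hG.moment n _ hu).trans_lt ENNReal.ofReal_lt_top).ne k
  have happ : ∀ i ∈ activeSet n (b n k) t, ∃ φ : (Fin (β + 1) → S) → ℝ, Measurable φ ∧
      (∀ v, |φ v| ≤ β) ∧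
      ∫⁻ ω, ‖G n ((i : ℝ) / n) (past ε 0 ω) k - φ (fun j => past ε 0 ω j)‖ₑ ∂P
        ≤ ENNReal.ofReal ((C * T / (1 - χ) + 1) * χ ^ (β + 1)
          + C / τ' * Real.exp (-(τ' * β))) := by
    intro i hia
    have hu := div_mem_Icc_of_mem_activeSet hia
    refine hε.exists_bounded_finite_approx (F := fun v => G n ((i : ℝ) / n) v k) (hF i hia)
      (hi i hia) (by positivity) hχ (by positivity) hβ0.le (fun j => ?_) ?_ β
    · refine (lintegral_coord_le_physDep hε hq1 hu (hG.meas n _ hu) j k).trans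
        ((hG.dep n j).trans (ENNReal.ofReal_le_ofReal ?_))
      have h1 : Θ (p n) ≤ T := le_max_right _ _
      have h2 := pow_pos hχ.1 j
      gcongr
    · have h1 := hexp n i (hmem i hia) k
      have h2 := hε.lintegral_past i
        (f := fun v => ENNReal.ofReal (Real.exp (τ' * |G n ((i : ℝ) / n) v k|)))
        (Real.measurable_exp.comp ((hF i hia).abs.const_mul τ')).ennreal_ofReal
      rw [h2] at h1
      exact lintegral_trunc_le_of_exp_moment (X := fun ω => G n ((i : ℝ) / n) (past ε 0 ω) k) hτ' h1 β
  have hA : ∀ i ∈ activeSet n (b n k) t,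
      |K (designPt n (b n k) t i) * designPt n (b n k) t i ^ l| ≤ κ := fun i hia =>
    abs_kernel_mul_pow_le hK hKκ hia l
  have hdev := hε.measure_activeSet_sum_ge_le (F := fun i v => G n ((i : ℝ) / n) v k) (hb.1 n k) ((hwin k).1.trans ht.1) (hwin k).2 hF hi
    (m := β) (B := β) (η := (C * T / (1 - χ) + 1) * χ ^ (β + 1) + C / τ' * Real.exp (-(τ' * β)))
    hκ hβ0 (by have := hχ.1; have : 0 < 1 - χ := by linarith [hχ.2]
               positivity) happ hA hδ
  have hset : ∀ ω, ∑ i ∈ activeSet n (b n k) t,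
      K (designPt n (b n k) t i) * designPt n (b n k) t i ^ l *
        (G n ((i : ℝ) / n) (past ε i ω) k - ∫ ω', G n ((i : ℝ) / n) (past ε i ω') k ∂P)
      = ∑ i ∈ activeSet n (b n k) t, K (designPt n (b n k) t i) * designPt n (b n k) t i ^ l *
        G n ((i : ℝ) / n) (past ε i ω) k := fun ω =>
    Finset.sum_congr rfl fun i hia => by rw [hG.mean_zero n i (hmem i hia) k, sub_zero]
  simp only [hset] at hdev
  have hpT : (p n : ℝ≥0∞) ≤ ENNReal.ofReal T := by
    rw [← ENNReal.ofReal_natCast]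
    exact ENNReal.ofReal_le_ofReal (le_max_left _ _)
  refine (mul_le_mul' hpT hdev).trans ?_
  rw [← ENNReal.ofReal_mul hT0]
  exact ENNReal.ofReal_le_ofReal (hmain T _ hT0 hTle (hbn k))

/-- In the trend model the local linear estimators are consistent for every family of bandwidths
of the order `h_r`. -/
theorem TrendErrorCond.relConsistent (hε : IsInnovation P ε) {K : ℝ → ℝ} (hK : IsKernel K)
    {hr hd : ℕ → ℝ} {N : ℕ → ℕ} (hband : BandwidthCond hr hd N) {p : ℕ → ℕ} {Θ : ℕ → ℝ}
    {G : ∀ n, ℝ → (ℕ → S) → EuclideanSpace ℝ (Fin (p n))} {α χ q C : ℝ}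
    (hα : α ∈ Ioo (0 : ℝ) 1) (hχ : χ ∈ Ioo (0 : ℝ) 1) (hq : 2 ≤ q) (hC : 0 < C)
    (hG : TrendErrorCond P ε p Θ G α χ q C) {m : ∀ n, Fin (p n) → ℝ → ℝ}
    (hsm : SmoothFamily fun i : Σ n, Fin (p n) => m i.1 i.2)
    (hinc : UniformlyIncreasing fun i : Σ n, Fin (p n) => m i.1 i.2)
    {y : ∀ n, ℕ → Fin (p n) → Ω → ℝ}
    (hy : ∀ n i k ω, y n i k ω = m n k ((i : ℝ) / n) + G n ((i : ℝ) / n) (past ε i ω) k)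
    {b : ∀ n, Fin (p n) → ℝ} (hb : UniformlyComparable b hr) :
    RelConsistent P p m fun n k ω t => localLinear n K (b n k) (fun i => y n i k ω) t := by
  intro κ hκ τ hτ e he
  obtain ⟨L, hL⟩ := hsm
  obtain ⟨M, hM, hM'⟩ := hinc
  obtain ⟨B, hB, hKB⟩ := hK.exists_le
  obtain ⟨C', hC', hcurve⟩ := exists_abs_sub_linear_le L.coe_nonneg hM hτ.1
  obtain ⟨c, hc, C₀, hdes⟩ := hK.exists_design_bound
  set δ := κ * M * c / 16 with hδ
  have hδ0 : 0 < δ := by positivity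
  -- for bandwidths below `ρ` the bias is at most half of the allowed error
  set ρ := min τ (min 1 (κ * c / (24 * B * C'))) with hρ
  have hρ0 : 0 < ρ := by have := hτ.1; positivity
  filter_upwards [hb.eventually_window hband hρ0 (max 1 C₀),
    hG.eventually_noise_le hε hK hband hα hχ hq hC hb hτ.1 hδ0 (e := e / 2) (by positivity)]
    with n hwin hnoise k t ht
  obtain ⟨hbρ, hbn⟩ := hwin k
  have hb0 := hb.1 n k
  have hbt : b n k ≤ t := (hbρ.trans (min_le_left _ _)).trans ht.1
  have hbt' : b n k ≤ 1 - t := (hbρ.trans (min_le_left _ _)).trans (by linarith [ht.2])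
  have hn1 : 1 ≤ n * b n k := (le_max_left _ _).trans hbn
  have htI : t ∈ Icc (0 : ℝ) 1 := ⟨by linarith, by linarith⟩
  obtain ⟨hdf, hdf', hlip⟩ := hL ⟨n, k⟩
  have hMk := hM' ⟨n, k⟩
  dsimp only at hdf hdf' hlip hMk
  set s := derivWithin (m n k) (Icc 0 1) t with hs
  have hMs : M ≤ s := hMk t htI
  have hs0 : 0 < s := hM.trans_le hMs
  have hquad := hcurve (m n k) hdf hdf'
    (fun x hx y hy => by simpa [Real.dist_eq] using hlip.dist_le_mul x hx y hy) hMk t ht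
  have hnh : 0 < n * b n k := by linarith
  have hsub : {ω | κ * s ≤ |localLinear n K (b n k) (fun i => y n i k ω) t - m n k t|} ⊆
      {ω | δ * (n * b n k) ≤ |∑ i ∈ activeSet n (b n k) t, K (designPt n (b n k) t i) *
        designPt n (b n k) t i ^ 0 * G n ((i : ℝ) / n) (past ε i ω) k|} ∪
      {ω | δ * (n * b n k) ≤ |∑ i ∈ activeSet n (b n k) t, K (designPt n (b n k) t i) *
        designPt n (b n k) t i ^ 1 * G n ((i : ℝ) / n) (past ε i ω) k|} := by
    intro ω hω
    by_contra hcon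
    simp only [mem_union, not_or, mem_ofPred_eq, not_le] at hcon hω
    have h1 := abs_localLinear_sub_le_of_curve hK hKB hb0 hbt hn1 hc
      (by positivity : 0 ≤ C' * s)
      (hdes n (b n k) t hb0 hbt hbt' ((le_max_right _ _).trans hbn)) hquad
      (fun i => hy n i k ω)
    have h2 : 12 * B * (C' * s * b n k ^ 2) / c ≤ κ * s / 2 := by
      have h3 : b n k ^ 2 ≤ κ * c / (24 * B * C') := by
        have h4 : b n k ≤ 1 := hbρ.trans ((min_le_right _ _).trans (min_le_left _ _))
        have h5 : b n k ≤ κ * c / (24 * B * C') :=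
          hbρ.trans ((min_le_right _ _).trans (min_le_right _ _))
        nlinarith
      rw [le_div_iff₀ (by positivity)] at h3
      rw [div_le_iff₀ hc]
      nlinarith
    have h3 : 2 / (c * (n * b n k)) *
      (|∑ i ∈ activeSet n (b n k) t, K (designPt n (b n k) t i) * designPt n (b n k) t i ^ 0 *
          G n ((i : ℝ) / n) (past ε i ω) k|
        + |∑ i ∈ activeSet n (b n k) t, K (designPt n (b n k) t i) * designPt n (b n k) t i ^ 1 *
          G n ((i : ℝ) / n) (past ε i ω) k|) ≤ κ * s / 4 := by
      refine (mul_le_mul_of_nonneg_left (add_le_add hcon.1.le hcon.2.le)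
        (by positivity)).trans ?_
      rw [hδ, div_mul_eq_mul_div, div_le_iff₀ (by positivity)]
      have : κ * M * (c * (n * b n k)) ≤ κ * s * (c * (n * b n k)) := by gcongr
      linarith
    have h4 : 0 < κ * s := by positivity
    linarith
  calc _ ≤ (p n : ℝ≥0∞) * (_ + _) := by
        gcongr
        exact (measure_mono hsub).trans (measure_union_le _ _)
    _ ≤ ENNReal.ofReal (e / 2) + ENNReal.ofReal (e / 2) := by
        rw [mul_add]
        exact add_le_add (hnoise k t ht 0) (hnoise k t ht 1)
    _ = ENNReal.ofReal e := by
        rw [← ENNReal.ofReal_add (by positivity) (by positivity), add_halves]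

end Trend

/-! ### Uniform weak laws of large numbers -/

section UniformWeakLaw

variable {Ω S : Type*} [MeasurableSpace Ω] [MeasurableSpace S]
  {P : Measure Ω} {ε : ℤ → Ω → S}

/-- The functionals `F u`, `u ∈ [0, 1]`, of the past are integrable and, up to an arbitrarily small
error in `L¹`, bounded functions of finitely many innovations, with a number of innovations and a
bound that do not depend on `u`. -/
structure UniformlyApproximable (P : Measure Ω) (ε : ℤ → Ω → S) (F : ℝ → (ℕ → S) → ℝ) :
    Prop where
  meas : ∀ u ∈ Icc (0 : ℝ) 1, Measurable (F u)
  integrable : ∀ u ∈ Icc (0 : ℝ) 1, Integrable (fun ω => F u (past ε 0 ω)) P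
  approx : ∀ η > (0 : ℝ), ∃ (m : ℕ) (B : ℝ), 0 < B ∧ ∀ u ∈ Icc (0 : ℝ) 1,
    ∃ φ : (Fin (m + 1) → S) → ℝ, Measurable φ ∧ (∀ v, |φ v| ≤ B) ∧
      ∫⁻ ω, ‖F u (past ε 0 ω) - φ (fun j => past ε 0 ω j)‖ₑ ∂P ≤ ENNReal.ofReal η

/-- The weak law of large numbers for kernel windows, uniform in the position of the window and in
bounded weights. -/
theorem UniformlyApproximable.eventually_sum_le (hε : IsInnovation P ε) {F : ℝ → (ℕ → S) → ℝ}
    (hF : UniformlyApproximable P ε F) {hr hd : ℕ → ℝ} {N : ℕ → ℕ} (hband : BandwidthCond hr hd N)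
    {p : ℕ → ℕ} {b : ∀ n, Fin (p n) → ℝ} (hb : UniformlyComparable b hr) {τ : ℝ} (hτ : 0 < τ)
    {R : ℝ} (hR : 0 ≤ R) {δ e : ℝ} (hδ : 0 < δ) (he : 0 < e) :
    ∀ᶠ n in atTop, ∀ k, ∀ t ∈ Icc τ (1 - τ), ∀ a : ℕ → ℝ,
      (∀ i ∈ activeSet n (b n k) t, |a i| ≤ R) →
      P {ω | δ * (n * b n k) ≤ |∑ i ∈ activeSet n (b n k) t,
        a i * (F ((i : ℝ) / n) (past ε i ω) - ∫ ω', F ((i : ℝ) / n) (past ε 0 ω') ∂P)|}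
        ≤ ENNReal.ofReal e := by
  -- a positive weight bound is needed for the choice of the approximation error
  set A := R + 1 with hA
  have hA0 : 0 < A := by positivity
  obtain ⟨m, B, hB, happ⟩ := hF.approx (e * δ / (18 * A)) (by positivity)
  set γ := δ ^ 2 / (54 * (A ^ 2 * (((m : ℝ) + 1) ^ 2 * B ^ 2))) with hγ
  have hγ0 : 0 < γ := by positivity
  have hlim : Tendsto (fun x : ℝ => 2 * ((m : ℝ) + 1) * Real.exp (-(γ * x))) atTop (𝓝 0) := by
    have h1 := (Real.tendsto_exp_neg_atTop_nhds_zero.comp (tendsto_id.const_mul_atTop hγ0)).const_mul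
      (2 * ((m : ℝ) + 1))
    simpa using h1
  obtain ⟨Γ, hΓ⟩ := eventually_atTop.1 ((tendsto_order.1 hlim).2 (e / 2) (by positivity))
  filter_upwards [hb.eventually_window hband hτ (max 1 Γ)] with n hwin k t ht a ha
  obtain ⟨hbτ, hbn⟩ := hwin k
  have hdev := hε.measure_activeSet_sum_ge_le (F := fun i => F ((i : ℝ) / n)) (hb.1 n k)
    (hbτ.trans ht.1) ((le_max_left _ _).trans hbn)
    (fun i hi => hF.meas _ (div_mem_Icc_of_mem_activeSet hi))
    (fun i hi => hF.integrable _ (div_mem_Icc_of_mem_activeSet hi)) hA0 hB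
    (by positivity : 0 ≤ e * δ / (18 * A))
    (fun i hi => happ _ (div_mem_Icc_of_mem_activeSet hi))
    (fun i hi => (ha i hi).trans (by linarith)) hδ
  have hset : ∀ ω, ∑ i ∈ activeSet n (b n k) t,
      a i * (F ((i : ℝ) / n) (past ε i ω) - ∫ ω', F ((i : ℝ) / n) (past ε i ω') ∂P)
      = ∑ i ∈ activeSet n (b n k) t,
        a i * (F ((i : ℝ) / n) (past ε i ω) - ∫ ω', F ((i : ℝ) / n) (past ε 0 ω') ∂P) := fun ω =>
    Finset.sum_congr rfl fun i hi => by
      rw [hε.integral_past i (hF.meas _ (div_mem_Icc_of_mem_activeSet hi))]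
  simp only [hset] at hdev
  refine hdev.trans (ENNReal.ofReal_le_ofReal ?_)
  have h1 : 9 * A * (e * δ / (18 * A)) / δ = e / 2 := by
    field_simp
    norm_num
  have h2 := (hΓ _ ((le_max_right _ _).trans hbn)).le
  have h3 : δ ^ 2 * (n * b n k) / (54 * (A ^ 2 * (((m : ℝ) + 1) ^ 2 * B ^ 2)))
      = γ * (n * b n k) := by rw [hγ]; ring
  rw [h1, h3]
  linarith

lemma lintegral_enorm_sq_le {E : Type*} [NormedAddCommGroup E] {f : Ω → E} {c : ℝ≥0∞}
    (h : eLpNorm f 2 P ≤ c) : ∫⁻ ω, ‖f ω‖ₑ ^ 2 ∂P ≤ c ^ 2 := by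
  have h1 := eLpNorm_nnreal_pow_eq_lintegral (f := f) (μ := P) (p := 2) two_ne_zero
  simp only [NNReal.coe_ofNat, ENNReal.rpow_ofNat, ENNReal.coe_ofNat] at h1
  rw [← h1]
  gcongr

/-- A second moment bounds the truncation error. -/
lemma lintegral_trunc_le_of_sq {X : Ω → ℝ} {V : ℝ} (hV : 0 ≤ V)
    (h : eLpNorm X 2 P ≤ ENNReal.ofReal V) {B : ℝ} (hB : 0 < B) :
    ∫⁻ ω, ENNReal.ofReal (|X ω| - B) ∂P ≤ ENNReal.ofReal (V ^ 2 / B) := by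
  calc _ ≤ ∫⁻ ω, ENNReal.ofReal B⁻¹ * ‖X ω‖ₑ ^ 2 ∂P := by
        refine lintegral_mono fun ω => ?_
        rw [Real.enorm_eq_ofReal_abs, ← ENNReal.ofReal_pow (abs_nonneg _),
          ← ENNReal.ofReal_mul (by positivity)]
        refine ENNReal.ofReal_le_ofReal ?_
        rw [inv_mul_eq_div, le_div_iff₀ hB]
        nlinarith [sq_nonneg (|X ω| - B), abs_nonneg (X ω)]
    _ = ENNReal.ofReal B⁻¹ * ∫⁻ ω, ‖X ω‖ₑ ^ 2 ∂P :=
        lintegral_const_mul' _ _ ENNReal.ofReal_ne_top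
    _ ≤ ENNReal.ofReal B⁻¹ * ENNReal.ofReal V ^ 2 := by
        gcongr
        exact lintegral_enorm_sq_le h
    _ = _ := by
        rw [← ENNReal.ofReal_pow hV, ← ENNReal.ofReal_mul (by positivity)]
        congr 1
        ring

lemma eLpNorm_coord_le {d : ℕ} {f : Ω → EuclideanSpace ℝ (Fin d)} (q : ℝ≥0∞) (a : Fin d) :
    eLpNorm (fun ω => f ω a) q P ≤ eLpNorm f q P :=
  eLpNorm_mono fun ω => PiLp.norm_apply_le (f ω) a

/-- Geometrically decaying dependence and bounded second moments make the coordinates of a filter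
uniformly approximable. -/
theorem uniformlyApproximable_of_physDep (hε : IsInnovation P ε) {d : ℕ}
    {F : ℝ → (ℕ → S) → EuclideanSpace ℝ (Fin d)} (hF : ∀ u ∈ Icc (0 : ℝ) 1, Measurable (F u))
    {q : ℝ≥0∞} (hq : 2 ≤ q) {χ : ℝ} (hχ : χ ∈ Ioo (0 : ℝ) 1) {C : ℝ}
    (hdep : ∀ k, physDep P ε q F k ≤ ENNReal.ofReal (C * χ ^ k)) {V : ℝ}
    (hV : ∀ u ∈ Icc (0 : ℝ) 1, eLpNorm (fun ω => F u (past ε 0 ω)) q P ≤ ENNReal.ofReal V)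
    (a : Fin d) : UniformlyApproximable P ε fun u v => F u v a := by
  have := hε.indep.isProbabilityMeasure
  have hq1 : 1 ≤ q := one_le_two.trans hq
  have hint : ∀ u ∈ Icc (0 : ℝ) 1, Integrable (fun ω => F u (past ε 0 ω) a) P := fun u hu =>
    integrable_coord ((hF u hu).comp (measurable_past hε 0)) hq1
      ((hV u hu).trans_lt ENNReal.ofReal_lt_top).ne a
  have hm : ∀ u ∈ Icc (0 : ℝ) 1, Measurable fun v => F u v a := fun u hu => by
    have := hF u hu
    fun_prop
  refine ⟨hm, hint, fun η hη => ?_⟩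
  have h1χ : 0 < 1 - χ := by linarith [hχ.2]
  set D := max C 0 with hD
  have hD0 : 0 ≤ D := le_max_right _ _
  set W := max V 0 with hW
  have hW0 : 0 ≤ W := le_max_right _ _
  have hlim : Tendsto (fun m : ℕ => (D / (1 - χ) + 1) * χ ^ (m + 1)) atTop (𝓝 0) := by
    have h := ((tendsto_pow_atTop_nhds_zero_of_lt_one hχ.1.le hχ.2).comp
      (tendsto_add_atTop_nat 1)).const_mul (D / (1 - χ) + 1)
    simpa using h
  obtain ⟨m, hm'⟩ := ((tendsto_order.1 hlim).2 (η / 2) (by positivity)).exists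
  set B := 2 * W ^ 2 / η + 1 with hB
  have hB0 : 0 < B := by positivity
  refine ⟨m, B, hB0, fun u hu => ?_⟩
  obtain ⟨φ, hφ, hφB, hφη⟩ := hε.exists_bounded_finite_approx (hm u hu) (hint u hu) hD0 hχ
    (by positivity : 0 ≤ W ^ 2 / B) hB0.le
    (fun k => (lintegral_coord_le_physDep hε hq1 hu (hF u hu) k a).trans ((hdep k).trans
      (ENNReal.ofReal_le_ofReal
        (mul_le_mul_of_nonneg_right (le_max_left _ _) (pow_pos hχ.1 k).le))))
    (lintegral_trunc_le_of_sq hW0 (by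
      refine (eLpNorm_coord_le 2 a).trans ((eLpNorm_le_eLpNorm_of_exponent_le hq
        ((hF u hu).comp (measurable_past hε 0)).aestronglyMeasurable).trans ((hV u hu).trans ?_))
      exact ENNReal.ofReal_le_ofReal (le_max_left _ _)) hB0) m
  refine ⟨φ, hφ, hφB, hφη.trans (ENNReal.ofReal_le_ofReal ?_)⟩
  have h1 : W ^ 2 / B ≤ η / 2 := by
    rw [div_le_iff₀ hB0, hB]
    have : η / 2 * (2 * W ^ 2 / η + 1) = W ^ 2 + η / 2 := by field_simp
    linarith
  linarith

/-- An integrable functional of the past is close in `L¹` to a function of finitely many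
innovations. -/
lemma exists_finite_approx_of_integrable (hε : IsInnovation P ε) {F : (ℕ → S) → ℝ}
    (hF : Measurable F) (hi : Integrable (fun ω => F (past ε 0 ω)) P) {η : ℝ≥0∞} (hη : η ≠ 0) :
    ∃ J : ℕ, ∀ m ≥ J, ∃ φ : (Fin (m + 1) → S) → ℝ, Measurable φ ∧
      ∫⁻ ω, ‖F (past ε 0 ω) - φ (fun j => past ε 0 ω j)‖ₑ ∂P ≤ η := by
  have := hε.indep.isProbabilityMeasure
  have hp := measurable_past hε 0
  have : IsProbabilityMeasure (P.map (past ε 0)) := Measure.isProbabilityMeasure_map hp.aemeasurable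
  obtain ⟨J, f, hf, hfJ, hFf⟩ := exists_dependsOn_lintegral_le (P.map (past ε 0)) hF
    ((integrable_map_measure hF.aestronglyMeasurable hp.aemeasurable).2 hi) hη
  refine ⟨J, fun m hm => ⟨fun v => f fun j => v ⟨min j m, by omega⟩,
    hf.comp (measurable_pi_lambda _ fun j => measurable_pi_apply _), ?_⟩⟩
  rw [lintegral_map (f := fun x => ‖F x - f x‖ₑ) (hF.sub hf).enorm hp] at hFf
  refine le_trans (le_of_eq (lintegral_congr fun ω => ?_)) hFf
  congr 2
  refine hfJ fun j hj => ?_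
  have hj' : j ≤ J := hj
  simp [min_eq_left (hj'.trans hm)]

/-- Functionals that depend on `u` in an `L¹`-Lipschitz way and have bounded second moments are
uniformly approximable: it suffices to approximate those on a finite grid. -/
theorem uniformlyApproximable_of_lipschitz (hε : IsInnovation P ε) {F : ℝ → (ℕ → S) → ℝ}
    (hF : ∀ u ∈ Icc (0 : ℝ) 1, Measurable (F u)) {V : ℝ}
    (hV : ∀ u ∈ Icc (0 : ℝ) 1, eLpNorm (fun ω => F u (past ε 0 ω)) 2 P ≤ ENNReal.ofReal V) {L : ℝ}
    (hL : ∀ u ∈ Icc (0 : ℝ) 1, ∀ v ∈ Icc (0 : ℝ) 1,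
      ∫⁻ ω, ‖F u (past ε 0 ω) - F v (past ε 0 ω)‖ₑ ∂P ≤ ENNReal.ofReal (L * |u - v|)) :
    UniformlyApproximable P ε F := by
  have := hε.indep.isProbabilityMeasure
  have hp := measurable_past hε 0
  have hint : ∀ u ∈ Icc (0 : ℝ) 1, Integrable (fun ω => F u (past ε 0 ω)) P := fun u hu =>
    MemLp.integrable one_le_two ⟨((hF u hu).comp hp).aestronglyMeasurable,
      (hV u hu).trans_lt ENNReal.ofReal_lt_top⟩
  refine ⟨hF, hint, fun η hη => ?_⟩
  set W := max V 0 with hW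
  have hW0 : 0 ≤ W := le_max_right _ _
  set D := max L 0 with hD
  have hD0 : 0 ≤ D := le_max_right _ _
  obtain ⟨Q, hQ⟩ := exists_nat_gt (3 * D / η)
  have hQ0 : (0 : ℝ) < Q := lt_of_le_of_lt (by positivity) hQ
  have hgrid : ∀ j ∈ Finset.range (Q + 1), (j : ℝ) / Q ∈ Icc (0 : ℝ) 1 := by
    intro j hj
    refine ⟨by positivity, (div_le_one hQ0).2 ?_⟩
    exact_mod_cast Nat.lt_succ_iff.1 (Finset.mem_range.1 hj)
  have hex : ∀ j ∈ Finset.range (Q + 1), ∃ J : ℕ, ∀ m ≥ J, ∃ φ : (Fin (m + 1) → S) → ℝ,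
      Measurable φ ∧ ∫⁻ ω, ‖F ((j : ℝ) / Q) (past ε 0 ω) - φ (fun j => past ε 0 ω j)‖ₑ ∂P
        ≤ ENNReal.ofReal (η / 3) := fun j hj =>
    exists_finite_approx_of_integrable hε (hF _ (hgrid j hj)) (hint _ (hgrid j hj))
      (by simpa using hη)
  choose! J hJ using hex
  set m := (Finset.range (Q + 1)).sup J with hm
  set B := 3 * W ^ 2 / η + 1 with hB
  have hB0 : 0 < B := by positivity
  refine ⟨m, B, hB0, fun u hu => ?_⟩
  set j := ⌊u * Q⌋₊ with hj
  have huQ : 0 ≤ u * Q := mul_nonneg hu.1 hQ0.le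
  have hjQ : j ∈ Finset.range (Q + 1) := by
    rw [Finset.mem_range, Nat.lt_succ_iff]
    exact Nat.floor_le_of_le (mul_le_of_le_one_left hQ0.le hu.2)
  have hdist : |u - (j : ℝ) / Q| ≤ 1 / Q := by
    have h1 : (j : ℝ) ≤ u * Q := Nat.floor_le huQ
    have h2 : u * Q < j + 1 := Nat.lt_floor_add_one _
    rw [abs_of_nonneg (sub_nonneg.2 ((div_le_iff₀ hQ0).2 h1)), sub_le_iff_le_add, ← add_div,
      le_div_iff₀ hQ0]
    linarith
  obtain ⟨φ, hφ, hφη⟩ := hJ j hjQ m (Finset.le_sup hjQ)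
  have hclose : ∫⁻ ω, ‖F u (past ε 0 ω) - F ((j : ℝ) / Q) (past ε 0 ω)‖ₑ ∂P
      ≤ ENNReal.ofReal (η / 3) := by
    refine (hL u hu _ (hgrid j hjQ)).trans (ENNReal.ofReal_le_ofReal ?_)
    calc L * |u - (j : ℝ) / Q| ≤ D * (1 / Q) := by
          have : L ≤ D := le_max_left _ _
          gcongr
      _ ≤ η / 3 := by
          rw [mul_one_div, div_le_iff₀ hQ0]
          rw [div_lt_iff₀ hη] at hQ
          linarith
  have h1 : ∫⁻ ω, ‖F u (past ε 0 ω) - φ (fun j => past ε 0 ω j)‖ₑ ∂P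
      ≤ ENNReal.ofReal (η / 3) + ENNReal.ofReal (η / 3) := by
    refine le_trans ?_ (add_le_add hclose hφη)
    rw [← lintegral_add_left (f := fun ω => ‖F u (past ε 0 ω) - F ((j : ℝ) / Q) (past ε 0 ω)‖ₑ)
      (((hF u hu).comp hp).sub ((hF _ (hgrid j hjQ)).comp hp)).enorm]
    exact lintegral_mono fun ω => enorm_sub_le_add _ _ _
  obtain ⟨ψ, hψ, hψB, hψη⟩ := exists_bounded_approx hε (hF u hu) hφ hB0.le h1
    (lintegral_trunc_le_of_sq hW0
      ((hV u hu).trans (ENNReal.ofReal_le_ofReal (le_max_left _ _))) hB0)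
  refine ⟨ψ, hψ, hψB, hψη.trans ?_⟩
  rw [← ENNReal.ofReal_add (by positivity) (by positivity),
    ← ENNReal.ofReal_add (by positivity) (by positivity)]
  refine ENNReal.ofReal_le_ofReal ?_
  have h2 : W ^ 2 / B ≤ η / 3 := by
    rw [div_le_iff₀ hB0, hB]
    have : η / 3 * (3 * W ^ 2 / η + 1) = W ^ 2 + η / 3 := by field_simp
    linarith
  linarith

/-- The products of the coordinates of a filter that is `L²`-Lipschitz in `u` and has bounded fourth
moments are uniformly approximable. -/
theorem uniformlyApproximable_mul (hε : IsInnovation P ε) {d : ℕ}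
    {H : ℝ → (ℕ → S) → EuclideanSpace ℝ (Fin d)} (hH : ∀ u ∈ Icc (0 : ℝ) 1, Measurable (H u))
    {C : ℝ} (hC : ∀ u ∈ Icc (0 : ℝ) 1, eLpNorm (fun ω => H u (past ε 0 ω)) 4 P ≤ ENNReal.ofReal C)
    {L : ℝ} (hL : ∀ u ∈ Icc (0 : ℝ) 1, ∀ v ∈ Icc (0 : ℝ) 1,
      eLpNorm (fun ω => H u (past ε 0 ω) - H v (past ε 0 ω)) 2 P ≤ ENNReal.ofReal (L * |u - v|))
    (a b : Fin d) : UniformlyApproximable P ε fun u v => H u v a * H u v b := by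
  have := hε.indep.isProbabilityMeasure
  have hp := measurable_past hε 0
  have hHp : ∀ u ∈ Icc (0 : ℝ) 1, ∀ a, Measurable fun ω => H u (past ε 0 ω) a := fun u hu a => by
    have := (hH u hu).comp hp
    exact (measurable_pi_apply a).comp ((PiLp.continuous_ofLp 2 _).measurable.comp this)
  have h442 : ENNReal.HolderTriple 4 4 2 := ⟨by
    rw [show (4 : ℝ≥0∞) = 2 * 2 by norm_num, ENNReal.mul_inv (by simp) (by simp), ← mul_add,
      ENNReal.inv_two_add_inv_two, mul_one]⟩
  have hC2 : ∀ u ∈ Icc (0 : ℝ) 1, ∀ a,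
      eLpNorm (fun ω => H u (past ε 0 ω) a) 2 P ≤ ENNReal.ofReal C := fun u hu a =>
    (eLpNorm_coord_le 2 a).trans ((eLpNorm_le_eLpNorm_of_exponent_le (by norm_num)
      ((hH u hu).comp hp).aestronglyMeasurable).trans (hC u hu))
  refine uniformlyApproximable_of_lipschitz hε
    (fun u hu => ?_) (V := max C 0 * max C 0) (fun u hu => ?_)
    (L := max L 0 * max C 0 + max C 0 * max L 0) fun u hu v hv => ?_
  · have := hH u hu
    fun_prop
  · have h1 := eLpNorm_smul_le_mul_eLpNorm (μ := P) (p := 4) (q := 4) (r := 2)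
      (hHp u hu b).aestronglyMeasurable (hHp u hu a).aestronglyMeasurable
    refine h1.trans ?_
    rw [ENNReal.ofReal_mul (le_max_right _ _)]
    refine mul_le_mul' ?_ ?_ <;>
      exact (eLpNorm_coord_le 4 _).trans ((hC u hu).trans
        (ENNReal.ofReal_le_ofReal (le_max_left _ _)))
  · have hsplit : ∫⁻ ω, ‖H u (past ε 0 ω) a * H u (past ε 0 ω) b
          - H v (past ε 0 ω) a * H v (past ε 0 ω) b‖ₑ ∂P
        ≤ eLpNorm ((fun ω => (H u (past ε 0 ω) - H v (past ε 0 ω)) a) •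
            fun ω => H u (past ε 0 ω) b) 1 P
          + eLpNorm ((fun ω => H v (past ε 0 ω) a) •
            fun ω => (H u (past ε 0 ω) - H v (past ε 0 ω)) b) 1 P := by
      have hm : Measurable ((fun ω => (H u (past ε 0 ω) - H v (past ε 0 ω)) a) •
          fun ω => H u (past ε 0 ω) b) := ((hHp u hu a).sub (hHp v hv a)).smul (hHp u hu b)
      rw [eLpNorm_one_eq_lintegral_enorm, eLpNorm_one_eq_lintegral_enorm,
        ← lintegral_add_left hm.enorm]
      refine lintegral_mono fun ω => ?_
      refine le_trans (le_of_eq ?_) (enorm_add_le _ _)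
      congr 1
      simp only [Pi.smul_apply', smul_eq_mul, PiLp.sub_apply]
      ring
    refine hsplit.trans ?_
    have hLL : eLpNorm (fun ω => H u (past ε 0 ω) - H v (past ε 0 ω)) 2 P
        ≤ ENNReal.ofReal (max L 0 * |u - v|) := (hL u hu v hv).trans
      (ENNReal.ofReal_le_ofReal (mul_le_mul_of_nonneg_right (le_max_left _ _) (abs_nonneg _)))
    have hCC : ∀ u ∈ Icc (0 : ℝ) 1, ∀ a,
        eLpNorm (fun ω => H u (past ε 0 ω) a) 2 P ≤ ENNReal.ofReal (max C 0) := fun u hu a =>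
      (hC2 u hu a).trans (ENNReal.ofReal_le_ofReal (le_max_left _ _))
    have hdm : ∀ a, AEStronglyMeasurable
        (fun ω => (H u (past ε 0 ω) - H v (past ε 0 ω)) a) P := fun a =>
      ((hHp u hu a).sub (hHp v hv a)).aestronglyMeasurable
    have h1 := eLpNorm_smul_le_mul_eLpNorm (μ := P) (p := 2) (q := 2) (r := 1)
      (hHp u hu b).aestronglyMeasurable (hdm a)
    have h2 := eLpNorm_smul_le_mul_eLpNorm (μ := P) (p := 2) (q := 2) (r := 1)
      (hdm b) (hHp v hv a).aestronglyMeasurable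
    have hL0 : 0 ≤ max L 0 := le_max_right _ _
    have hC0 : 0 ≤ max C 0 := le_max_right _ _
    refine (add_le_add
      (h1.trans (mul_le_mul' ((eLpNorm_coord_le 2 a).trans hLL) (hCC u hu b)))
      (h2.trans (mul_le_mul' (hCC v hv a) ((eLpNorm_coord_le 2 b).trans hLL)))).trans
      (le_of_eq ?_)
    rw [← ENNReal.ofReal_mul (by positivity), ← ENNReal.ofReal_mul hC0,
      ← ENNReal.ofReal_add (by positivity) (by positivity)]
    congr 1
    ring

end UniformWeakLaw

/-! ### The normal equations of the regression model -/

section NormalEquations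

/-- A matrix with spectrum above `c` has a quadratic form above `c`. -/
lemma mul_sum_sq_le_of_spectrum {d : ℕ} {M : Matrix (Fin d) (Fin d) ℝ} (hM : M.IsHermitian) {c : ℝ}
    (hc : ∀ μ ∈ spectrum ℝ M, c ≤ μ) (v : Fin d → ℝ) :
    c * ∑ a, v a ^ 2 ≤ ∑ a, ∑ b, v a * v b * M a b := by
  have hherm : (M - algebraMap ℝ _ c).IsHermitian := by
    refine hM.sub ?_
    rw [Matrix.algebraMap_eq_diagonal]
    exact Matrix.isHermitian_diagonal _
  have hps : (M - algebraMap ℝ _ c).PosSemidef := by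
    rw [Matrix.posSemidef_iff_isHermitian_and_spectrum_nonneg]
    refine ⟨hherm, fun μ hμ => ?_⟩
    rw [← spectrum.sub_singleton_eq] at hμ
    obtain ⟨ν, hν, r, hr, rfl⟩ := hμ
    rw [mem_singleton_iff.1 hr]
    exact sub_nonneg.2 (hc ν hν)
  have h := hps.dotProduct_mulVec_nonneg v
  rw [Matrix.sub_mulVec, dotProduct_sub, Algebra.algebraMap_eq_smul_one, Matrix.smul_mulVec,
    Matrix.one_mulVec, dotProduct_smul, sub_nonneg] at h
  simp only [dotProduct, Matrix.mulVec, star_trivial, smul_eq_mul, Finset.mul_sum] at h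
  rw [Finset.mul_sum]
  refine le_trans (le_of_eq ?_) (h.trans (le_of_eq ?_))
  · exact Finset.sum_congr rfl fun a _ => by ring
  · exact Finset.sum_congr rfl fun a _ => Finset.sum_congr rfl fun b _ => by ring

/-- A non-degenerate local design admits a weighted least squares line. -/
lemma exists_normal_equations {K : ℝ → ℝ} {n : ℕ} {h t c : ℝ} (hc : 0 < c)
    (hdes : ∀ a b : ℝ, c * (a ^ 2 + b ^ 2)
      ≤ ∑ i ∈ Finset.Icc 1 n, K (designPt n h t i) * (a + b * designPt n h t i) ^ 2) (g : ℕ → ℝ) :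
    ∃ a₀ a₁ : ℝ,
      ∑ i ∈ Finset.Icc 1 n, K (designPt n h t i) * (g i - (a₀ + a₁ * designPt n h t i)) = 0 ∧
      ∑ i ∈ Finset.Icc 1 n, K (designPt n h t i) *
        (designPt n h t i * (g i - (a₀ + a₁ * designPt n h t i))) = 0 := by
  set s : ℕ → ℝ := fun l => ∑ i ∈ Finset.Icc 1 n, K (designPt n h t i) * designPt n h t i ^ l
    with hs
  set w : ℕ → ℝ := fun l =>
    ∑ i ∈ Finset.Icc 1 n, K (designPt n h t i) * (designPt n h t i ^ l * g i) with hw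
  have hq : ∀ a b : ℝ, c * (a ^ 2 + b ^ 2) ≤ a ^ 2 * s 0 + 2 * a * b * s 1 + b ^ 2 * s 2 := by
    intro a b
    refine (hdes a b).trans (le_of_eq ?_)
    simp only [hs, Finset.mul_sum, ← Finset.sum_add_distrib]
    exact Finset.sum_congr rfl fun i _ => by ring
  have hs0 : 0 < s 0 := by
    have := hq 1 0
    norm_num at this
    linarith
  -- the value of the form at `(-s 1, s 0)` is `s 0` times the determinant
  have hdet : 0 < s 0 * s 2 - s 1 ^ 2 := by
    have h1 := hq (-s 1) (s 0)
    have h2 : 0 < c * ((-s 1) ^ 2 + s 0 ^ 2) := by positivity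
    have h3 : (-s 1) ^ 2 * s 0 + 2 * (-s 1) * s 0 * s 1 + s 0 ^ 2 * s 2
        = s 0 * (s 0 * s 2 - s 1 ^ 2) := by ring
    rw [h3] at h1
    exact pos_of_mul_pos_right (h2.trans_le h1) hs0.le
  set Δ := s 0 * s 2 - s 1 ^ 2 with hΔ
  refine ⟨(s 2 * w 0 - s 1 * w 1) / Δ, (s 0 * w 1 - s 1 * w 0) / Δ, ?_, ?_⟩
  · have e : ∀ a b : ℝ, ∑ i ∈ Finset.Icc 1 n,
        K (designPt n h t i) * (g i - (a + b * designPt n h t i)) = w 0 - (a * s 0 + b * s 1) := by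
      intro a b
      simp only [hs, hw, Finset.mul_sum, ← Finset.sum_add_distrib, ← Finset.sum_sub_distrib]
      exact Finset.sum_congr rfl fun i _ => by ring
    rw [e]
    have := hdet.ne'
    field_simp
    rw [hΔ]
    ring
  · have e : ∀ a b : ℝ, ∑ i ∈ Finset.Icc 1 n,
        K (designPt n h t i) * (designPt n h t i * (g i - (a + b * designPt n h t i)))
          = w 1 - (a * s 1 + b * s 2) := by
      intro a b
      simp only [hs, hw, Finset.mul_sum, ← Finset.sum_add_distrib, ← Finset.sum_sub_distrib]
      exact Finset.sum_congr rfl fun i _ => by ring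
    rw [e]
    have := hdet.ne'
    field_simp
    rw [hΔ]
    ring

lemma inner_eq_sum {d : ℕ} (x v : EuclideanSpace ℝ (Fin d)) : inner ℝ x v = ∑ a, x a * v a := by
  simp [PiLp.inner_apply, mul_comm]

lemma abs_apply_le_max {d : ℕ} (v₀ v₁ : EuclideanSpace ℝ (Fin d)) (a : Fin d) :
    |v₀ a| ≤ max ‖v₀‖ ‖v₁‖ ∧ |v₁ a| ≤ max ‖v₀‖ ‖v₁‖ :=
  ⟨(PiLp.norm_apply_le v₀ a).trans (le_max_left _ _),
    (PiLp.norm_apply_le v₁ a).trans (le_max_right _ _)⟩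

/-- If the local second moments of the covariates are close to their expectations, the regression
design is non-degenerate. -/
lemma mul_max_sq_le_sum_inner_sq {d n : ℕ} {K : ℝ → ℝ} (hK : IsKernel K) {h t c lam q : ℝ}
    (hc : 0 ≤ c) (hlam : 0 ≤ lam)
    (hdes : ∀ a b : ℝ, c * (a ^ 2 + b ^ 2)
      ≤ ∑ i ∈ Finset.Icc 1 n, K (designPt n h t i) * (a + b * designPt n h t i) ^ 2)
    {x : ℕ → EuclideanSpace ℝ (Fin d)} {M : ℕ → Fin d → Fin d → ℝ}
    (heig : ∀ i ∈ activeSet n h t, ∀ v : Fin d → ℝ,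
      lam * ∑ a, v a ^ 2 ≤ ∑ a, ∑ b, v a * v b * M i a b)
    (hdev : ∀ l ≤ 2, ∀ a b, |∑ i ∈ activeSet n h t, K (designPt n h t i) * designPt n h t i ^ l *
      (x i a * x i b - M i a b)| ≤ q) (v₀ v₁ : EuclideanSpace ℝ (Fin d)) :
    (lam * c - 4 * d ^ 2 * q) * (max ‖v₀‖ ‖v₁‖) ^ 2
      ≤ ∑ i ∈ Finset.Icc 1 n, K (designPt n h t i) *
        (inner ℝ (x i) (v₀ + designPt n h t i • v₁)) ^ 2 := by
  rw [sum_kernel_eq_sum_activeSet hK]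
  set D := max ‖v₀‖ ‖v₁‖ with hD
  have hD0 : 0 ≤ D := le_max_of_le_left (norm_nonneg _)
  set z := designPt n h t with hz
  set X : ℕ → Fin d → Fin d → ℝ := fun l a b =>
    ∑ i ∈ activeSet n h t, K (z i) * z i ^ l * (x i a * x i b - M i a b) with hX
  have hsplit : ∑ i ∈ activeSet n h t, K (z i) * (inner ℝ (x i) (v₀ + z i • v₁)) ^ 2
      = ∑ i ∈ activeSet n h t, K (z i) *
          ∑ a, ∑ b, (v₀ a + v₁ a * z i) * (v₀ b + v₁ b * z i) * M i a b
        + ∑ a, ∑ b, (v₀ a * v₀ b * X 0 a b + (v₀ a * v₁ b + v₁ a * v₀ b) * X 1 a b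
          + v₁ a * v₁ b * X 2 a b) := by
    have e : ∑ a, ∑ b, (v₀ a * v₀ b * X 0 a b + (v₀ a * v₁ b + v₁ a * v₀ b) * X 1 a b
          + v₁ a * v₁ b * X 2 a b)
        = ∑ i ∈ activeSet n h t, ∑ a, ∑ b, K (z i) *
          ((v₀ a + v₁ a * z i) * (v₀ b + v₁ b * z i) * (x i a * x i b - M i a b)) := by
      symm
      rw [Finset.sum_comm]
      refine Finset.sum_congr rfl fun a _ => ?_
      rw [Finset.sum_comm]
      refine Finset.sum_congr rfl fun b _ => ?_
      simp only [hX, Finset.mul_sum, ← Finset.sum_add_distrib]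
      exact Finset.sum_congr rfl fun i _ => by ring
    rw [e, ← Finset.sum_add_distrib]
    refine Finset.sum_congr rfl fun i _ => ?_
    rw [inner_eq_sum, sq, Finset.sum_mul_sum, Finset.mul_sum, Finset.mul_sum,
      ← Finset.sum_add_distrib]
    refine Finset.sum_congr rfl fun a _ => ?_
    rw [Finset.mul_sum, Finset.mul_sum, ← Finset.sum_add_distrib]
    refine Finset.sum_congr rfl fun b _ => ?_
    simp only [PiLp.add_apply, PiLp.smul_apply, smul_eq_mul]
    ring
  have hmain : lam * c * D ^ 2 ≤ ∑ i ∈ activeSet n h t, K (z i) *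
      ∑ a, ∑ b, (v₀ a + v₁ a * z i) * (v₀ b + v₁ b * z i) * M i a b := by
    have h1 : ∑ i ∈ activeSet n h t, K (z i) * (lam * ∑ a, (v₀ a + v₁ a * z i) ^ 2)
        ≤ ∑ i ∈ activeSet n h t, K (z i) *
          ∑ a, ∑ b, (v₀ a + v₁ a * z i) * (v₀ b + v₁ b * z i) * M i a b :=
      Finset.sum_le_sum fun i hi => mul_le_mul_of_nonneg_left
        (heig i hi fun a => v₀ a + v₁ a * z i) (hK.nonneg _)
    have h2 : ∑ i ∈ activeSet n h t, K (z i) * (lam * ∑ a, (v₀ a + v₁ a * z i) ^ 2)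
        = lam * ∑ a, ∑ i ∈ activeSet n h t, K (z i) * (v₀ a + v₁ a * z i) ^ 2 := by
      rw [Finset.sum_comm, Finset.mul_sum]
      refine Finset.sum_congr rfl fun i _ => ?_
      rw [Finset.mul_sum, Finset.mul_sum, Finset.mul_sum]
      exact Finset.sum_congr rfl fun a _ => by ring
    have h3 : c * D ^ 2 ≤ ∑ a, ∑ i ∈ activeSet n h t, K (z i) * (v₀ a + v₁ a * z i) ^ 2 := by
      calc c * D ^ 2 ≤ c * (‖v₀‖ ^ 2 + ‖v₁‖ ^ 2) := by
            refine mul_le_mul_of_nonneg_left ?_ hc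
            rcases max_cases ‖v₀‖ ‖v₁‖ with h5 | h5
            · rw [hD, h5.1]; nlinarith [sq_nonneg ‖v₁‖]
            · rw [hD, h5.1]; nlinarith [sq_nonneg ‖v₀‖]
        _ = ∑ a, c * (v₀ a ^ 2 + v₁ a ^ 2) := by
            rw [EuclideanSpace.real_norm_sq_eq, EuclideanSpace.real_norm_sq_eq,
              ← Finset.sum_add_distrib, Finset.mul_sum]
        _ ≤ _ := by
            refine Finset.sum_le_sum fun a _ => (hdes (v₀ a) (v₁ a)).trans (le_of_eq ?_)
            rw [sum_kernel_eq_sum_activeSet hK]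
    rw [h2] at h1
    have := mul_le_mul_of_nonneg_left h3 hlam
    linarith
  have herr : |∑ a, ∑ b, (v₀ a * v₀ b * X 0 a b + (v₀ a * v₁ b + v₁ a * v₀ b) * X 1 a b
      + v₁ a * v₁ b * X 2 a b)| ≤ 4 * d ^ 2 * q * D ^ 2 := by
    have hprod : ∀ s r y : ℝ, ∀ l ≤ 2, ∀ a b, |s| ≤ D → |r| ≤ D → y = X l a b →
        |s * r * y| ≤ D * D * q := by
      intro s r y l hl a b hs hr hy
      rw [abs_mul, abs_mul, hy]
      exact mul_le_mul (mul_le_mul hs hr (abs_nonneg _) hD0) (hdev l hl a b) (abs_nonneg _)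
        (by positivity)
    have hterm : ∀ a b, |v₀ a * v₀ b * X 0 a b + (v₀ a * v₁ b + v₁ a * v₀ b) * X 1 a b
        + v₁ a * v₁ b * X 2 a b| ≤ 4 * (D * D * q) := by
      intro a b
      obtain ⟨ha₀, ha₁⟩ := abs_apply_le_max v₀ v₁ a
      obtain ⟨hb₀, hb₁⟩ := abs_apply_le_max v₀ v₁ b
      have e1 := abs_le.1 (hprod _ _ _ 0 (by norm_num) a b ha₀ hb₀ rfl)
      have e2 := abs_le.1 (hprod _ _ _ 1 (by norm_num) a b ha₀ hb₁ rfl)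
      have e3 := abs_le.1 (hprod _ _ _ 1 (by norm_num) a b ha₁ hb₀ rfl)
      have e4 := abs_le.1 (hprod _ _ _ 2 le_rfl a b ha₁ hb₁ rfl)
      rw [abs_le]
      constructor <;> linarith [e1.1, e1.2, e2.1, e2.2, e3.1, e3.2, e4.1, e4.2]
    calc _ ≤ ∑ a : Fin d, ∑ b : Fin d, 4 * (D * D * q) :=
          (Finset.abs_sum_le_sum_abs _ _).trans (Finset.sum_le_sum fun a _ =>
            (Finset.abs_sum_le_sum_abs _ _).trans (Finset.sum_le_sum fun b _ => hterm a b))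
      _ = _ := by
          simp only [Finset.sum_const, Finset.card_univ, Fintype.card_fin, nsmul_eq_mul]
          ring
  rw [hsplit]
  have := (abs_le.1 herr).1
  linarith

lemma sum_mul_inner_le {d n : ℕ} {K : ℝ → ℝ} (hK : IsKernel K) {h t q : ℝ}
    {x : ℕ → EuclideanSpace ℝ (Fin d)} {r : ℕ → ℝ}
    (hq : ∀ l ≤ 1, ∀ a, |∑ i ∈ activeSet n h t,
      K (designPt n h t i) * designPt n h t i ^ l * (r i * x i a)| ≤ q)
    (v₀ v₁ : EuclideanSpace ℝ (Fin d)) :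
    ∑ i ∈ Finset.Icc 1 n, K (designPt n h t i) *
        (r i * inner ℝ (x i) (v₀ + designPt n h t i • v₁)) ≤ 2 * d * q * max ‖v₀‖ ‖v₁‖ := by
  rw [sum_kernel_eq_sum_activeSet hK]
  set D := max ‖v₀‖ ‖v₁‖ with hD
  have hD0 : 0 ≤ D := le_max_of_le_left (norm_nonneg _)
  set z := designPt n h t with hz
  set Q : ℕ → Fin d → ℝ := fun l a =>
    ∑ i ∈ activeSet n h t, K (z i) * z i ^ l * (r i * x i a) with hQ
  have hsplit : ∑ i ∈ activeSet n h t, K (z i) * (r i * inner ℝ (x i) (v₀ + z i • v₁))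
      = ∑ a, (v₀ a * Q 0 a + v₁ a * Q 1 a) := by
    simp only [hQ, Finset.mul_sum, ← Finset.sum_add_distrib, inner_eq_sum]
    rw [Finset.sum_comm]
    refine Finset.sum_congr rfl fun a _ => Finset.sum_congr rfl fun i _ => ?_
    simp only [PiLp.add_apply, PiLp.smul_apply, smul_eq_mul]
    ring
  rw [hsplit]
  calc _ ≤ ∑ a : Fin d, 2 * (D * q) := by
        refine Finset.sum_le_sum fun a _ => ?_
        obtain ⟨ha₀, ha₁⟩ := abs_apply_le_max v₀ v₁ a
        have h0 := le_abs_self (v₀ a * Q 0 a)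
        have h1 := le_abs_self (v₁ a * Q 1 a)
        rw [abs_mul] at h0 h1
        have h2 := mul_le_mul ha₀ (hq 0 (by norm_num) a) (abs_nonneg _) hD0
        have h3 := mul_le_mul ha₁ (hq 1 le_rfl a) (abs_nonneg _) hD0
        linarith
    _ = _ := by
        simp only [Finset.sum_const, Finset.card_univ, Fintype.card_fin, nsmul_eq_mul]
        ring

/-- The normal equations at the weighted least squares line of the coefficient curve: the products
of the covariates may be replaced by their expectations at `t`, and then the residuals of the line
are annihilated. -/
lemma abs_sum_residual_mul_le {d n : ℕ} {K : ℝ → ℝ} (hK : IsKernel K) {B : ℝ}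
    (hB : ∀ x, K x ≤ B) {h t : ℝ} (hh : 0 < h) (ht : h ≤ t) (hn : 1 ≤ n * h) {l : ℕ}
    {x ρ : ℕ → EuclideanSpace ℝ (Fin d)} {e : ℕ → ℝ} {M : ℕ → Fin d → Fin d → ℝ}
    {M' : Fin d → Fin d → ℝ} {q w R : ℝ} (hR : 0 ≤ R) (hw0 : 0 ≤ w)
    (hρ0 : ∀ b, ∑ i ∈ activeSet n h t, K (designPt n h t i) * designPt n h t i ^ l * ρ i b = 0)
    (hρ : ∀ i ∈ activeSet n h t, ∀ b, |ρ i b| ≤ R)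
    (hM : ∀ i ∈ activeSet n h t, ∀ a b, |M i a b - M' a b| ≤ w)
    (hdev : ∀ a b, |∑ i ∈ activeSet n h t, K (designPt n h t i) * designPt n h t i ^ l * ρ i b *
      (x i a * x i b - M i a b)| ≤ q)
    (he : ∀ a, |∑ i ∈ activeSet n h t,
      K (designPt n h t i) * designPt n h t i ^ l * (e i * x i a)| ≤ q) (a : Fin d) :
    |∑ i ∈ activeSet n h t, K (designPt n h t i) * designPt n h t i ^ l *
      ((inner ℝ (x i) (ρ i) + e i) * x i a)| ≤ d * (q + 3 * (n * h) * (B * (R * w))) + q := by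
  set z := designPt n h t with hz
  have hsplit : ∑ i ∈ activeSet n h t, K (z i) * z i ^ l * ((inner ℝ (x i) (ρ i) + e i) * x i a)
      = ∑ b, (∑ i ∈ activeSet n h t, K (z i) * z i ^ l * ρ i b * (x i a * x i b - M i a b)
          + ∑ i ∈ activeSet n h t, K (z i) * z i ^ l * (ρ i b * (M i a b - M' a b)))
        + ∑ i ∈ activeSet n h t, K (z i) * z i ^ l * (e i * x i a) := by
    have h1 : ∑ b, (∑ i ∈ activeSet n h t, K (z i) * z i ^ l * ρ i b * (x i a * x i b - M i a b)
          + ∑ i ∈ activeSet n h t, K (z i) * z i ^ l * (ρ i b * (M i a b - M' a b)))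
        = ∑ i ∈ activeSet n h t, ∑ b, K (z i) * z i ^ l * (x i b * ρ i b * x i a) := by
      rw [Finset.sum_comm]
      refine Finset.sum_congr rfl fun b _ => ?_
      rw [← sub_eq_zero, ← mul_zero (-M' a b), ← hρ0 b, Finset.mul_sum, ← Finset.sum_add_distrib,
        ← Finset.sum_sub_distrib]
      exact Finset.sum_congr rfl fun i _ => by ring
    rw [h1, ← Finset.sum_add_distrib]
    refine Finset.sum_congr rfl fun i _ => ?_
    rw [inner_eq_sum, add_mul, mul_add, Finset.sum_mul, Finset.mul_sum]
  rw [hsplit]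
  refine (abs_add_le _ _).trans (add_le_add ?_ (he a))
  refine (Finset.abs_sum_le_sum_abs _ _).trans ((Finset.sum_le_sum fun b _ =>
    (abs_add_le _ _).trans (add_le_add (hdev a b) (abs_sum_kernel_le hK hB hh ht hn l
      (V := R * w) (by positivity) fun i hi => ?_))).trans (le_of_eq ?_))
  · rw [abs_mul]
    exact mul_le_mul (hρ i hi b) (hM i hi a b) (abs_nonneg _) hR
  · simp only [Finset.sum_const, Finset.card_univ, Fintype.card_fin, nsmul_eq_mul]

end NormalEquations

/-! ### Consistency in the regression model -/

section Regression

lemma norm_regLocalLinear_sub_le_of_moments {d n : ℕ} {K : ℝ → ℝ} (hK : IsKernel K) {B : ℝ}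
    (hB : ∀ x, K x ≤ B) {h t c lam δ w R : ℝ} (hh : 0 < h) (ht : h ≤ t) (hn : 1 ≤ n * h)
    (hc : 0 < c) (hlam : 0 < lam) (hδ : 0 ≤ δ) (hδc : 8 * d ^ 2 * δ ≤ lam * c) (hw : 0 ≤ w)
    (hR : 0 ≤ R)
    (hdes : ∀ a b : ℝ, c * (n * h) * (a ^ 2 + b ^ 2)
      ≤ ∑ i ∈ Finset.Icc 1 n, K (designPt n h t i) * (a + b * designPt n h t i) ^ 2)
    {x μ ρ : ℕ → EuclideanSpace ℝ (Fin d)} {y e : ℕ → ℝ} {M : ℕ → Fin d → Fin d → ℝ}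
    {M' : Fin d → Fin d → ℝ} {θ₀ θ₁ : EuclideanSpace ℝ (Fin d)}
    (hy : ∀ i, y i = inner ℝ (x i) (μ i) + e i)
    (hρdef : ∀ i, ρ i = μ i - (θ₀ + designPt n h t i • θ₁))
    (hρ0 : ∀ l ≤ 1, ∀ b,
      ∑ i ∈ activeSet n h t, K (designPt n h t i) * designPt n h t i ^ l * ρ i b = 0)
    (hρ : ∀ i ∈ activeSet n h t, ∀ b, |ρ i b| ≤ R)
    (heig : ∀ i ∈ activeSet n h t, ∀ v : Fin d → ℝ,
      lam * ∑ a, v a ^ 2 ≤ ∑ a, ∑ b, v a * v b * M i a b)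
    (hM : ∀ i ∈ activeSet n h t, ∀ a b, |M i a b - M' a b| ≤ w)
    (hdev : ∀ l ≤ 2, ∀ a b, |∑ i ∈ activeSet n h t, K (designPt n h t i) * designPt n h t i ^ l *
      (x i a * x i b - M i a b)| ≤ δ * (n * h))
    (hdev' : ∀ l ≤ 1, ∀ a b, |∑ i ∈ activeSet n h t,
      K (designPt n h t i) * designPt n h t i ^ l * ρ i b * (x i a * x i b - M i a b)|
        ≤ δ * (n * h))
    (he : ∀ l ≤ 1, ∀ a, |∑ i ∈ activeSet n h t,
      K (designPt n h t i) * designPt n h t i ^ l * (e i * x i a)| ≤ δ * (n * h)) :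
    ‖regLocalLinear n K h x y t - θ₀‖
      ≤ 8 * d * (d * (δ + 3 * (B * (R * w))) + δ) / (lam * c) := by
  have hnh : 0 < n * h := by linarith
  have hB0 : 0 ≤ B := (hK.nonneg 0).trans (hB 0)
  set q := d * (δ * (n * h) + 3 * (n * h) * (B * (R * w))) + δ * (n * h) with hq
  have hq0 : 0 ≤ q := by positivity
  have hres : ∀ i, y i - inner ℝ (x i) (θ₀ + designPt n h t i • θ₁)
      = inner ℝ (x i) (ρ i) + e i := by
    intro i
    rw [hy, hρdef, inner_sub_right]
    ring
  have h1 := norm_regLocalLinear_sub_le (K := K) hh (c := lam * c * (n * h) / 2) (E := 2 * d * q)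
    (by positivity) (by positivity) x y θ₀ θ₁ (fun v₀ v₁ => by
      refine le_trans ?_ (mul_max_sq_le_sum_inner_sq hK (by positivity) hlam.le hdes heig hdev v₀ v₁)
      refine mul_le_mul_of_nonneg_right ?_ (sq_nonneg _)
      have := mul_le_mul_of_nonneg_right hδc hnh.le
      linarith)
    (fun v₀ v₁ => by
      simp only [hres]
      exact sum_mul_inner_le hK (fun l hl a => abs_sum_residual_mul_le hK hB hh ht hn hR hw
        (hρ0 l hl) hρ hM (hdev' l hl) (he l hl) a) v₀ v₁)
  refine h1.trans (le_of_eq ?_)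
  rw [hq, div_eq_div_iff (by positivity) (by positivity)]
  ring

lemma contrast_sub {s d : ℕ} (A : Matrix (Fin s) (Fin d) ℝ) (v w : EuclideanSpace ℝ (Fin d))
    (k : Fin s) : contrast A (v - w) k = contrast A v k - contrast A w k := by
  simp [contrast, mul_sub, Finset.sum_sub_distrib]

lemma contrast_add {s d : ℕ} (A : Matrix (Fin s) (Fin d) ℝ) (v w : EuclideanSpace ℝ (Fin d))
    (k : Fin s) : contrast A (v + w) k = contrast A v k + contrast A w k := by
  simp [contrast, mul_add, Finset.sum_add_distrib]

lemma contrast_smul {s d : ℕ} (A : Matrix (Fin s) (Fin d) ℝ) (r : ℝ)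
    (v : EuclideanSpace ℝ (Fin d)) (k : Fin s) : contrast A (r • v) k = r * contrast A v k := by
  simp only [contrast, PiLp.smul_apply, smul_eq_mul, Finset.mul_sum]
  exact Finset.sum_congr rfl fun a _ => by ring

lemma abs_contrast_le {s d : ℕ} (A : Matrix (Fin s) (Fin d) ℝ) (v : EuclideanSpace ℝ (Fin d))
    (k : Fin s) : |contrast A v k| ≤ (∑ k, ∑ a, |A k a|) * ‖v‖ := by
  calc |contrast A v k| ≤ ∑ a, |A k a| * ‖v‖ := by
        refine (Finset.abs_sum_le_sum_abs _ _).trans (Finset.sum_le_sum fun a _ => ?_)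
        rw [abs_mul]
        exact mul_le_mul_of_nonneg_left (PiLp.norm_apply_le v a) (abs_nonneg _)
    _ = (∑ a, |A k a|) * ‖v‖ := by rw [Finset.sum_mul]
    _ ≤ _ := by
        refine mul_le_mul_of_nonneg_right ?_ (norm_nonneg _)
        exact Finset.single_le_sum (f := fun k => ∑ a, |A k a|)
          (fun k _ => Finset.sum_nonneg fun a _ => abs_nonneg _) (Finset.mem_univ k)

/-- The weighted least squares line of a bounded coefficient curve, which need not be smooth. Its
residuals are bounded, and every smooth contrast of the curve is nearly the contrast of the
intercept. -/
lemma exists_weighted_least_squares {s d n : ℕ} {K : ℝ → ℝ} (hK : IsKernel K) {B : ℝ}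
    (hB : ∀ x, K x ≤ B) {h t c : ℝ} (hh : 0 < h) (ht : h ≤ t) (hn : 1 ≤ n * h) (hc : 0 < c)
    (hdes : ∀ a b : ℝ, c * (n * h) * (a ^ 2 + b ^ 2)
      ≤ ∑ i ∈ Finset.Icc 1 n, K (designPt n h t i) * (a + b * designPt n h t i) ^ 2)
    {m : ℝ → EuclideanSpace ℝ (Fin d)} {V : ℝ} (hV : 0 ≤ V)
    (hm : ∀ u ∈ Icc (0 : ℝ) 1, ‖m u‖ ≤ V) (A : Matrix (Fin s) (Fin d) ℝ) :
    ∃ θ₀ θ₁ : EuclideanSpace ℝ (Fin d),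
      (∀ l ≤ 1, ∀ b, ∑ i ∈ activeSet n h t, K (designPt n h t i) * designPt n h t i ^ l *
        (m ((i : ℝ) / n) - (θ₀ + designPt n h t i • θ₁)) b = 0) ∧
      (∀ i ∈ activeSet n h t, ∀ b,
        |(m ((i : ℝ) / n) - (θ₀ + designPt n h t i • θ₁)) b| ≤ V + 12 * B * V / c) ∧
      ∀ k, ∀ r W : ℝ, 0 ≤ W → (∀ u ∈ Icc (0 : ℝ) 1,
        |contrast A (m u) k - contrast A (m t) k - r * (u - t)| ≤ W * (u - t) ^ 2) →
        |contrast A θ₀ k - contrast A (m t) k| ≤ 6 * B * (W * h ^ 2) / c := by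
  have hnh : 0 < n * h := by linarith
  have hex := fun b => exists_normal_equations (mul_pos hc hnh) hdes
    fun i => m ((i : ℝ) / n) b
  choose a₀ a₁ ha₀ ha₁ using hex
  set z := designPt n h t with hz
  have hbd : ∀ b, |a₀ b| ≤ 6 * B * V / c ∧ |a₁ b| ≤ 6 * B * V / c := fun b =>
    abs_le_of_normal_equations hK hB hh ht hn hc hV hdes (fun i hi =>
      (PiLp.norm_apply_le _ b).trans (hm _ (div_mem_Icc_of_mem_activeSet hi))) (ha₀ b) (ha₁ b)
  have hcoord : ∀ (i : ℕ) b, (m ((i : ℝ) / n) - (WithLp.toLp 2 a₀ + z i • WithLp.toLp 2 a₁)) b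
      = m ((i : ℝ) / n) b - (a₀ b + a₁ b * z i) := by
    intro i b
    simp [mul_comm]
  refine ⟨WithLp.toLp 2 a₀, WithLp.toLp 2 a₁, fun l hl b => ?_, fun i hi b => ?_,
    fun k r W hW hquad => ?_⟩
  · simp only [hcoord]
    interval_cases l
    · rw [← ha₀ b, sum_kernel_eq_sum_activeSet hK]
      exact Finset.sum_congr rfl fun i _ => by ring
    · rw [← ha₁ b, sum_kernel_eq_sum_activeSet hK]
      exact Finset.sum_congr rfl fun i _ => by ring
  · rw [hcoord]
    have h1 : |m ((i : ℝ) / n) b| ≤ V :=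
      (PiLp.norm_apply_le _ b).trans (hm _ (div_mem_Icc_of_mem_activeSet hi))
    have h2 : |a₁ b * z i| ≤ |a₁ b| := by
      rw [abs_mul]
      exact mul_le_of_le_one_right (abs_nonneg _) (Finset.mem_filter.1 hi).2
    have h3 := abs_sub (m ((i : ℝ) / n) b) (a₀ b + a₁ b * z i)
    have h4 := abs_add_le (a₀ b) (a₁ b * z i)
    obtain ⟨h5, h6⟩ := hbd b
    have e : 12 * B * V / c = 6 * B * V / c + 6 * B * V / c := by ring
    linarith
  · -- the contrast of the line, recentred at the tangent, solves scalar normal equations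
    have hlin : ∀ i : ℕ, contrast A (m ((i : ℝ) / n)) k - contrast A (m t) k
          - r * ((i : ℝ) / n - t)
          - ((contrast A (WithLp.toLp 2 a₀) k - contrast A (m t) k)
            + (contrast A (WithLp.toLp 2 a₁) k - h * r) * z i)
        = ∑ b, A k b * (m ((i : ℝ) / n) b - (a₀ b + a₁ b * z i)) := by
      intro i
      have e : (i : ℝ) / n - t = h * z i := by
        rw [hz, designPt]; field_simp
      rw [e]
      simp only [← hcoord]
      change _ = contrast A (m ((i : ℝ) / n) - (WithLp.toLp 2 a₀ + z i • WithLp.toLp 2 a₁)) k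
      rw [contrast_sub, contrast_add, contrast_smul]
      ring
    have hsq : ∀ i ∈ activeSet n h t,
        |contrast A (m ((i : ℝ) / n)) k - contrast A (m t) k - r * ((i : ℝ) / n - t)|
          ≤ W * h ^ 2 := by
      intro i hi
      refine (hquad _ (div_mem_Icc_of_mem_activeSet hi)).trans (mul_le_mul_of_nonneg_left ?_ hW)
      exact sq_le_sq' (abs_le.1 (abs_sub_le_of_mem_activeSet hh hi)).1
        (abs_le.1 (abs_sub_le_of_mem_activeSet hh hi)).2
    refine (abs_le_of_normal_equations hK hB hh ht hn hc (by positivity) hdes hsq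
      (a₁ := contrast A (WithLp.toLp 2 a₁) k - h * r) ?_ ?_).1
    · calc _ = ∑ b, A k b * ∑ i ∈ Finset.Icc 1 n,
            K (z i) * (m ((i : ℝ) / n) b - (a₀ b + a₁ b * z i)) := by
            simp only [Finset.mul_sum]
            rw [Finset.sum_comm]
            refine Finset.sum_congr rfl fun i _ => ?_
            rw [← hz, hlin, Finset.mul_sum]
            exact Finset.sum_congr rfl fun b _ => by ring
        _ = 0 := Finset.sum_eq_zero fun b _ => by rw [ha₀ b, mul_zero]
    · calc _ = ∑ b, A k b * ∑ i ∈ Finset.Icc 1 n,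
            K (z i) * (z i * (m ((i : ℝ) / n) b - (a₀ b + a₁ b * z i))) := by
            simp only [Finset.mul_sum]
            rw [Finset.sum_comm]
            refine Finset.sum_congr rfl fun i _ => ?_
            rw [← hz, hlin, Finset.mul_sum, Finset.mul_sum]
            exact Finset.sum_congr rfl fun b _ => by ring
        _ = 0 := Finset.sum_eq_zero fun b _ => by rw [ha₁ b, mul_zero]

lemma isHermitian_secondMoment {Ω S : Type*} [MeasurableSpace Ω] {P : Measure Ω}
    {ε : ℤ → Ω → S} {d : ℕ} (H : ℝ → (ℕ → S) → EuclideanSpace ℝ (Fin d)) (t : ℝ) :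
    (secondMoment P ε H t).IsHermitian := by
  ext a b
  simp [secondMoment, mul_comm]

variable {Ω S : Type*} [MeasurableSpace Ω] [MeasurableSpace S]
  {P : Measure Ω} {ε : ℤ → Ω → S}

/-- In the regression model the contrasts of the local linear estimator are consistent for every
bandwidth of the order `h_r`. Only the contrasts of the coefficient curve are smooth, so the
estimator is compared with the weighted least squares line of the curve itself. -/
theorem RegressionCond.relConsistent (hε : IsInnovation P ε) {K : ℝ → ℝ} (hK : IsKernel K)
    {hr hd : ℕ → ℝ} {N : ℕ → ℕ} (hband : BandwidthCond hr hd N) {d s : ℕ} {hd0 : 0 < d}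
    (hs : 0 < s) {A : Matrix (Fin s) (Fin d) ℝ} {m : ℝ → EuclideanSpace ℝ (Fin d)}
    (hmb : ∃ V : ℝ, ∀ t ∈ Icc (0 : ℝ) 1, ‖m t‖ ≤ V)
    (hsm : SmoothFamily fun (k : Fin s) t => contrast A (m t) k)
    (hinc : UniformlyIncreasing fun (k : Fin s) t => contrast A (m t) k)
    {H : ℝ → (ℕ → S) → EuclideanSpace ℝ (Fin d)} {G : ℝ → (ℕ → S) → ℝ}
    (hreg : RegressionCond P ε hd0 H G)
    {x : ℕ → ℕ → Ω → EuclideanSpace ℝ (Fin d)} {y : ℕ → ℕ → Ω → ℝ}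
    (hx : ∀ n i ω, x n i ω = H ((i : ℝ) / n) (past ε i ω))
    (hy : ∀ n i ω, y n i ω
      = inner ℝ (x n i ω) (m ((i : ℝ) / n)) + G ((i : ℝ) / n) (past ε i ω))
    {b : ℕ → ℝ} (hb : UniformlyComparable (p := fun _ => 1) (fun n _ => b n) hr) :
    RelConsistent P (fun _ => s) (fun _ k t => contrast A (m t) k) fun n k ω t =>
      contrast A (regLocalLinear n K (b n) (fun i => x n i ω) (fun i => y n i ω) t) k := by
  have := hε.indep.isProbabilityMeasure
  intro κ hκ τ hτ e he
  obtain ⟨V, hV⟩ := hmb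
  have hV0 : 0 ≤ V := (norm_nonneg _).trans (hV 0 (by simp))
  obtain ⟨L, hL⟩ := hsm
  obtain ⟨M₀, hM₀, hM₀'⟩ := hinc
  obtain ⟨B, hB, hKB⟩ := hK.exists_le
  obtain ⟨C', hC', hcurve⟩ := exists_abs_sub_linear_le L.coe_nonneg hM₀ hτ.1
  obtain ⟨c, hc, C₀, hdes⟩ := hK.exists_design_bound
  obtain ⟨lam, hlam, heig⟩ := hreg.design_eigen
  obtain ⟨Ld, hLd⟩ := hreg.design_lipschitz
  obtain ⟨CH, hCH⟩ := hreg.moment_H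
  obtain ⟨LH, -, hLH⟩ := hreg.lipschitz_H
  obtain ⟨χ, hχ, CU, hdep⟩ := hreg.dep
  obtain ⟨VU, hVU⟩ := hreg.moment_U
  have hUm : ∀ u ∈ Icc (0 : ℝ) 1, Measurable (productFilter H G u) := fun u hu =>
    (hreg.meas_G u hu).smul (hreg.meas_H u hu)
  have happH := fun a a' => uniformlyApproximable_mul hε hreg.meas_H hCH hLH a a'
  have happU := fun a => uniformlyApproximable_of_physDep hε hUm (by norm_num) hχ hdep hVU a
  have hd1 : (0 : ℝ) < d := by exact_mod_cast hd0
  set CA := ∑ k, ∑ a, |A k a| + 1 with hCA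
  have hCA0 : 0 < CA := by
    have : 0 ≤ ∑ k, ∑ a, |A k a| :=
      Finset.sum_nonneg fun k _ => Finset.sum_nonneg fun a _ => abs_nonneg _
    linarith
  set R := V + 12 * B * V / c with hR
  have hR0 : 0 ≤ R := by positivity
  -- the stochastic error, the variation of the design and the bias are each allowed a small
  -- multiple of the slope
  set δ := min (lam * c / (8 * d ^ 2)) (κ * M₀ * (lam * c) / (64 * CA * d * (d + 1))) with hδ
  have hδ0 : 0 < δ := by positivity
  set ρ := min (min τ 1) (min (κ * c / (24 * B * C'))
    (κ * M₀ * (lam * c) / (192 * CA * d ^ 2 * B * (R + 1) * (Ld + 1)))) with hρ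
  have hρ0 : 0 < ρ := by have := hτ.1; positivity
  set e' := e / (s * (9 * d ^ 2)) with he'
  have hs1 : (0 : ℝ) < s := by exact_mod_cast hs
  have he'0 : 0 < e' := by positivity
  have hBR : 0 ≤ B * R := by positivity
  have hevV := eventually_all.2 fun a => eventually_all.2 fun a' =>
    (happH a a').eventually_sum_le hε hband hb hτ.1 hB.le hδ0 he'0
  have hevT := eventually_all.2 fun a => eventually_all.2 fun a' =>
    (happH a a').eventually_sum_le hε hband hb hτ.1 hBR hδ0 he'0
  have hevW := eventually_all.2 fun a =>
    (happU a).eventually_sum_le hε hband hb hτ.1 hB.le hδ0 he'0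
  filter_upwards [hb.eventually_window hband hρ0 (max 1 C₀), hevV, hevT, hevW]
    with n hwin hdV hdT hdW k t ht
  obtain ⟨hbρ, hbn⟩ := hwin 0
  have hb0 : 0 < b n := hb.1 n 0
  have hbτ : b n ≤ τ := hbρ.trans ((min_le_left _ _).trans (min_le_left _ _))
  have hb1 : b n ≤ 1 := hbρ.trans ((min_le_left _ _).trans (min_le_right _ _))
  have hbt : b n ≤ t := hbτ.trans ht.1
  have hbt' : b n ≤ 1 - t := hbτ.trans (by linarith [ht.2])
  have hn1 : 1 ≤ n * b n := (le_max_left _ _).trans hbn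
  have htI : t ∈ Icc (0 : ℝ) 1 := ⟨by linarith, by linarith⟩
  have hdes' := hdes n (b n) t hb0 hbt hbt' ((le_max_right _ _).trans hbn)
  obtain ⟨θ₀, θ₁, hθ, hθR, hθA⟩ := exists_weighted_least_squares hK hKB hb0 hbt hn1 hc hdes' hV0 hV A
  obtain ⟨hdf, hdf', hlip⟩ := hL k
  have hMk := hM₀' k
  dsimp only at hdf hdf' hlip hMk
  set slope := derivWithin (fun t => contrast A (m t) k) (Icc 0 1) t with hslope
  have hMs : M₀ ≤ slope := hMk t htI
  have hs0 : 0 < slope := hM₀.trans_le hMs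
  have hquad := hcurve (fun t => contrast A (m t) k) hdf hdf'
    (fun x hx y hy => by simpa [Real.dist_eq] using hlip.dist_le_mul x hx y hy) hMk t ht
  set I := activeSet n (b n) t with hI
  set z := designPt n (b n) t with hz
  set res : ℕ → EuclideanSpace ℝ (Fin d) := fun i => m ((i : ℝ) / n) - (θ₀ + z i • θ₁) with hres
  set EV : ℕ → Fin d → Fin d → Set Ω := fun l a a' => {ω | δ * (n * b n) ≤
    |∑ i ∈ I, K (z i) * z i ^ l * (H ((i : ℝ) / n) (past ε i ω) a * H ((i : ℝ) / n) (past ε i ω) a'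
      - ∫ ω', H ((i : ℝ) / n) (past ε 0 ω') a * H ((i : ℝ) / n) (past ε 0 ω') a' ∂P)|} with hEV
  set ET : ℕ → Fin d → Fin d → Set Ω := fun l a a' => {ω | δ * (n * b n) ≤
    |∑ i ∈ I, K (z i) * z i ^ l * res i a' *
      (H ((i : ℝ) / n) (past ε i ω) a * H ((i : ℝ) / n) (past ε i ω) a'
      - ∫ ω', H ((i : ℝ) / n) (past ε 0 ω') a * H ((i : ℝ) / n) (past ε 0 ω') a' ∂P)|} with hET
  set EW : ℕ → Fin d → Set Ω := fun l a => {ω | δ * (n * b n) ≤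
    |∑ i ∈ I, K (z i) * z i ^ l * (productFilter H G ((i : ℝ) / n) (past ε i ω) a
      - ∫ ω', productFilter H G ((i : ℝ) / n) (past ε 0 ω') a ∂P)|} with hEW
  have hPV : ∀ l a a', P (EV l a a') ≤ ENNReal.ofReal e' := fun l a a' =>
    hdV a a' 0 t ht _ fun i hi => abs_kernel_mul_pow_le hK hKB hi l
  have hPT : ∀ l a a', P (ET l a a') ≤ ENNReal.ofReal e' := fun l a a' =>
    hdT a a' 0 t ht _ fun i hi => by
      rw [abs_mul]
      exact mul_le_mul (abs_kernel_mul_pow_le hK hKB hi l) (hθR i hi a') (abs_nonneg _) hB.le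
  have hPW : ∀ l a, P (EW l a) ≤ ENNReal.ofReal e' := fun l a =>
    hdW a 0 t ht _ fun i hi => abs_kernel_mul_pow_le hK hKB hi l
  have hsub : {ω | κ * slope ≤ |contrast A (regLocalLinear n K (b n) (fun i => x n i ω)
        (fun i => y n i ω) t) k - contrast A (m t) k|} ⊆
      ⋃ l : Fin 3, ⋃ a, ⋃ a', (EV l a a' ∪ ET l a a') ∪ EW l a := by
    intro ω hω
    by_contra hcon
    simp only [mem_iUnion, mem_union, not_exists, not_or] at hcon
    have hω' : κ * slope ≤ |contrast A (regLocalLinear n K (b n) (fun i => x n i ω)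
        (fun i => y n i ω) t) k - contrast A (m t) k| := hω
    have hmean : ∀ i ∈ I, ∀ a, ∫ ω', productFilter H G ((i : ℝ) / n) (past ε 0 ω') a ∂P = 0 := by
      intro i hi a
      rw [← hreg.mean_zero n i (Finset.mem_filter.1 hi).1 a]
      exact (hε.integral_past i ((happU a).meas _ (div_mem_Icc_of_mem_activeSet hi))).symm
    have hl3 : ∀ l ≤ 2, ∀ a a', ω ∉ EV l a a' ∧ ω ∉ ET l a a' ∧ ω ∉ EW l a := fun l hl a a' =>
      ⟨(hcon ⟨l, by omega⟩ a a').1.1, (hcon ⟨l, by omega⟩ a a').1.2, (hcon ⟨l, by omega⟩ a a').2⟩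
    have hnorm := norm_regLocalLinear_sub_le_of_moments hK hKB (x := fun i => x n i ω)
      (y := fun i => y n i ω) (μ := fun i => m ((i : ℝ) / n)) (ρ := res)
      (e := fun i => G ((i : ℝ) / n) (past ε i ω))
      (M := fun i a a' => secondMoment P ε H ((i : ℝ) / n) a a')
      (M' := fun a a' => secondMoment P ε H t a a') (δ := δ) (w := Ld * b n) (R := R)
      hb0 hbt hn1 hc hlam hδ0.le (by
        have : δ ≤ lam * c / (8 * d ^ 2) := min_le_left _ _
        rw [le_div_iff₀ (by positivity)] at this
        linarith) (by positivity) hR0 hdes' (fun i => hy n i ω) (fun i => rfl) hθ hθR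
      (fun i hi v => mul_sum_sq_le_of_spectrum (isHermitian_secondMoment H _)
        (heig _ (div_mem_Icc_of_mem_activeSet hi)) v)
      (fun i hi a a' => by
        have h1 := (hLd a a').dist_le_mul _ (div_mem_Icc_of_mem_activeSet hi) _ htI
        rw [Real.dist_eq, Real.dist_eq] at h1
        exact h1.trans (mul_le_mul_of_nonneg_left (abs_sub_le_of_mem_activeSet hb0 hi)
          Ld.coe_nonneg))
      (fun l hl a a' => by
        simp only [hx]
        exact (not_le.1 (hl3 l hl a a').1).le)
      (fun l hl a a' => by
        simp only [hx]
        exact (not_le.1 (hl3 l (by omega) a a').2.1).le)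
      (fun l hl a => by
        have h1 := (hl3 l (by omega) a a).2.2
        simp only [hEW, mem_ofPred_eq, not_le] at h1
        simp only [hx]
        refine le_trans (le_of_eq ?_) h1.le
        congr 1
        refine Finset.sum_congr rfl fun i hi => ?_
        rw [hmean i hi a, sub_zero]
        rfl)
    set θ := regLocalLinear n K (b n) (fun i => x n i ω) (fun i => y n i ω) t with hθdef
    have h1 : |contrast A θ k - contrast A θ₀ k| ≤ κ * M₀ / 4 := by
      rw [← contrast_sub]
      refine (abs_contrast_le A _ k).trans ?_
      have hle : ∑ k, ∑ a, |A k a| ≤ CA := by linarith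
      refine (mul_le_mul hle hnorm (norm_nonneg _) hCA0.le).trans ?_
      have e1 : δ * (64 * CA * d * (d + 1)) ≤ κ * M₀ * (lam * c) := by
        rw [← le_div_iff₀ (by positivity)]
        exact min_le_right _ _
      have e2 : b n * (192 * CA * d ^ 2 * B * (R + 1) * (Ld + 1)) ≤ κ * M₀ * (lam * c) := by
        rw [← le_div_iff₀ (by positivity)]
        exact hbρ.trans ((min_le_right _ _).trans (min_le_right _ _))
      have e3 : b n * (192 * CA * d ^ 2 * B * R * Ld)
          ≤ b n * (192 * CA * d ^ 2 * B * (R + 1) * (Ld + 1)) := by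
        have : (0 : ℝ) ≤ Ld := Ld.coe_nonneg
        gcongr <;> linarith
      rw [mul_div_assoc', div_le_iff₀ (by positivity)]
      linarith
    have h2 : |contrast A θ₀ k - contrast A (m t) k| ≤ κ * slope / 4 := by
      refine (hθA k slope (C' * slope) (by positivity) hquad).trans ?_
      have h3 : b n ^ 2 ≤ κ * c / (24 * B * C') := by
        have h5 : b n ≤ κ * c / (24 * B * C') :=
          hbρ.trans ((min_le_right _ _).trans (min_le_left _ _))
        nlinarith
      rw [le_div_iff₀ (by positivity)] at h3
      rw [div_le_iff₀ hc]
      nlinarith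
    have h3 := abs_sub_le (contrast A θ k) (contrast A θ₀ k) (contrast A (m t) k)
    have h4 : κ * M₀ ≤ κ * slope := mul_le_mul_of_nonneg_left hMs hκ.le
    have h5 : 0 < κ * slope := mul_pos hκ hs0
    linarith
  have hsum : P (⋃ l : Fin 3, ⋃ a, ⋃ a', (EV l a a' ∪ ET l a a') ∪ EW l a)
      ≤ ENNReal.ofReal (9 * d ^ 2 * e') := by
    have hone : ∀ (l : Fin 3) a a', P ((EV l a a' ∪ ET l a a') ∪ EW l a)
        ≤ ENNReal.ofReal (3 * e') := by
      intro l a a'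
      refine (measure_union_le _ _).trans ((add_le_add ((measure_union_le _ _).trans
        (add_le_add (hPV l a a') (hPT l a a'))) (hPW l a)).trans (le_of_eq ?_))
      rw [← ENNReal.ofReal_add he'0.le he'0.le, ← ENNReal.ofReal_add (by positivity) he'0.le]
      congr 1
      ring
    refine (measure_iUnion_fintype_le _ _).trans ((Finset.sum_le_sum fun l _ =>
      (measure_iUnion_fintype_le _ _).trans (Finset.sum_le_sum fun a _ =>
        (measure_iUnion_fintype_le _ _).trans (Finset.sum_le_sum fun a' _ => hone l a a'))).trans
          (le_of_eq ?_))
    simp only [Finset.sum_const, Finset.card_univ, Fintype.card_fin, nsmul_eq_mul]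
    rw [← ENNReal.ofReal_natCast, ← ENNReal.ofReal_natCast, ← ENNReal.ofReal_mul (by positivity),
      ← ENNReal.ofReal_mul (by positivity), ← ENNReal.ofReal_mul (by positivity)]
    congr 1
    push_cast
    ring
  refine (mul_le_mul' le_rfl ((measure_mono hsub).trans hsum)).trans (le_of_eq ?_)
  rw [← ENNReal.ofReal_natCast, ← ENNReal.ofReal_mul (by positivity)]
  congr 1
  rw [he']
  field_simp

end Regression

end MonoSCB

end

theorem mainTheorem5
    {Ω S : Type*} [MeasurableSpace Ω] [MeasurableSpace S]
    (P : Measure Ω) [IsProbabilityMeasure P]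
    (ε : ℤ → Ω → S) (hε : MonoSCB.IsInnovation P ε)
    (Kd Kr : ℝ → ℝ) (hKd : MonoSCB.IsKernel Kd) (hKr : MonoSCB.IsKernel Kr)
    (hr hd : ℕ → ℝ) (N : ℕ → ℕ) (hband : MonoSCB.BandwidthCond hr hd N) :
    -- the high-dimensional trend model
    (∀ (p : ℕ → ℕ) (_ : ∀ n, 0 < p n)
      (hrk hdk : ∀ n, Fin (p n) → ℝ)
      (_ : MonoSCB.UniformlyComparable hrk hr) (_ : MonoSCB.UniformlyComparable hdk hd)
      (m : ∀ n, Fin (p n) → ℝ → ℝ)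
      (_ : MonoSCB.SmoothFamily fun i : Σ n, Fin (p n) => m i.1 i.2)
      (_ : MonoSCB.UniformlyIncreasing fun i : Σ n, Fin (p n) => m i.1 i.2)
      (Θ : ℕ → ℝ) (G : ∀ n, ℝ → (ℕ → S) → EuclideanSpace ℝ (Fin (p n)))
      (α χ q C : ℝ) (_ : α ∈ Ioo (0 : ℝ) 1) (_ : χ ∈ Ioo (0 : ℝ) 1) (_ : 2 ≤ q) (_ : 0 < C)
      (_ : MonoSCB.TrendErrorCond P ε p Θ G α χ q C)
      (y : ∀ n, ℕ → Fin (p n) → Ω → ℝ)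
      (_ : ∀ n i k ω, y n i k ω = m n k ((i : ℝ) / n) + G n ((i : ℝ) / n) (MonoSCB.past ε i ω) k),
      TendstoInMeasure P
        (fun n ω => volume.real (⋂ k : Fin (p n),
          MonoSCB.indexSet (N n) Kd (hd n) (hdk n k)
            (MonoSCB.jackknife n Kr (hrk n k) fun i => y n i k ω)
            (MonoSCB.localLinear n Kr (hrk n k) fun i => y n i k ω)))
        atTop (fun _ => 1) ∧
      TendstoInMeasure P
        (fun n ω => volume.real (⋂ k : Fin (p n),
          MonoSCB.indexSet (N n) Kd (hd n) (hdk n k)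
            (MonoSCB.jackknife n Kr (hrk n k) fun i => y n i k ω)
            (MonoSCB.jackknife n Kr (hrk n k) fun i => y n i k ω)))
        atTop (fun _ => 1)) ∧
    -- the time-varying coefficient regression model
    (∀ (d s : ℕ) (hd0 : 0 < d) (_ : 0 < s) (A : Matrix (Fin s) (Fin d) ℝ)
      (m : ℝ → EuclideanSpace ℝ (Fin d))
      (_ : ∃ B : ℝ, ∀ t ∈ Icc (0 : ℝ) 1, ‖m t‖ ≤ B)
      (_ : MonoSCB.SmoothFamily fun (k : Fin s) t => MonoSCB.contrast A (m t) k)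
      (_ : MonoSCB.UniformlyIncreasing fun (k : Fin s) t => MonoSCB.contrast A (m t) k)
      (H : ℝ → (ℕ → S) → EuclideanSpace ℝ (Fin d)) (G : ℝ → (ℕ → S) → ℝ)
      (_ : MonoSCB.RegressionCond P ε hd0 H G)
      (x : ℕ → ℕ → Ω → EuclideanSpace ℝ (Fin d)) (y : ℕ → ℕ → Ω → ℝ)
      (_ : ∀ n i ω, x n i ω = H ((i : ℝ) / n) (MonoSCB.past ε i ω))
      (_ : ∀ n i ω, y n i ω
        = inner ℝ (x n i ω) (m ((i : ℝ) / n)) + G ((i : ℝ) / n) (MonoSCB.past ε i ω)),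
      TendstoInMeasure P
        (fun n ω => volume.real (⋂ k : Fin s,
          MonoSCB.indexSet (N n) Kd (hd n) (hd n)
            (fun t => MonoSCB.contrast A
              (MonoSCB.regJackknife n Kr (hr n) (fun i => x n i ω) (fun i => y n i ω) t) k)
            (fun t => MonoSCB.contrast A
              (MonoSCB.regLocalLinear n Kr (hr n) (fun i => x n i ω) (fun i => y n i ω) t) k)))
        atTop (fun _ => 1) ∧
      TendstoInMeasure P
        (fun n ω => volume.real (⋂ k : Fin s,
          MonoSCB.indexSet (N n) Kd (hd n) (hd n)
            (fun t => MonoSCB.contrast A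
              (MonoSCB.regJackknife n Kr (hr n) (fun i => x n i ω) (fun i => y n i ω) t) k)
            (fun t => MonoSCB.contrast A
              (MonoSCB.regJackknife n Kr (hr n) (fun i => x n i ω) (fun i => y n i ω) t) k)))
        atTop (fun _ => 1)) := by
  have hsqrt : 0 < Real.sqrt 2 := Real.sqrt_pos.2 two_pos
  refine ⟨?_, ?_⟩
  · intro p hp hrk hdk hrk_cmp hdk_cmp m hsm hinc Θ G α χ q C hα hχ hq hC hG y hy
    have hLL := hG.relConsistent hε hKr hband hα hχ hq hC hsm hinc hy hrk_cmp
    have hJK : MonoSCB.RelConsistent P p m fun n k ω t =>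
        MonoSCB.jackknife n Kr (hrk n k) (fun i => y n i k ω) t :=
      hLL.jackknife (hG.relConsistent hε hKr hband hα hχ hq hC hsm hinc hy
        (hrk_cmp.div_const hsqrt))
    exact ⟨hJK.tendstoInMeasure hKd hband hp hdk_cmp hsm hinc hLL,
      hJK.tendstoInMeasure hKd hband hp hdk_cmp hsm hinc hJK⟩
  · intro d s hd0 hs A m hmb hsm hinc H G hreg x y hx hy
    have hcmp : ∀ {k : ℕ} {h : ℕ → ℝ}, (∀ n, 0 < h n) →
        MonoSCB.UniformlyComparable (p := fun _ => k) (fun n _ => h n) h := fun hpos =>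
      ⟨fun n _ => hpos n, 1, one_pos, 1, Eventually.of_forall fun n _ => by simp⟩
    have hLL := hreg.relConsistent hε hKr hband hs hmb hsm hinc hx hy (hcmp hband.hr_pos)
    have hJK : MonoSCB.RelConsistent P (fun _ => s) (fun _ k t => MonoSCB.contrast A (m t) k)
        fun n k ω t => MonoSCB.contrast A
          (MonoSCB.regJackknife n Kr (hr n) (fun i => x n i ω) (fun i => y n i ω) t) k := by
      simp only [MonoSCB.regJackknife, MonoSCB.contrast_sub, MonoSCB.contrast_smul]
      exact hLL.jackknife (hreg.relConsistent hε hKr hband hs hmb hsm hinc hx hy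
        ((hcmp hband.hr_pos).div_const hsqrt))
    have hsm' : MonoSCB.SmoothFamily fun (i : Σ _ : ℕ, Fin s) t =>
        MonoSCB.contrast A (m t) i.2 := hsm.imp fun _ hL i => hL i.2
    have hinc' : MonoSCB.UniformlyIncreasing fun (i : Σ _ : ℕ, Fin s) t =>
        MonoSCB.contrast A (m t) i.2 := hinc.imp fun _ hM => ⟨hM.1, fun i => hM.2 i.2⟩
    exact ⟨hJK.tendstoInMeasure hKd hband (fun _ => hs) (hcmp hband.hd_pos) hsm' hinc' hLL,
      hJK.tendstoInMeasure hKd hband (fun _ => hs) (hcmp hband.hd_pos) hsm' hinc' hJK⟩
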